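/- **Setting.** Let $p_n=2^{-n}$ and let $\Omega=\bigcup_{n\ge 0}[n,n+1]\times[0,p_n]$ be the exponential step billiard. For a slope $\alpha>0$ let $R_\alpha$ be its invariant surface: the planar region $\bigcup_{n\ge0}\{(X,Y): n\le |X|\le n+1,\ |Y|\le p_n\}$ in which the top and bottom sides of each box are identified by $(X,p_n)\sim(X,-p_n)$ for $n\le|X|\le n+1$, and the vertical walls by $(n,Y)\sim(-n,Y)$ for $n\ge1$, $p_n\le|Y|\le p_{n-1}$. The flow $\phi_\alpha^t$ ($t\in\mathbb R$) moves every point at unit speed in the direction $(1,\alpha)$, with these conventions at the singular vertices ($n\ge1$): a trajectory reaching $(n,p_n)$ from the left continues from $(-n,p_n)$; one reaching $(-n,p_n)$ from the left continues from $(-n,-p_n)$; one reaching $(n,-p_n)$ passes through. (So three phase points lie over each singular vertex; the topology is that of the surface.) Vertices are the points of $R_\alpha$ over the corners of $\Omega$: $(0,0)$, $(0,\pm1)$, $(\pm n,\pm p_n)$, $(\pm n,\pm p_{n-1})$, $n\ge1$. An orbit *escapes* (in the future) if from some time on it moves to $X=+\infty$ with constant positive $X$-velocity, never hitting a vertical wall;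 it *escapes in the past* if up to some time it comes in this way from $X=-\infty$. Let $L=\{0\}\times[-1,1)$, a closed curve, and let $E_\alpha^{(n)}\subset L$ be the set of points whose forward trajectory reaches the aperture $\{n\}\times[-p_n,p_n)$ without hitting a vertical wall. Let $D$ be the set of irrational $\alpha>0$ such that $E_\alpha^{(n)}$ is a single right-open interval of $L$ for infinitely many $n$, and such that the backward part of an escape orbit (up to and including its last crossing of $L$) contains no vertex. **Statement.** $D$ has full Lebesgue measure in $(0,\infty)$, and for every $\alpha\in D$ there is exactly one escape orbit $\eta$ and exactly one orbit $\eta'$ that escapes in the past, $\eta'\neq\eta$, and: 1. (i) $\eta$ is contained in the $\omega$-limit set of every orbit other than $\eta$, and in the $\alpha$-limit set of every orbit other than $\eta$ and $\eta'$ (the $\alpha$-limit set of $\eta'$ is empty, because $\eta'$ comes from infinity); 2. (ii) $\eta$ is contained in its own $\alpha$-limit set; 3. (iii) every continuous function $f:R_\alpha\to\mathbb R$ that is invariant under the flow is constant; 4. (iv) the flow is minimal (every orbit is dense) if and only if $\eta$ is dense. -/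

import Mathlib

open Set Filter Topology MeasureTheory

namespace StepBilliard

noncomputable section

/-- Half-height of the `k`-th box `[k, k+1] × [-h k, h k]` of the unfolded exponential step
billiard: `2⁻ᵏ` for `k ≥ 0`, and the mirror image `h (-k-1) = h k` for `k < 0`. -/
def h (k : ℤ) : ℝ := if 0 ≤ k then (2 : ℝ) ^ (-k) else (2 : ℝ) ^ (k + 1)

theorem h_pos (k : ℤ) : 0 < h k := by
  unfold h; split_ifs <;> positivity

theorem two_h_pos (k : ℤ) : 0 < 2 * h k := by
  have := h_pos k; linarith

theorem h_neg (k : ℤ) : h (-(k + 1)) = h k := by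
  unfold h
  rcases le_or_gt 0 k with hk | hk
  · rw [if_neg (by omega), if_pos hk]; congr 1; ring
  · rw [if_pos (by omega), if_neg (by omega)]; congr 1; ring

theorem h_mono {k : ℤ} (hk : k + 1 ≤ 0) : h k ≤ h (k + 1) := by
  unfold h
  rw [if_neg (by omega)]
  split_ifs with h0
  · have : k = -1 := by omega
    subst this; norm_num
  · exact zpow_le_zpow_right₀ (by norm_num) (by omega)

theorem h_anti {k : ℤ} (hk : 0 ≤ k) : h k ≤ h (k - 1) := by
  unfold h
  rw [if_pos hk]
  split_ifs with h0
  · exact zpow_le_zpow_right₀ (by norm_num) (by omega)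
  · have : k = 0 := by omega
    subst this; norm_num

/-! ### The surface -/

/-- The closed planar polygonal region `⋃ₖ [k, k+1] × [-h k, h k]`. -/
def Region : Set (ℝ × ℝ) :=
  {z | ∃ k : ℤ, (k : ℝ) ≤ z.1 ∧ z.1 ≤ k + 1 ∧ |z.2| ≤ h k}

/-- Side identifications: the top of each box is glued to its bottom, and each point `(n, y)` of
a vertical wall (`n ≥ 1`, `2⁻ⁿ ≤ |y| ≤ 2⁻⁽ⁿ⁻¹⁾`) is glued to `(-n, y)`. -/
def Glue (z w : Region) : Prop :=
  (∃ k : ℤ, (k : ℝ) ≤ z.1.1 ∧ z.1.1 ≤ k + 1 ∧ w.1.1 = z.1.1 ∧ z.1.2 = h k ∧ w.1.2 = -h k) ∨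
  (∃ n : ℕ, 1 ≤ n ∧ z.1.1 = n ∧ w.1.1 = -n ∧ w.1.2 = z.1.2 ∧ h n ≤ |z.1.2|)

/-- The invariant surface: the quotient of the region by the equivalence relation generated by
the side identifications, with the quotient topology. -/
def Surface : Type := Quot Glue

instance : TopologicalSpace Surface := inferInstanceAs (TopologicalSpace (Quot Glue))

/-! ### The phase space

A point of the phase space is a planar representative `(x, y)` taken in the half-open box
`[k, k+1) × [-h k, h k)`, `k = ⌊x⌋`. Every point of the surface other than a singular vertex has
exactly one such representative; the singular vertex `(±n, ±2⁻ⁿ)`, `n ≥ 1`, has three, one for each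
way in which a trajectory that hits it is continued: `(n, -2⁻ⁿ)`, `(-n, 2⁻ⁿ)`, `(-n, -2⁻ⁿ)`.
The topology is that of the surface. -/

@[ext]
structure Phase where
  x : ℝ
  y : ℝ
  mem : y ∈ Ico (-h ⌊x⌋) (h ⌊x⌋)

theorem Phase.mem_region (z : Phase) : (z.x, z.y) ∈ Region :=
  ⟨⌊z.x⌋, Int.floor_le _, (Int.lt_floor_add_one _).le, abs_le.2 ⟨z.mem.1, z.mem.2.le⟩⟩

/-- The point of the surface that a phase point represents. -/
def Phase.toSurface (z : Phase) : Surface := Quot.mk Glue ⟨(z.x, z.y), z.mem_region⟩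

instance : TopologicalSpace Phase := TopologicalSpace.induced Phase.toSurface inferInstance

/-! ### The flow -/

/-- The representative of `y` modulo `2 * h k` in `[-h k, h k)`. -/
def wrap (k : ℤ) (y : ℝ) : ℝ := toIcoMod (two_h_pos k) (-h k) y

theorem wrap_mem (k : ℤ) (y : ℝ) : wrap k y ∈ Ico (-h k) (h k) := by
  have := toIcoMod_mem_Ico (two_h_pos k) (-h k) y
  rw [show -h k + 2 * h k = h k by ring] at this
  exact this

theorem wrap_eq_self {k : ℤ} {y : ℝ} (hy : y ∈ Ico (-h k) (h k)) : wrap k y = y := by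
  unfold wrap
  rw [toIcoMod_eq_self]
  rwa [show -h k + 2 * h k = h k by ring]

theorem wrap_wrap_add (k : ℤ) (y a : ℝ) : wrap k (wrap k y + a) = wrap k (y + a) := by
  unfold wrap
  rw [toIcoMod_eq_toIcoMod]
  refine ⟨toIcoDiv (two_h_pos k) (-h k) y, ?_⟩
  have := toIcoMod_add_toIcoDiv_zsmul (two_h_pos k) (-h k) y
  linarith

/-- A point `(box, y)` of the left edge of the half-open box number `box`. The same type also
records points of the right edge of a box, before they are sent to the next box. -/
@[ext]
structure Edge where
  box : ℤ
  y : ℝ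
  mem : y ∈ Ico (-h box) (h box)

/-- Crossing a box from its left edge to its right edge in the direction `(1, α)`. -/
def cross (α : ℝ) : Equiv.Perm Edge where
  toFun s := ⟨s.box, wrap s.box (s.y + α), wrap_mem _ _⟩
  invFun s := ⟨s.box, wrap s.box (s.y + -α), wrap_mem _ _⟩
  left_inv s := by
    ext
    · rfl
    · simp only [wrap_wrap_add]
      rw [add_assoc, add_neg_cancel, add_zero, wrap_eq_self s.mem]
  right_inv s := by
    ext
    · rfl
    · simp only [wrap_wrap_add]
      rw [add_assoc, neg_add_cancel, add_zero, wrap_eq_self s.mem]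

/-- From the right edge of a box to the left edge of the next one. A point of height
`y ∈ [-h (k+1), h (k+1))` on the right edge of box `k` enters box `k+1`; otherwise
(only possible for `k ≥ 0`) it has hit the vertical wall `x = k+1`, and it continues from the
glued point `(-(k+1), y)`. -/
def transfer : Equiv.Perm Edge where
  toFun s := if hs : s.y ∈ Ico (-h (s.box + 1)) (h (s.box + 1)) then ⟨s.box + 1, s.y, hs⟩
    else ⟨-(s.box + 1), s.y, by rw [h_neg]; exact s.mem⟩
  invFun s := if hs : s.y ∈ Ico (-h (s.box - 1)) (h (s.box - 1)) then ⟨s.box - 1, s.y, hs⟩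
    else ⟨-s.box - 1, s.y, by
      rw [show -s.box - 1 = -(s.box + 1) by ring, h_neg]; exact s.mem⟩
  left_inv s := by
    obtain ⟨k, y, hy⟩ := s
    by_cases hs : y ∈ Ico (-h (k + 1)) (h (k + 1))
    · simp only [dif_pos hs, add_sub_cancel_right, dif_pos hy]
    · have hn : y ∉ Ico (-h (-(k + 1) - 1)) (h (-(k + 1) - 1)) := by
        rwa [show -(k + 1) - 1 = -((k + 1) + 1) by ring, h_neg]
      simp only [dif_neg hs, dif_neg hn]
      ext
      · simp
      · rfl
  right_inv s := by
    obtain ⟨k, y, hy⟩ := s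
    by_cases hs : y ∈ Ico (-h (k - 1)) (h (k - 1))
    · simp only [dif_pos hs, sub_add_cancel, dif_pos hy]
    · have hn : y ∉ Ico (-h (-k - 1 + 1)) (h (-k - 1 + 1)) := by
        rw [show -k - 1 + 1 = -((k - 1) + 1) by ring, h_neg]; exact hs
      simp only [dif_neg hs, dif_neg hn]
      ext
      · simp
      · rfl

/-- The map from left edge to left edge induced by the flow. -/
def step (α : ℝ) : Equiv.Perm Edge := (cross α).trans transfer

/-- The point of the left edge of its box from which a phase point is reached. -/
def Phase.base (α : ℝ) (z : Phase) : Edge :=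
  ⟨⌊z.x⌋, wrap ⌊z.x⌋ (z.y - α * Int.fract z.x), wrap_mem _ _⟩

/-- The point reached from a left edge after moving in the direction `(1, α)` inside the box by
the horizontal distance `Int.fract u`. -/
def Edge.advance (α : ℝ) (s : Edge) (u : ℝ) : Phase :=
  ⟨s.box + Int.fract u, wrap s.box (s.y + α * Int.fract u), by
    have : ⌊(s.box : ℝ) + Int.fract u⌋ = s.box := by
      rw [Int.floor_intCast_add, Int.floor_fract, add_zero]
    rw [this]; exact wrap_mem _ _⟩

/-- The constant horizontal velocity of a unit-speed particle moving in the direction `(1, α)`. -/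
def speed (α : ℝ) : ℝ := 1 / √(1 + α ^ 2)

/-- The billiard flow: unit-speed motion in the direction `(1, α)` on the surface. If `u` is the
horizontal distance from the left edge of the current box to the position at time `t`, measured
along the trajectory, then `⌊u⌋` boxes are traversed (backwards if negative). -/
def flow (α t : ℝ) (z : Phase) : Phase :=
  ((step α ^ ⌊Int.fract z.x + t * speed α⌋) (z.base α)).advance α (Int.fract z.x + t * speed α)

def orbit (α : ℝ) (z : Phase) : Set Phase := range fun t : ℝ => flow α t z

/-- From some time on, the trajectory travels to `+∞` with constant positive horizontal velocity,
that is, it never hits a vertical wall again. -/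
def Escapes (α : ℝ) (z : Phase) : Prop :=
  ∃ t₀ : ℝ, ∀ t ≥ t₀, (flow α t z).x = (flow α t₀ z).x + (t - t₀) * speed α

/-- Up to some time, the trajectory comes from `-∞` with constant positive horizontal velocity. -/
def EscapesInPast (α : ℝ) (z : Phase) : Prop :=
  ∃ t₀ : ℝ, ∀ t ≤ t₀, (flow α t z).x = (flow α t₀ z).x + (t - t₀) * speed α

def IsEscapeOrbit (α : ℝ) (O : Set Phase) : Prop := ∃ z, Escapes α z ∧ O = orbit α z

def IsPastEscapeOrbit (α : ℝ) (O : Set Phase) : Prop := ∃ z, EscapesInPast α z ∧ O = orbit α z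

/-- Every orbit is dense. -/
def IsMinimalFlow (α : ℝ) : Prop := ∀ z, Dense (orbit α z)

/-! ### Typical directions -/

theorem left_mem {y : ℝ} (hy : y ∈ Ico (-1 : ℝ) 1) :
    y ∈ Ico (-h ⌊(0 : ℝ)⌋) (h ⌊(0 : ℝ)⌋) := by
  simpa [h] using hy

/-- The point `(0, y)` of the closed curve `L = {0} × [-1, 1)`. -/
def onL (y : ℝ) (hy : y ∈ Ico (-1 : ℝ) 1) : Phase := ⟨0, y, left_mem hy⟩

/-- The set `E_α^{(n)}` of the `y` such that the forward trajectory of `(0, y)` reaches the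
aperture `{n} × [-2⁻ⁿ, 2⁻ⁿ)` without hitting a vertical wall. -/
def E (α : ℝ) (n : ℕ) : Set ℝ :=
  {y | ∃ hy : y ∈ Ico (-1 : ℝ) 1, ∀ i ≤ n, (flow α (i / speed α) (onL y hy)).x = i}

/-- The right-open arc from `a` to `b` of the closed curve `L ≃ ℝ / 2ℤ`. -/
def arc (a b : ℝ) : Set ℝ := {y | y ∈ Ico (-1 : ℝ) 1 ∧ ∃ k : ℤ, y + 2 * k ∈ Ico a b}

/-- The number of intervals of a subset of `L`: the least number of right-open arcs of which it
is the union (`0` also if there is no such number). -/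
def numIntervals (A : Set ℝ) : ℕ :=
  sInf {N : ℕ | ∃ a b : Fin N → ℝ, A = ⋃ i, arc (a i) (b i)}

/-- The phase points over the corners of the billiard table: `(0, 0)`, `(0, ±1)` and, for
`n ≥ 1`, `(±n, ±2⁻ⁿ)` and `(±n, ±2⁻⁽ⁿ⁻¹⁾)`. -/
def IsVertex (z : Phase) : Prop :=
  (z.x = 0 ∧ (z.y = 0 ∨ |z.y| = 1)) ∨
  ∃ n : ℕ, 1 ≤ n ∧ |z.x| = n ∧ (|z.y| = (2 : ℝ)⁻¹ ^ n ∨ |z.y| = (2 : ℝ)⁻¹ ^ (n - 1))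

/-- The typical directions: irrational slopes `α > 0` such that `E_α^{(n)}` is a single interval
for infinitely many `n`, and such that the backward part of an escape orbit, up to its last
crossing of `L`, contains no vertex. -/
def typicalDirections : Set ℝ :=
  {α | 0 < α ∧ Irrational α ∧ (∃ᶠ n : ℕ in atTop, numIntervals (E α n) = 1) ∧
    ∀ (y : ℝ) (hy : y ∈ Ico (-1 : ℝ) 1), (∀ n, y ∈ E α n) →
      ∀ t ≤ 0, ¬ IsVertex (flow α t (onL y hy))}

end

end StepBilliard

/-!
The flow in a direction of slope `α` is a suspension of the step map `step α` on the left edges of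
the boxes, and almost everything is proved for this map. Three facts carry the argument.

*Recurrence* (`exists_notMem_boxRange`). For irrational `α` no forward orbit stays in finitely many
boxes. Close the aperture at `x = N` by a wall. The points that the orbit does not meet or approach
from above form a set open to the right that contains its preimage under the truncated step map.
Over the rotation by `α` modulo `2⁻ᴺ` the number of its points in a fiber can only increase to the
right and along backward orbits, so by minimality of the rotation it is constant, and the set is
invariant. A left-hand discontinuity of its indicator would be transported along the half of a
two-sided orbit that avoids dyadic heights (at most one point of the orbit has dyadic height), which
is dense; but just above a fiber there are none. Hence the set is a union of whole boxes, thus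
everything or nothing, although it contains the points about to enter the aperture and misses the
orbit itself. Consequently every orbit that does not escape reaches every aperture infinitely often
(`IsEscapePoint.exists_ge_edgeL`).

*The escape orbit* (`exists_isEscapePoint`). The set `E α n` meets every class modulo `2 * 2⁻ⁿ` of
the circle `L` in exactly one point. If it is an interval, its ends are the points whose
trajectories meet the ends of the aperture number `n`. As `α` is irrational, two such intervals have
no end in common, so they are strictly nested, and infinitely many of them shrink to a point `y`
that is interior to all `E α n`: the last crossing of `L` by the only escape orbit `η`. An orbit
that reaches every aperture comes from points of `L` arbitrarily close to `y`, so it accumulates on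
`η`, since near `η` the flow is continuous: the forward part of `η` meets no singular vertex because
`y` is interior to all `E α n`, and the backward part meets none by assumption.

*Symmetries*. The reflection in the vertical axis conjugates `(step α)⁻¹` to `step (-α)`
(`step_neg_zpow_mirror`), so `(0, -y)` lies on the only orbit `η'` escaping in the past, and every
other orbit accumulates on `(0, -y)` in the past. The rotation by `π` reverses the flow away from
the vertices; it maps the backward part of `η` to the forward part of `η'`, which therefore meets no
vertex. If `η' = η`, the middle of the trajectory from `(0, -y)` to `(0, y)` would be fixed by the
rotation, hence a vertex (`IsEscapePoint.zpow_edgeL_neg_ne`). Now `η` lies in the `ω`-limit set of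
`η'`, and the forward part of `η'` lies in the `α`-limit set of every orbit other than `η'`, so `η`
lies in that `α`-limit set too, including its own. As `η` lies in the closure of every orbit, an
invariant continuous function is constant, and the flow is minimal as soon as `η` is dense.

*Almost every slope is typical*. Almost every `α` has infinitely many `N` with `8 * (N + 1) * fract
(2 ^ N * α) < 1`, that is, a run of about `log₂ N` zeros at the binary digit number `N`
(`ae_frequently_fract_lt`). If `E α n` is not an interval, it is interrupted at a point `t` whose
trajectory meets the end of an earlier aperture, number `j`, and a trajectory slightly below it
passes all apertures up to `n`. In units of the period at `x = i`, the height of the trajectory of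
`t` is, for `i ≥ j + 2`, equal to `2 ^ (i - 2) * (i - j) * α` modulo `1`. After a run of zeros has
begun, this quantity modulo `1` starts below `1/4`, and it at least doubles and at most triples at
each step, so it cannot jump over `[1/4, 3/4)`, which means hitting a wall
(`exists_mem_Ico_quarter`). Hence interruptions from before the run are gone at its end, and those
from within the run die at once. The same growth argument shows that the last crossing of `L` by an
escape orbit is not at a height `d + k * α` with `d` dyadic and `k : ℕ`, as it would be if the
backward part met a vertex (`sub_mul_notMem_dyadic`).
-/

namespace StepBilliard

/-! ### Heights, wrapping and edges -/

theorem h_of_nonneg {k : ℤ} (hk : 0 ≤ k) : h k = (2 : ℝ) ^ (-k) := if_pos hk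

theorem h_natCast (n : ℕ) : h n = (2 : ℝ)⁻¹ ^ n := by
  rw [h_of_nonneg (by positivity), zpow_neg, zpow_natCast, inv_pow]

@[simp] theorem h_zero : h 0 = 1 := by simp [h]

@[simp] theorem h_neg_one : h (-1) = 1 := by simp [h]

theorem h_eq_two_mul_succ {k : ℤ} (hk : 0 ≤ k) : h k = 2 * h (k + 1) := by
  rw [h_of_nonneg hk, h_of_nonneg (by omega), neg_add, zpow_add₀ two_ne_zero]
  norm_num
  ring

theorem h_succ_eq_two_mul {k : ℤ} (hk : k + 1 < 0) : h (k + 1) = 2 * h k := by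
  have := h_eq_two_mul_succ (k := -k - 2) (by omega)
  rw [show -k - 2 = -((k + 1) + 1) by ring, h_neg, show -(k + 1 + 1) + 1 = -(k + 1) by ring,
    h_neg] at this
  exact this

theorem h_neg_natCast_succ (n : ℕ) : h (-((n : ℤ) + 1)) = (2 : ℝ)⁻¹ ^ n := by
  rw [h_neg, h_natCast]

theorem wrap_eq_iff {k : ℤ} {y c : ℝ} :
    wrap k y = c ↔ c ∈ Ico (-h k) (h k) ∧ ∃ z : ℤ, y = c + z * (2 * h k) := by
  unfold wrap
  rw [toIcoMod_eq_iff, show -h k + 2 * h k = h k by ring]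
  simp

theorem exists_eq_wrap_add (k : ℤ) (y : ℝ) : ∃ z : ℤ, y = wrap k y + z * (2 * h k) :=
  (wrap_eq_iff.1 rfl).2

theorem wrap_congr {k k' : ℤ} (hk : h k = h k') (y : ℝ) : wrap k y = wrap k' y := by
  rw [wrap_eq_iff, hk]
  exact ⟨wrap_mem _ _, exists_eq_wrap_add _ _⟩

theorem wrap_add_int_mul (k : ℤ) (y : ℝ) (z : ℤ) : wrap k (y + z * (2 * h k)) = wrap k y := by
  obtain ⟨w, hw⟩ := exists_eq_wrap_add k y
  rw [wrap_eq_iff]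
  exact ⟨wrap_mem _ _, w + z, by push_cast; linarith⟩

@[simp] theorem cross_box (α : ℝ) (s : Edge) : (cross α s).box = s.box := rfl

@[simp] theorem cross_y (α : ℝ) (s : Edge) : (cross α s).y = wrap s.box (s.y + α) := rfl

@[simp] theorem transfer_y (s : Edge) : (transfer s).y = s.y := by
  change (dite _ _ _ : Edge).y = _
  split_ifs <;> rfl

theorem transfer_box_of_mem {s : Edge} (hs : s.y ∈ Ico (-h (s.box + 1)) (h (s.box + 1))) :
    (transfer s).box = s.box + 1 := by
  change (dite _ _ _ : Edge).box = _
  rw [dif_pos hs]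

theorem transfer_box_of_notMem {s : Edge} (hs : s.y ∉ Ico (-h (s.box + 1)) (h (s.box + 1))) :
    (transfer s).box = -(s.box + 1) := by
  change (dite _ _ _ : Edge).box = _
  rw [dif_neg hs]

@[simp] theorem transfer_symm_y (s : Edge) : (transfer.symm s).y = s.y := by
  change (dite _ _ _ : Edge).y = _
  split_ifs <;> rfl

theorem transfer_symm_box_of_mem {s : Edge} (hs : s.y ∈ Ico (-h (s.box - 1)) (h (s.box - 1))) :
    (transfer.symm s).box = s.box - 1 := by
  change (dite _ _ _ : Edge).box = _
  rw [dif_pos hs]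

theorem transfer_symm_box_of_notMem {s : Edge}
    (hs : s.y ∉ Ico (-h (s.box - 1)) (h (s.box - 1))) :
    (transfer.symm s).box = -s.box - 1 := by
  change (dite _ _ _ : Edge).box = _
  rw [dif_neg hs]

theorem h_mono_of_neg {k : ℤ} (hk : k < 0) : h k ≤ h (k + 1) := h_mono (by omega)

theorem transfer_box_of_neg {s : Edge} (hs : s.box < 0) : (transfer s).box = s.box + 1 := by
  apply transfer_box_of_mem
  have := h_mono_of_neg hs
  exact ⟨by linarith [s.mem.1], by linarith [s.mem.2]⟩

theorem transfer_symm_box_of_nonneg {s : Edge} (hs : 0 ≤ s.box) :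
    (transfer.symm s).box = s.box - 1 := by
  apply transfer_symm_box_of_mem
  have := h_anti hs
  exact ⟨by linarith [s.mem.1], by linarith [s.mem.2]⟩

theorem step_apply (α : ℝ) (s : Edge) : step α s = transfer (cross α s) := rfl

theorem step_symm_apply (α : ℝ) (s : Edge) : (step α).symm s = (cross α).symm (transfer.symm s) :=
  rfl

@[simp] theorem step_y (α : ℝ) (s : Edge) : (step α s).y = wrap s.box (s.y + α) := by
  rw [step_apply, transfer_y, cross_y]

theorem step_box_of_neg (α : ℝ) {s : Edge} (hs : s.box < 0) : (step α s).box = s.box + 1 :=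
  transfer_box_of_neg (s := cross α s) hs

theorem step_box_of_mem {α : ℝ} {s : Edge}
    (hs : wrap s.box (s.y + α) ∈ Ico (-h (s.box + 1)) (h (s.box + 1))) :
    (step α s).box = s.box + 1 :=
  transfer_box_of_mem (s := cross α s) hs

theorem step_box_of_notMem {α : ℝ} {s : Edge}
    (hs : wrap s.box (s.y + α) ∉ Ico (-h (s.box + 1)) (h (s.box + 1))) :
    (step α s).box = -(s.box + 1) :=
  transfer_box_of_notMem (s := cross α s) hs

theorem step_box_eq_or (α : ℝ) (s : Edge) :
    (step α s).box = s.box + 1 ∨ (step α s).box = -(s.box + 1) := by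
  by_cases hs : wrap s.box (s.y + α) ∈ Ico (-h (s.box + 1)) (h (s.box + 1))
  · exact Or.inl (step_box_of_mem hs)
  · exact Or.inr (step_box_of_notMem hs)

theorem step_symm_box_of_nonneg (α : ℝ) {s : Edge} (hs : 0 ≤ s.box) :
    ((step α).symm s).box = s.box - 1 := by
  rw [step_symm_apply]
  exact transfer_symm_box_of_nonneg hs

/-- Vertical displacement along the left edge of a box. -/
noncomputable def Edge.shift (s : Edge) (δ : ℝ) : Edge :=
  ⟨s.box, wrap s.box (s.y + δ), wrap_mem _ _⟩

@[simp] theorem Edge.shift_box (s : Edge) (δ : ℝ) : (s.shift δ).box = s.box := rfl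

@[simp] theorem Edge.shift_y (s : Edge) (δ : ℝ) : (s.shift δ).y = wrap s.box (s.y + δ) := rfl

@[simp] theorem Edge.shift_zero (s : Edge) : s.shift 0 = s := by
  ext
  · rfl
  · simp [wrap_eq_self s.mem]

@[simp] theorem Edge.shift_shift (s : Edge) (δ δ' : ℝ) :
    (s.shift δ).shift δ' = s.shift (δ + δ') := by
  ext
  · rfl
  · simp [wrap_wrap_add, add_assoc]

theorem Edge.shift_injective (δ : ℝ) : Function.Injective fun s : Edge => s.shift δ := by
  intro s t hst
  have := congrArg (fun u : Edge => u.shift (-δ)) hst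
  simpa using this

theorem cross_shift (α : ℝ) (s : Edge) (δ : ℝ) : cross α (s.shift δ) = (cross α s).shift δ := by
  ext
  · rfl
  · simp [wrap_wrap_add]
    congr 1; ring

/-- The singular phase points: those over the vertices `(±n, ±2⁻ⁿ)`, `n ≥ 1`. -/
def Edge.IsSingular (s : Edge) : Prop := s.box ≠ 0 ∧ |s.y| = h |s.box|

theorem mem_Ico_of_abs_lt {a δ l r : ℝ} (h1 : |δ| < a - l) (h2 : |δ| < r - a) :
    a + δ ∈ Ico l r := by
  have := abs_lt.1 h1
  have := abs_lt.1 h2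
  constructor <;> linarith

/-- The passage to the next box commutes with small vertical displacements: always with upward
ones, because apertures and walls are right-open, and with downward ones unless the image is a
singular vertex. -/
theorem exists_transfer_shift (s : Edge) : ∃ ε > 0, ∀ δ, |δ| < ε →
    0 ≤ δ ∨ ¬ (transfer s).IsSingular → transfer (s.shift δ) = (transfer s).shift δ := by
  obtain ⟨b, y, hy⟩ := s
  rcases eq_or_ne b (-1) with rfl | hb
  · -- Boxes `-1` and `0` have equal heights, and the whole edge is passed.
    refine ⟨1, one_pos, fun δ _ _ => ?_⟩
    have hm : ∀ s : Edge, s.box = -1 → s.y ∈ Ico (-h (s.box + 1)) (h (s.box + 1)) := by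
      rintro ⟨b, y, hy⟩ hb
      obtain rfl : b = -1 := hb
      simpa using hy
    have hbox : ∀ s : Edge, s.box = -1 → (transfer s).box = -1 + 1 := fun s hs => by
      rw [transfer_box_of_mem (hm s hs), hs]
    ext
    · rw [hbox _ rfl, Edge.shift_box, hbox _ rfl]
    · rw [transfer_y, Edge.shift_y, Edge.shift_y, transfer_y, hbox _ rfl]
      exact wrap_congr (by simp) _
  by_cases hs : y ∈ Ico (-h (b + 1)) (h (b + 1))
  · have hT : transfer ⟨b, y, hy⟩ = ⟨b + 1, y, hs⟩ := by
      ext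
      · exact transfer_box_of_mem hs
      · simp
    have key : ∀ δ, y + δ ∈ Ico (-h b) (h b) → y + δ ∈ Ico (-h (b + 1)) (h (b + 1)) →
        transfer (Edge.shift ⟨b, y, hy⟩ δ) = (transfer ⟨b, y, hy⟩).shift δ := by
      intro δ h1 h2
      have e1 : Edge.shift ⟨b, y, hy⟩ δ = ⟨b, y + δ, h1⟩ := by
        ext
        · rfl
        · exact wrap_eq_self h1
      rw [e1, hT]
      ext
      · exact transfer_box_of_mem (s := ⟨b, y + δ, h1⟩) h2
      · simp [wrap_eq_self h2]
    by_cases hsing : (transfer ⟨b, y, hy⟩).IsSingular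
    · refine ⟨min (h b - y) (h (b + 1) - y), lt_min (by linarith [hy.2]) (by linarith [hs.2]),
        fun δ hδ hδ' => ?_⟩
      have h0 : 0 ≤ δ := hδ'.resolve_right (not_not.2 hsing)
      rw [abs_of_nonneg h0] at hδ
      have := (lt_min_iff.1 hδ)
      exact key δ ⟨by linarith [hy.1], by linarith⟩ ⟨by linarith [hs.1], by linarith⟩
    · have hlow : -h b < y ∧ -h (b + 1) < y := by
        rw [hT] at hsing
        simp only [Edge.IsSingular, not_and] at hsing
        rcases lt_or_ge b 0 with hb0 | hb0
        · have h1 := h_succ_eq_two_mul (k := b) (by omega)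
          have hp := h_pos b
          have h2 : |y| ≠ h b := by
            have h3 := hsing (by omega)
            rwa [abs_of_neg (by omega : b + 1 < 0), h_neg] at h3
          have h4 : -h b < y := lt_of_le_of_ne hy.1 fun h5 => h2 (by
            rw [← h5, abs_neg, abs_of_pos hp])
          exact ⟨h4, by linarith⟩
        · have h1 := h_eq_two_mul_succ hb0
          have hp := h_pos (b + 1)
          have h2 : |y| ≠ h (b + 1) := by
            have h3 := hsing (by omega)
            rwa [abs_of_pos (by omega : 0 < b + 1)] at h3
          have h4 : -h (b + 1) < y :=
            lt_of_le_of_ne hs.1 fun h5 => h2 (by rw [← h5, abs_neg, abs_of_pos hp])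
          exact ⟨by linarith, h4⟩
      refine ⟨min (min (h b - y) (h (b + 1) - y)) (min (y + h b) (y + h (b + 1))),
        lt_min (lt_min (by linarith [hy.2]) (by linarith [hs.2]))
          (lt_min (by linarith) (by linarith)), fun δ hδ _ => ?_⟩
      simp only [lt_min_iff] at hδ
      obtain ⟨⟨h1, h2⟩, h3, h4⟩ := hδ
      exact key δ (mem_Ico_of_abs_lt (by linarith) (by linarith))
        (mem_Ico_of_abs_lt (by linarith) (by linarith))
  · have hb0 : 0 ≤ b := by
      by_contra hb0
      have := h_mono_of_neg (not_le.1 hb0)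
      exact hs ⟨by linarith [hy.1], by linarith [hy.2]⟩
    have h1 := h_eq_two_mul_succ hb0
    have hp := h_pos (b + 1)
    have hT : transfer ⟨b, y, hy⟩ = ⟨-(b + 1), y, by rw [h_neg]; exact hy⟩ := by
      ext
      · exact transfer_box_of_notMem hs
      · simp
    have key : ∀ δ, wrap b (y + δ) ∉ Ico (-h (b + 1)) (h (b + 1)) →
        transfer (Edge.shift ⟨b, y, hy⟩ δ) = (transfer ⟨b, y, hy⟩).shift δ := by
      intro δ h2
      rw [hT]
      ext
      · exact transfer_box_of_notMem (s := Edge.shift ⟨b, y, hy⟩ δ) h2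
      · simp only [transfer_y, Edge.shift_y]
        exact wrap_congr (h_neg b).symm _
    -- The wall is the arc from `h (b + 1)` to `3 * h (b + 1)` modulo `4 * h (b + 1)`.
    have wall : ∀ u : ℝ, (∃ z : ℤ, h (b + 1) ≤ u + z * (2 * h b) ∧
        u + z * (2 * h b) < 3 * h (b + 1)) → wrap b u ∉ Ico (-h (b + 1)) (h (b + 1)) := by
      rintro u ⟨z, hz1, hz2⟩ hu
      obtain ⟨w, hw⟩ := exists_eq_wrap_add b u
      have h3 : 0 < ((w + z : ℤ) : ℝ) * (2 * h b) := by push_cast; linarith [hu.2]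
      have h4 : ((w + z : ℤ) : ℝ) * (2 * h b) < 1 * (2 * h b) := by push_cast; linarith [hu.1]
      have h5 := pos_of_mul_pos_left h3 (by linarith)
      have h6 := lt_of_mul_lt_mul_right h4 (by linarith)
      have h7 : 0 < w + z := by exact_mod_cast h5
      have h8 : w + z < 1 := by exact_mod_cast h6
      omega
    rcases lt_or_ge y (h (b + 1)) with hyl | hyl
    · have hyl' : y < -h (b + 1) := by
        by_contra h2
        exact hs ⟨not_lt.1 h2, hyl⟩
      refine ⟨min (-h (b + 1) - y) (h (b + 1)), lt_min (by linarith) hp, fun δ hδ _ => ?_⟩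
      simp only [lt_min_iff, abs_lt] at hδ
      exact key δ (wall _ ⟨1, by push_cast; linarith [hy.1], by push_cast; linarith⟩)
    · by_cases hsing : (transfer ⟨b, y, hy⟩).IsSingular
      · refine ⟨h (b + 1), hp, fun δ hδ hδ' => ?_⟩
        have h0 : 0 ≤ δ := hδ'.resolve_right (not_not.2 hsing)
        rw [abs_of_nonneg h0] at hδ
        exact key δ (wall _ ⟨0, by push_cast; linarith, by push_cast; linarith [hy.2]⟩)
      · have h2 : h (b + 1) < y := by
          refine lt_of_le_of_ne hyl fun h5 => hsing ?_
          rw [hT]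
          refine ⟨by simp only; omega, ?_⟩
          simp only [abs_neg]
          rw [← h5, abs_of_pos hp, abs_of_pos (by omega : 0 < b + 1)]
        refine ⟨min (y - h (b + 1)) (h (b + 1)), lt_min (by linarith) hp, fun δ hδ _ => ?_⟩
        simp only [lt_min_iff, abs_lt] at hδ
        exact key δ (wall _ ⟨0, by push_cast; linarith, by push_cast; linarith [hy.2]⟩)

/-- The step map is a local translation from the right at every point, and from both sides where
it does not reach a singular vertex. -/
theorem exists_step_shift (α : ℝ) (s : Edge) : ∃ ε > 0, ∀ δ, |δ| < ε →
    0 ≤ δ ∨ ¬ (step α s).IsSingular → step α (s.shift δ) = (step α s).shift δ := by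
  obtain ⟨ε, hε, H⟩ := exists_transfer_shift (cross α s)
  refine ⟨ε, hε, fun δ hδ h' => ?_⟩
  rw [step_apply, cross_shift]
  exact H δ hδ h'

theorem exists_step_pow_shift (α : ℝ) (s : Edge) (n : ℕ)
    (hn : ∀ i, 1 ≤ i → i ≤ n → ¬ ((step α ^ i) s).IsSingular) :
    ∃ ε > 0, ∀ δ, |δ| < ε → ∀ i ≤ n, (step α ^ i) (s.shift δ) = ((step α ^ i) s).shift δ := by
  induction n with
  | zero => exact ⟨1, one_pos, fun δ _ i hi => by simp [Nat.le_zero.1 hi]⟩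
  | succ n ih =>
    obtain ⟨ε, hε, H⟩ := ih fun i h1 h2 => hn i h1 (by omega)
    obtain ⟨ε', hε', H'⟩ := exists_step_shift α ((step α ^ n) s)
    refine ⟨min ε ε', lt_min hε hε', fun δ hδ i hi => ?_⟩
    rw [lt_min_iff] at hδ
    rcases hi.lt_or_eq with h1 | rfl
    · exact H δ hδ.1 i (by omega)
    · have h2 := hn (n + 1) (by omega) le_rfl
      rw [pow_succ', Equiv.Perm.mul_apply] at h2 ⊢
      rw [H δ hδ.1 n le_rfl, H' δ hδ.2 (Or.inr h2), Equiv.Perm.mul_apply]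

/-! ### Dyadic rationals -/

/-- The dyadic rationals, as an additive subgroup of the reals. -/
def dyadic : AddSubgroup ℝ where
  carrier := {x | ∃ (n : ℕ) (a : ℤ), x * 2 ^ n = a}
  zero_mem' := ⟨0, 0, by simp⟩
  add_mem' := by
    rintro x y ⟨n, a, hx⟩ ⟨m, b, hy⟩
    refine ⟨n + m, a * 2 ^ m + b * 2 ^ n, ?_⟩
    push_cast
    rw [← hx, ← hy, pow_add]; ring
  neg_mem' := by
    rintro x ⟨n, a, hx⟩
    exact ⟨n, -a, by push_cast; rw [← hx]; ring⟩

theorem int_mem_dyadic (a : ℤ) : (a : ℝ) ∈ dyadic := ⟨0, a, by simp⟩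

theorem half_pow_mem_dyadic (n : ℕ) : (2 : ℝ)⁻¹ ^ n ∈ dyadic :=
  ⟨n, 1, by rw [← mul_pow]; norm_num⟩

theorem int_mul_mem_dyadic (a : ℤ) {x : ℝ} (hx : x ∈ dyadic) : a * x ∈ dyadic := by
  simpa using dyadic.zsmul_mem hx a

theorem h_mem_dyadic (k : ℤ) : h k ∈ dyadic := by
  rcases le_or_gt 0 k with hk | hk
  · obtain ⟨n, rfl⟩ := Int.eq_ofNat_of_zero_le hk
    rw [h_natCast]; exact half_pow_mem_dyadic n
  · obtain ⟨n, hn⟩ := Int.eq_ofNat_of_zero_le (by omega : 0 ≤ -k - 1)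
    rw [show k = -((n : ℤ) + 1) by omega, h_neg_natCast_succ]; exact half_pow_mem_dyadic n

theorem wrap_sub_mem_dyadic (k : ℤ) (y : ℝ) : wrap k y - y ∈ dyadic := by
  obtain ⟨z, hz⟩ := exists_eq_wrap_add k y
  have : wrap k y - y = -((2 * z : ℤ) * h k) := by push_cast; linarith
  rw [this]
  exact dyadic.neg_mem (int_mul_mem_dyadic _ (h_mem_dyadic k))

theorem eq_zero_of_int_mul_mem_dyadic {α : ℝ} (hα : Irrational α) {k : ℤ}
    (hk : k * α ∈ dyadic) : k = 0 := by
  by_contra h0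
  obtain ⟨n, a, ha⟩ := hk
  refine ((hα.intCast_mul h0).mul_natCast (pow_ne_zero n two_ne_zero)).ne_int a ?_
  rw [← ha]; push_cast; rfl

theorem step_y_sub_mem_dyadic (α : ℝ) (s : Edge) : (step α s).y - s.y - α ∈ dyadic := by
  rw [step_y, sub_sub]
  exact wrap_sub_mem_dyadic _ _

theorem step_pow_y_sub_mem_dyadic (α : ℝ) (s : Edge) (n : ℕ) :
    ((step α ^ n) s).y - s.y - n * α ∈ dyadic := by
  induction n with
  | zero => simp
  | succ n ih =>
    have := dyadic.add_mem (step_y_sub_mem_dyadic α ((step α ^ n) s)) ih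
    rw [pow_succ', Equiv.Perm.mul_apply]
    convert this using 1
    push_cast; ring

theorem Edge.IsSingular.y_mem_dyadic {s : Edge} (hs : s.IsSingular) : s.y ∈ dyadic := by
  rcases eq_or_eq_neg_of_abs_eq hs.2 with h1 | h1 <;> rw [h1]
  · exact h_mem_dyadic _
  · exact dyadic.neg_mem (h_mem_dyadic _)

/-! ### Recurrence: orbits leave every bounded part of the surface -/

/-- Forward orbits of irrational rotations are dense. -/
theorem exists_nat_mul_add_int_mul_mem_Ioo {α p : ℝ} (hα : Irrational (α / p)) (hp : 0 < p)
    (θ c : ℝ) {ε : ℝ} (hε : 0 < ε) :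
    ∃ (i : ℕ) (l : ℤ), θ + i * α + l * p ∈ Ioo c (c + ε) := by
  obtain ⟨x, hx, hx0, hxε⟩ := (dense_addSubgroupClosure_pair_iff.2 hα).exists_between
    (lt_min hε hp)
  obtain ⟨m, l, rfl⟩ := AddSubgroup.mem_closure_pair.1 hx
  simp only [zsmul_eq_mul, lt_min_iff] at hx0 hxε
  have hm : m ≠ 0 := by
    rintro rfl
    simp only [Int.cast_zero, zero_mul, zero_add] at hx0 hxε
    have h1 := pos_of_mul_pos_left hx0 hp.le
    have h2 : (l : ℝ) < 1 := by
      by_contra h3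
      nlinarith [hxε.2]
    have h3 : 0 < l := by exact_mod_cast h1
    have h4 : l < 1 := by exact_mod_cast h2
    omega
  set x := (m : ℝ) * α + l * p with hxdef
  rcases lt_or_gt_of_ne hm with hm | hm
  · obtain ⟨L, hL⟩ := exists_nat_gt ((c + ε - θ) / p)
    rw [div_lt_iff₀ hp] at hL
    set t := ⌊(θ + L * p - c - ε) / x⌋₊ with ht
    have h1 := Nat.floor_le (a := (θ + L * p - c - ε) / x)
      (div_nonneg (by linarith) hx0.le)
    have h2 := Nat.lt_floor_add_one ((θ + L * p - c - ε) / x)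
    rw [← ht, le_div_iff₀ hx0] at h1
    rw [← ht, div_lt_iff₀ hx0] at h2
    refine ⟨(t + 1) * m.natAbs, L - (t + 1) * l, ?_⟩
    have h3 : ((m.natAbs : ℕ) : ℝ) = -m := by
      rw [Nat.cast_natAbs, abs_of_neg hm]; push_cast; ring
    push_cast
    rw [h3]
    have : θ + (t + 1) * -(m : ℝ) * α + (L - (t + 1) * l) * p = θ + L * p - (t + 1) * x := by
      rw [hxdef]; ring
    rw [this]
    constructor <;> linarith
  · obtain ⟨L, hL⟩ := exists_nat_gt ((θ - c) / p)
    rw [div_lt_iff₀ hp] at hL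
    set t := ⌊(c - θ + L * p) / x⌋₊ with ht
    have h1 := Nat.floor_le (a := (c - θ + L * p) / x) (div_nonneg (by linarith) hx0.le)
    have h2 := Nat.lt_floor_add_one ((c - θ + L * p) / x)
    rw [← ht, le_div_iff₀ hx0] at h1
    rw [← ht, div_lt_iff₀ hx0] at h2
    refine ⟨(t + 1) * m.natAbs, (t + 1) * l - L, ?_⟩
    have h3 : ((m.natAbs : ℕ) : ℝ) = m := by
      rw [Nat.cast_natAbs, abs_of_pos hm]
    push_cast
    rw [h3]
    have : θ + (t + 1) * (m : ℝ) * α + ((t + 1) * l - L) * p = θ - L * p + (t + 1) * x := by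
      rw [hxdef]; ring
    rw [this]
    constructor <;> linarith

theorem h_neg_eq_h_sub_one (k : ℤ) : h (-k) = h (k - 1) := by
  rw [← h_neg]; congr 1; ring

theorem h_natCast_le_h_neg (N : ℕ) : h N ≤ h (-N) := by
  rw [h_neg_eq_h_sub_one]; exact h_anti (by positivity)

theorem h_le_one (k : ℤ) : h k ≤ 1 := by
  rcases le_or_gt 0 k with hk | hk
  · obtain ⟨n, rfl⟩ := Int.eq_ofNat_of_zero_le hk
    rw [h_natCast]; exact pow_le_one₀ (by norm_num) (by norm_num)
  · obtain ⟨n, hn⟩ := Int.eq_ofNat_of_zero_le (by omega : 0 ≤ -k - 1)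
    rw [show k = -((n : ℤ) + 1) by omega, h_neg_natCast_succ]
    exact pow_le_one₀ (by norm_num) (by norm_num)

/-- The left edges of the boxes `-N, …, N - 1`. -/
def boxRange (N : ℕ) : Set Edge := {e | -(N : ℤ) ≤ e.box ∧ e.box < N}

open Classical in
/-- The step map of the truncated surface, whose aperture at `x = N` is replaced by a wall, glued
like the other walls to its mirror image at `x = -N`. -/
noncomputable def truncStep (α : ℝ) (N : ℕ) (e : Edge) : Edge :=
  if hs : (step α e).box = N then ⟨-N, (step α e).y, by
    have h1 := h_natCast_le_h_neg N
    have h2 := (step α e).mem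
    rw [hs] at h2
    exact ⟨by linarith [h2.1], by linarith [h2.2]⟩⟩
  else step α e

open Classical in
/-- The inverse of `truncStep α N` on `boxRange N`. -/
noncomputable def truncStepInv (α : ℝ) (N : ℕ) (e : Edge) : Edge :=
  if he : e.box = -N ∧ e.y ∈ Ico (-h N) (h N) then (step α).symm ⟨N, e.y, he.2⟩
  else (step α).symm e

theorem truncStep_y (α : ℝ) (N : ℕ) (e : Edge) : (truncStep α N e).y = (step α e).y := by
  unfold truncStep; split_ifs <;> rfl

theorem truncStep_of_ne {α : ℝ} {N : ℕ} {e : Edge} (he : (step α e).box ≠ N) :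
    truncStep α N e = step α e := dif_neg he

theorem truncStep_box_of_eq {α : ℝ} {N : ℕ} {e : Edge} (he : (step α e).box = N) :
    (truncStep α N e).box = -N := by
  unfold truncStep; rw [dif_pos he]

theorem truncStep_mem_boxRange (α : ℝ) {N : ℕ} (hN : 1 ≤ N) {e : Edge} (he : e ∈ boxRange N) :
    truncStep α N e ∈ boxRange N := by
  obtain ⟨h1, h2⟩ := he
  by_cases hs : (step α e).box = N
  · have := truncStep_box_of_eq hs
    constructor <;> omega
  · rw [truncStep_of_ne hs]
    rcases step_box_eq_or α e with h3 | h3 <;> constructor <;> omega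

theorem truncStep_truncStepInv (α : ℝ) {N : ℕ} {e : Edge} (he : e ∈ boxRange N) :
    truncStep α N (truncStepInv α N e) = e := by
  unfold truncStepInv
  split_ifs with h1
  · have h2 : step α ((step α).symm ⟨N, e.y, h1.2⟩) = ⟨N, e.y, h1.2⟩ :=
      Equiv.apply_symm_apply _ _
    ext
    · rw [truncStep_box_of_eq (by rw [h2]), h1.1]
    · rw [truncStep_y, h2]
  · rw [truncStep_of_ne] <;> rw [Equiv.apply_symm_apply]
    exact he.2.ne

theorem truncStepInv_mem_boxRange (α : ℝ) {N : ℕ} (hN : 1 ≤ N) {e : Edge} (he : e ∈ boxRange N) :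
    truncStepInv α N e ∈ boxRange N := by
  obtain ⟨h1, h2⟩ := he
  unfold truncStepInv
  split_ifs with h3
  · have h4 := step_symm_box_of_nonneg α (s := ⟨N, e.y, h3.2⟩) (by positivity)
    constructor <;> rw [h4] <;> simp only <;> omega
  · rcases le_or_gt 0 e.box with h4 | h4
    · have h5 := step_symm_box_of_nonneg α h4
      constructor <;> omega
    · have h5 : ((step α).symm e).box = (transfer.symm e).box := rfl
      by_cases h6 : e.y ∈ Ico (-h (e.box - 1)) (h (e.box - 1))
      · have h7 : e.box ≠ -N := by
          intro h8
          refine h3 ⟨h8, ?_⟩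
          rwa [h8, show -(N : ℤ) - 1 = -(N + 1) by ring, h_neg] at h6
        rw [transfer_symm_box_of_mem h6] at h5
        constructor <;> omega
      · rw [transfer_symm_box_of_notMem h6] at h5
        constructor <;> omega

/-- The truncated step map is a local translation, except on the left of points that are sent to
points of dyadic height. -/
theorem exists_truncStep_shift (α : ℝ) (N : ℕ) (e : Edge) : ∃ ε > 0, ∀ δ, |δ| < ε →
    0 ≤ δ ∨ (truncStep α N e).y ∉ dyadic →
      truncStep α N (e.shift δ) = (truncStep α N e).shift δ := by
  obtain ⟨ε, hε, H⟩ := exists_step_shift α e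
  by_cases hs : (step α e).box = N
  · have hm := (step α e).mem
    rw [hs] at hm
    have hd : 0 < (if (step α e).y = -h N then 1 else (step α e).y + h N) := by
      split_ifs with h1
      · exact one_pos
      · have := lt_of_le_of_ne hm.1 (Ne.symm h1)
        linarith
    refine ⟨min ε (min (h N - (step α e).y) _), lt_min hε (lt_min (by linarith [hm.2]) hd),
      fun δ hδ h' => ?_⟩
    simp only [lt_min_iff] at hδ
    rw [truncStep_y] at h'
    have h1 : 0 ≤ δ ∨ ¬ (step α e).IsSingular := h'.imp_right fun h2 h3 => h2 h3.y_mem_dyadic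
    have h2 := H δ hδ.1 h1
    have h3 : (step α (e.shift δ)).box = N := by rw [h2]; exact hs
    have h4 : (step α e).y + δ ∈ Ico (-h N) (h N) := by
      rcases h' with h5 | h5
      · rw [abs_of_nonneg h5] at hδ
        exact ⟨by linarith [hm.1], by linarith⟩
      · rw [if_neg] at hδ
        · exact mem_Ico_of_abs_lt (by linarith) (by linarith)
        · intro h6
          rw [h6] at h5
          exact h5 (dyadic.neg_mem (h_mem_dyadic _))
    have h5 := h_natCast_le_h_neg N
    ext
    · rw [truncStep_box_of_eq h3, Edge.shift_box, truncStep_box_of_eq hs]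
    · rw [truncStep_y, h2, Edge.shift_y, Edge.shift_y, truncStep_y, hs, wrap_eq_self h4,
        truncStep_box_of_eq hs, wrap_eq_self ⟨by linarith [h4.1], by linarith [h4.2]⟩]
  · refine ⟨ε, hε, fun δ hδ h' => ?_⟩
    rw [truncStep_of_ne hs] at h' ⊢
    have h2 := H δ hδ (h'.imp_right fun h2 h3 => h2 h3.y_mem_dyadic)
    rw [truncStep_of_ne (by rw [h2]; exact hs), h2]

/-- The points of `boxRange N` whose height is `θ` modulo `2⁻ᴺ`. -/
def fiber (N : ℕ) (θ : ℝ) : Set Edge :=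
  {e | e ∈ boxRange N ∧ ∃ l : ℤ, e.y = θ + l * (2 : ℝ)⁻¹ ^ N}

theorem exists_two_mul_h_eq {N : ℕ} {e : Edge} (he : e ∈ boxRange N) :
    ∃ m : ℤ, 2 * h e.box = m * (2 : ℝ)⁻¹ ^ N := by
  have key : ∀ n : ℕ, n ≤ N → ∃ m : ℤ, 2 * (2 : ℝ)⁻¹ ^ n = m * (2 : ℝ)⁻¹ ^ N := by
    intro n hn
    obtain ⟨k, rfl⟩ := Nat.exists_eq_add_of_le hn
    refine ⟨2 * 2 ^ k, ?_⟩
    push_cast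
    rw [pow_add, mul_assoc, mul_left_comm ((2 : ℝ) ^ k), ← mul_pow]
    norm_num
  obtain ⟨h1, h2⟩ := he
  rcases le_or_gt 0 e.box with hk | hk
  · obtain ⟨n, hn⟩ := Int.eq_ofNat_of_zero_le hk
    rw [hn, h_natCast]; exact key n (by omega)
  · obtain ⟨n, hn⟩ := Int.eq_ofNat_of_zero_le (by omega : 0 ≤ -e.box - 1)
    rw [show e.box = -((n : ℤ) + 1) by omega, h_neg_natCast_succ]; exact key n (by omega)

theorem exists_wrap_eq_add {N : ℕ} {e : Edge} (he : e ∈ boxRange N) (y : ℝ) :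
    ∃ l : ℤ, wrap e.box y = y + l * (2 : ℝ)⁻¹ ^ N := by
  obtain ⟨m, hm⟩ := exists_two_mul_h_eq he
  obtain ⟨z, hz⟩ := exists_eq_wrap_add e.box y
  rw [hm] at hz
  exact ⟨-(z * m), by push_cast; linarith⟩

theorem shift_mem_fiber {N : ℕ} {θ : ℝ} {e : Edge} (he : e ∈ fiber N θ) (δ : ℝ) :
    e.shift δ ∈ fiber N (θ + δ) := by
  obtain ⟨h1, l, hl⟩ := he
  obtain ⟨k, hk⟩ := exists_wrap_eq_add h1 (e.y + δ)
  exact ⟨h1, l + k, by rw [Edge.shift_y, hk, hl]; push_cast; ring⟩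

theorem truncStep_mem_fiber (α : ℝ) {N : ℕ} (hN : 1 ≤ N) {θ : ℝ} {e : Edge}
    (he : e ∈ fiber N θ) : truncStep α N e ∈ fiber N (θ + α) := by
  obtain ⟨h1, l, hl⟩ := he
  obtain ⟨k, hk⟩ := exists_wrap_eq_add h1 (e.y + α)
  exact ⟨truncStep_mem_boxRange α hN h1, l + k, by
    rw [truncStep_y, step_y, hk, hl]; push_cast; ring⟩

theorem mem_fiber_iff_of_eq_add {N : ℕ} {θ θ' : ℝ} {l : ℤ} (hl : θ' = θ + l * (2 : ℝ)⁻¹ ^ N)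
    {e : Edge} : e ∈ fiber N θ' ↔ e ∈ fiber N θ := by
  refine and_congr_right fun _ => ⟨?_, ?_⟩
  · rintro ⟨k, hk⟩
    exact ⟨l + k, by rw [hk, hl]; push_cast; ring⟩
  · rintro ⟨k, hk⟩
    exact ⟨k - l, by rw [hk, hl]; push_cast; ring⟩

theorem truncStepInv_mem_fiber (α : ℝ) {N : ℕ} (hN : 1 ≤ N) {θ : ℝ} {e : Edge}
    (he : e ∈ fiber N (θ + α)) : truncStepInv α N e ∈ fiber N θ := by
  have h1 := truncStepInv_mem_boxRange α hN he.1
  have h2 : truncStepInv α N e ∈ fiber N (truncStepInv α N e).y := ⟨h1, 0, by simp⟩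
  have h3 := truncStep_mem_fiber α hN h2
  rw [truncStep_truncStepInv α he.1] at h3
  obtain ⟨l, hl⟩ := he.2
  obtain ⟨k, hk⟩ := h3.2
  exact ⟨h1, l - k, by push_cast; linarith⟩

theorem fiber_finite (N : ℕ) (θ : ℝ) : (fiber N θ).Finite := by
  have hp : (0 : ℝ) < 2⁻¹ ^ N := by positivity
  refine Set.Finite.of_finite_image (f := fun e : Edge => (e.box, e.y)) (Set.Finite.subset
    (((finite_Icc (-(N : ℤ)) N).prod ((finite_Icc ⌈(-1 - θ) / (2 : ℝ)⁻¹ ^ N⌉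
      ⌊(1 - θ) / (2 : ℝ)⁻¹ ^ N⌋).image fun l : ℤ => θ + l * (2 : ℝ)⁻¹ ^ N))) ?_) ?_
  · rintro _ ⟨e, ⟨⟨h1, h2⟩, l, hl⟩, rfl⟩
    have h3 := h_le_one e.box
    refine ⟨⟨h1, h2.le⟩, l, ⟨Int.ceil_le.2 ?_, Int.le_floor.2 ?_⟩, hl.symm⟩
    · rw [div_le_iff₀ hp]; linarith [e.mem.1]
    · rw [le_div_iff₀ hp]; linarith [e.mem.2]
  · intro e _ e' _ hee
    simp only [Prod.mk.injEq] at hee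
    exact Edge.ext hee.1 hee.2

theorem irrational_div_half_pow {α : ℝ} (hα : Irrational α) (N : ℕ) :
    Irrational (α / (2 : ℝ)⁻¹ ^ N) := by
  rw [inv_pow, div_inv_eq_mul]
  have := hα.mul_natCast (pow_ne_zero N two_ne_zero)
  push_cast at this
  exact this

theorem finite_inter_fiber (U : Set Edge) (N : ℕ) (θ : ℝ) : (U ∩ fiber N θ).Finite :=
  (fiber_finite N θ).subset inter_subset_right

/-- A set of points of `boxRange N` that is open to the right and contains the preimage of itself
under the truncated step map, for an irrational slope. -/
structure IsBackwardInvariant (α : ℝ) (N : ℕ) (U : Set Edge) : Prop where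
  irrational : Irrational α
  one_le : 1 ≤ N
  back : ∀ e ∈ boxRange N, truncStep α N e ∈ U → e ∈ U
  right : ∀ e ∈ U, ∀ᶠ δ in 𝓝[≥] (0 : ℝ), e.shift δ ∈ U

theorem truncStepInv_injOn (α : ℝ) (N : ℕ) : InjOn (truncStepInv α N) (boxRange N) :=
  fun e he e' he' hee => by
    rw [← truncStep_truncStepInv α he, hee, truncStep_truncStepInv α he']

/-- `U` has a left-hand discontinuity at `e`. -/
def HasJump (U : Set Edge) (e : Edge) : Prop :=
  ∀ ε > 0, ∃ δ : ℝ, 0 < δ ∧ δ < ε ∧ ¬ (e.shift (-δ) ∈ U ↔ e ∈ U)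

namespace IsBackwardInvariant

variable {α : ℝ} {N : ℕ} {U : Set Edge}

theorem mapsTo_truncStepInv (H : IsBackwardInvariant α N U) (θ : ℝ) :
    MapsTo (truncStepInv α N) (U ∩ fiber N (θ + α)) (U ∩ fiber N θ) := by
  rintro e ⟨he, hf⟩
  have h1 := truncStepInv_mem_fiber α H.one_le hf
  exact ⟨H.back _ h1.1 (by rwa [truncStep_truncStepInv α hf.1]), h1⟩

theorem ncard_fiber_add_le (H : IsBackwardInvariant α N U) (θ : ℝ) :
    (U ∩ fiber N (θ + α)).ncard ≤ (U ∩ fiber N θ).ncard :=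
  ncard_le_ncard_of_injOn _ (H.mapsTo_truncStepInv θ)
    ((truncStepInv_injOn α N).mono fun _ he => he.2.1) (finite_inter_fiber U N θ)

theorem ncard_fiber_add_nat_mul_le (H : IsBackwardInvariant α N U) (θ : ℝ) (i : ℕ) :
    (U ∩ fiber N (θ + i * α)).ncard ≤ (U ∩ fiber N θ).ncard := by
  induction i with
  | zero => simp
  | succ i ih =>
    refine le_trans ?_ ih
    have h1 : θ + ((i + 1 : ℕ) : ℝ) * α = θ + i * α + α := by push_cast; ring
    rw [h1]
    exact H.ncard_fiber_add_le _

theorem eventually_shift_mem (H : IsBackwardInvariant α N U) (θ : ℝ) :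
    ∀ᶠ δ in 𝓝[≥] (0 : ℝ), ∀ e ∈ U ∩ fiber N θ, e.shift δ ∈ U ∩ fiber N (θ + δ) := by
  refine ((finite_inter_fiber U N θ).eventually_all).2 fun e he => ?_
  filter_upwards [H.right e he.1] with δ hδ
  exact ⟨hδ, shift_mem_fiber he.2 δ⟩

/-- The number of points of `U` over a height modulo `2⁻ᴺ` does not decrease along backward
orbits of the rotation by `α` nor to the right, so it is constant. -/
theorem ncard_fiber_eq (H : IsBackwardInvariant α N U) (θ θ' : ℝ) :
    (U ∩ fiber N θ).ncard = (U ∩ fiber N θ').ncard := by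
  set m : ℝ → ℕ := fun θ => (U ∩ fiber N θ).ncard with hm
  have hbdd : BddAbove (range m) := by
    refine ⟨(fiber N 0).ncard, ?_⟩
    rintro _ ⟨θ, rfl⟩
    refine ncard_le_ncard_of_injOn (fun e => e.shift (-θ)) (fun e he => ?_)
      (Edge.shift_injective _).injOn (fiber_finite N 0)
    simpa using shift_mem_fiber he.2 (-θ)
  obtain ⟨c, hc⟩ := Nat.sSup_mem (range_nonempty m) hbdd
  have hmax : ∀ θ, m θ ≤ m c := fun θ => by
    rw [hc]; exact le_csSup hbdd (mem_range_self θ)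
  obtain ⟨ε, hε, hc'⟩ := mem_nhdsGE_iff_exists_Ico_subset.1 (H.eventually_shift_mem c)
  have hε : 0 < ε := hε
  have hloc : ∀ δ, 0 ≤ δ → δ < ε → m c ≤ m (c + δ) := fun δ h0 h1 =>
    ncard_le_ncard_of_injOn _ (hc' ⟨h0, h1⟩) (Edge.shift_injective _).injOn
      (finite_inter_fiber U N _)
  have hall : ∀ θ, m θ = m c := by
    intro θ
    refine le_antisymm (hmax θ) ?_
    obtain ⟨i, l, hil⟩ := exists_nat_mul_add_int_mul_mem_Ioo
      (irrational_div_half_pow H.irrational N) (by positivity) θ c hε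
    have h1 := hloc (θ + i * α + l * (2 : ℝ)⁻¹ ^ N - c) (by linarith [hil.1]) (by linarith [hil.2])
    have h2 : m (c + (θ + i * α + l * (2 : ℝ)⁻¹ ^ N - c)) = m (θ + i * α) := by
      have : fiber N (c + (θ + i * α + l * (2 : ℝ)⁻¹ ^ N - c)) = fiber N (θ + i * α) :=
        Set.ext fun e => mem_fiber_iff_of_eq_add (l := l) (by ring)
      simp only [hm, this]
    rw [h2] at h1
    exact h1.trans (H.ncard_fiber_add_nat_mul_le θ i)
  exact (hall θ).trans (hall θ').symm

/-- As the inverse of the truncated step map sends the part of `U` in each fiber injectively into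
the part in another fiber, which has as many points, `U` is invariant. -/
theorem truncStep_mem_iff (H : IsBackwardInvariant α N U) {e : Edge} (he : e ∈ boxRange N) :
    truncStep α N e ∈ U ↔ e ∈ U := by
  refine ⟨H.back e he, fun heU => ?_⟩
  have h1 : e ∈ U ∩ fiber N e.y := ⟨heU, he, 0, by simp⟩
  have h2 : truncStepInv α N '' (U ∩ fiber N (e.y + α)) = U ∩ fiber N e.y := by
    refine eq_of_subset_of_ncard_le (H.mapsTo_truncStepInv e.y).image_subset ?_
      (finite_inter_fiber U N _)
    rw [((truncStepInv_injOn α N).mono fun _ he => he.2.1).ncard_image]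
    exact (H.ncard_fiber_eq _ _).le
  rw [← h2] at h1
  obtain ⟨e', he', rfl⟩ := h1
  rw [truncStep_truncStepInv α he'.2.1]
  exact he'.1

theorem eventually_shift_mem_iff (H : IsBackwardInvariant α N U) (θ : ℝ) :
    ∀ᶠ δ in 𝓝[≥] (0 : ℝ), ∀ e ∈ fiber N θ, (e.shift δ ∈ U ↔ e ∈ U) := by
  filter_upwards [H.eventually_shift_mem θ] with δ hδ e he
  refine ⟨fun heU => ?_, fun heU => (hδ e ⟨heU, he⟩).1⟩
  have h1 : (fun e : Edge => e.shift δ) '' (U ∩ fiber N θ) = U ∩ fiber N (θ + δ) := by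
    refine eq_of_subset_of_ncard_le (image_subset_iff.2 hδ) ?_ (finite_inter_fiber U N _)
    rw [ncard_image_of_injective _ (Edge.shift_injective δ)]
    exact (H.ncard_fiber_eq _ _).le
  have h2 : e.shift δ ∈ U ∩ fiber N (θ + δ) := ⟨heU, shift_mem_fiber he δ⟩
  rw [← h1] at h2
  obtain ⟨e', he', hee⟩ := h2
  rw [← Edge.shift_injective δ hee]
  exact he'.1

/-- Jumps are transported by the truncated step map as long as it is a local translation. -/
theorem hasJump_truncStep_iff (H : IsBackwardInvariant α N U) {e : Edge} (he : e ∈ boxRange N)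
    (hd : (truncStep α N e).y ∉ dyadic) : HasJump U (truncStep α N e) ↔ HasJump U e := by
  obtain ⟨ε, hε, hs⟩ := exists_truncStep_shift α N e
  have key : ∀ δ, 0 < δ → δ < ε → (((truncStep α N e).shift (-δ) ∈ U ↔ truncStep α N e ∈ U) ↔
      (e.shift (-δ) ∈ U ↔ e ∈ U)) := by
    intro δ h1 h2
    rw [← hs (-δ) (by rwa [abs_neg, abs_of_pos h1]) (Or.inr hd),
      H.truncStep_mem_iff (show e.shift (-δ) ∈ boxRange N from he), H.truncStep_mem_iff he]
  constructor <;> intro hj ε' hε' <;> obtain ⟨δ, h1, h2, h3⟩ := hj (min ε ε') (lt_min hε hε')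
    <;> rw [lt_min_iff] at h2 <;> refine ⟨δ, h1, h2.2, fun h4 => h3 ?_⟩
  · exact (key δ h1 h2.1).2 h4
  · exact (key δ h1 h2.1).1 h4

/-- No jump lies on a fiber slightly above a given one. -/
theorem exists_not_hasJump (H : IsBackwardInvariant α N U) : ∃ ε > 0, ∀ v : Edge, ∀ l : ℤ,
    v ∈ boxRange N → v.y + l * (2 : ℝ)⁻¹ ^ N ∈ Ioo 0 (0 + ε) → ¬ HasJump U v := by
  obtain ⟨ε, hε, hc⟩ := mem_nhdsGE_iff_exists_Ico_subset.1 (H.eventually_shift_mem_iff 0)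
  refine ⟨ε, hε, fun v l hv hvl hj => ?_⟩
  rw [zero_add] at hvl
  set w := v.y + l * (2 : ℝ)⁻¹ ^ N with hw
  set e := v.shift (-w) with he
  have hev : e.shift w = v := by simp [he]
  have hef : e ∈ fiber N 0 := by
    have h1 : v ∈ fiber N w := ⟨hv, -l, by rw [hw]; push_cast; ring⟩
    simpa using shift_mem_fiber h1 (-w)
  obtain ⟨δ, h1, h2, h3⟩ := hj w hvl.1
  refine h3 ?_
  rw [← hev, Edge.shift_shift, hc ⟨by linarith, by linarith [hvl.2]⟩ e hef,
    hc ⟨hvl.1.le, hvl.2⟩ e hef]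

theorem not_hasJump (H : IsBackwardInvariant α N U) {e : Edge} (he : e ∈ boxRange N) :
    ¬ HasJump U e := by
  intro hj
  obtain ⟨ε, hε, hno⟩ := H.exists_not_hasJump
  -- At most one point of the two-sided orbit of `e` has dyadic height, so the jump is transported
  -- along one of the two half-orbits, and their heights are dense modulo `2⁻ᴺ`.
  have dy : ∀ (a : ℤ) (c : ℝ), (∃ l : ℤ, c = e.y + a * α + l * (2 : ℝ)⁻¹ ^ N) → c ∈ dyadic →
      ∀ (b : ℤ) (c' : ℝ), (∃ l : ℤ, c' = e.y + b * α + l * (2 : ℝ)⁻¹ ^ N) → c' ∈ dyadic →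
      a = b := by
    rintro a c ⟨l, hl⟩ hc b c' ⟨l', hl'⟩ hc'
    have h1 : ((a - b : ℤ) : ℝ) * α = c - c' + (l' - l : ℤ) * (2 : ℝ)⁻¹ ^ N := by
      rw [hl, hl']; push_cast; ring
    have h2 := eq_zero_of_int_mul_mem_dyadic H.irrational (k := a - b) (by
      rw [h1]
      exact dyadic.add_mem (dyadic.sub_mem hc hc') (int_mul_mem_dyadic _ (half_pow_mem_dyadic N)))
    omega
  by_cases hfw : ∃ a : ℤ, 1 ≤ a ∧ ∃ c, (∃ l : ℤ, c = e.y + a * α + l * (2 : ℝ)⁻¹ ^ N) ∧ c ∈ dyadic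
  · obtain ⟨a, ha, c, hc, hcd⟩ := hfw
    have hbw : ∀ i : ℕ, ∃ v ∈ boxRange N, HasJump U v ∧
        ∃ l : ℤ, v.y = e.y + (-i : ℤ) * α + l * (2 : ℝ)⁻¹ ^ N := by
      intro i
      induction i with
      | zero => exact ⟨e, he, hj, 0, by simp⟩
      | succ i ih =>
        obtain ⟨v, hv, hvj, hvy⟩ := ih
        have hv' := truncStepInv_mem_boxRange α H.one_le hv
        have hvd : v.y ∉ dyadic := fun hvd => by
          have := dy a c hc hcd (-i) v.y hvy hvd
          omega
        refine ⟨truncStepInv α N v, hv', ?_, ?_⟩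
        · rw [← H.hasJump_truncStep_iff hv'] <;> rwa [truncStep_truncStepInv α hv]
        · obtain ⟨l, hl⟩ := hvy
          have h1 : v ∈ fiber N ((v.y - α) + α) := ⟨hv, 0, by simp⟩
          obtain ⟨k, hk⟩ := (truncStepInv_mem_fiber α H.one_le h1).2
          exact ⟨l + k, by rw [hk, hl]; push_cast; ring⟩
    have hα' : Irrational (-α / (2 : ℝ)⁻¹ ^ N) :=
      irrational_div_half_pow H.irrational.neg N
    obtain ⟨i, l, hil⟩ := exists_nat_mul_add_int_mul_mem_Ioo hα' (by positivity) e.y 0 hε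
    obtain ⟨v, hv, hvj, k, hk⟩ := hbw i
    refine hno v (l - k) hv ?_ hvj
    convert hil using 1
    rw [hk]; push_cast; ring
  · have hfor : ∀ i : ℕ, ∃ v ∈ boxRange N, HasJump U v ∧
        ∃ l : ℤ, v.y = e.y + i * α + l * (2 : ℝ)⁻¹ ^ N := by
      intro i
      induction i with
      | zero => exact ⟨e, he, hj, 0, by simp⟩
      | succ i ih =>
        obtain ⟨v, hv, hvj, l, hl⟩ := ih
        have h1 : v ∈ fiber N v.y := ⟨hv, 0, by simp⟩
        obtain ⟨k, hk⟩ := (truncStep_mem_fiber α H.one_le h1).2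
        have h2 : (truncStep α N v).y = e.y + ((i + 1 : ℕ) : ℝ) * α
            + (l + k : ℤ) * (2 : ℝ)⁻¹ ^ N := by
          rw [hk, hl]; push_cast; ring
        refine ⟨truncStep α N v, truncStep_mem_boxRange α H.one_le hv, ?_, l + k, h2⟩
        refine (H.hasJump_truncStep_iff hv fun h3 =>
          hfw ⟨(i + 1 : ℕ), by omega, _, ⟨l + k, ?_⟩, h3⟩).2 hvj
        rw [h2]; push_cast; ring
    obtain ⟨i, l, hil⟩ := exists_nat_mul_add_int_mul_mem_Ioo
      (irrational_div_half_pow H.irrational N) (by positivity) e.y 0 hε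
    obtain ⟨v, hv, hvj, k, hk⟩ := hfor i
    refine hno v (l - k) hv ?_ hvj
    convert hil using 1
    rw [hk]; push_cast; ring

/-- Without jumps, `U` is both open and closed in each of the circles forming `boxRange N`. -/
theorem mem_iff_of_box_eq (H : IsBackwardInvariant α N U) {e e' : Edge} (he : e ∈ boxRange N)
    (hee : e'.box = e.box) : e' ∈ U ↔ e ∈ U := by
  have hloc : IsLocallyConstant fun δ : ℝ => (e.shift δ ∈ U) := by
    rw [IsLocallyConstant.iff_eventually_eq]
    intro δ
    have hr : e.shift δ ∈ boxRange N := he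
    have h1 := H.not_hasJump hr
    simp only [HasJump, not_forall, not_exists] at h1
    obtain ⟨ε, hε, h1⟩ := h1
    obtain ⟨ε', hε', h2⟩ := mem_nhdsGE_iff_exists_Ico_subset.1
      (H.eventually_shift_mem_iff (e.shift δ).y)
    have hε' : 0 < ε' := hε'
    filter_upwards [Ioo_mem_nhds (sub_lt_self δ hε) (lt_add_of_pos_right δ hε')] with x hx
    have h3 : e.shift x = (e.shift δ).shift (x - δ) := by simp
    rw [h3]
    rcases lt_or_ge x δ with h4 | h4
    · have h5 := h1 (δ - x)
      simp only [not_and, not_not, neg_sub] at h5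
      exact propext (h5 (by linarith) (by linarith [hx.1]))
    · exact propext (h2 ⟨by linarith, by linarith [hx.2]⟩ _ ⟨hr, 0, by simp⟩)
  have h1 : e' = e.shift (e'.y - e.y) := by
    refine Edge.ext hee ?_
    rw [Edge.shift_y, add_sub_cancel, ← hee, wrap_eq_self e'.mem]
  have h2 := hloc.apply_eq_of_isPreconnected isPreconnected_univ (mem_univ (e'.y - e.y))
    (mem_univ 0)
  simp only [Edge.shift_zero, ← h1] at h2
  exact iff_of_eq h2

/-- All boxes are linked by the truncated step map. -/
theorem mem_iff (H : IsBackwardInvariant α N U) {e e' : Edge} (he : e ∈ boxRange N)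
    (he' : e' ∈ boxRange N) : e ∈ U ↔ e' ∈ U := by
  have hnext : ∀ k : ℤ, -(N : ℤ) ≤ k → k + 1 < N → ∀ e e' : Edge, e.box = k → e'.box = k + 1 →
      (e ∈ U ↔ e' ∈ U) := by
    intro k h1 h2 e e' he he'
    have h0 : (0 : ℝ) ∈ Ico (-h (k + 1)) (h (k + 1)) := by
      have := h_pos (k + 1)
      exact ⟨by linarith, this⟩
    set s : Edge := ⟨k + 1, 0, h0⟩ with hs
    set v := (step α).symm s with hv
    have hsv : step α v = s := Equiv.apply_symm_apply _ _
    have hvb : v.box = k := by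
      have h3 : v.box = (transfer.symm s).box := rfl
      rw [h3, transfer_symm_box_of_mem]
      · simp [hs]
      · have := h_pos (s.box - 1)
        exact ⟨by simp only [hs] at this ⊢; linarith, this⟩
    have hvr : v ∈ boxRange N := ⟨by omega, by omega⟩
    have h4 : truncStep α N v = s := by
      rw [truncStep_of_ne, hsv]
      rw [hsv]; simp only [hs]; omega
    have h5 := H.truncStep_mem_iff hvr
    rw [h4] at h5
    rw [H.mem_iff_of_box_eq hvr (by rw [he, hvb]), ← h5]
    refine (H.mem_iff_of_box_eq (e := s) ⟨?_, ?_⟩ he').symm <;> simp only [hs] <;> omega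
  have hchain : ∀ n : ℕ, ∀ e e' : Edge, e.box = -N → e'.box = -N + n → (n : ℤ) < 2 * N →
      (e ∈ U ↔ e' ∈ U) := by
    intro n
    induction n with
    | zero =>
      intro e e' he he' _
      have := H.one_le
      exact (H.mem_iff_of_box_eq ⟨by omega, by omega⟩ (by rw [he']; simpa using he.symm)).symm
    | succ n ih =>
      intro e e' he he' hn
      have h0 := h_pos (-N + n)
      set s : Edge := ⟨-N + n, 0, by linarith, h0⟩ with hs
      rw [ih e s he rfl (by omega)]
      refine hnext (-N + n) (by omega) (by push_cast at hn; omega) s e' rfl ?_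
      rw [he']; push_cast; ring
  have h0 := h_pos (-N)
  set s : Edge := ⟨-N, 0, by linarith, h0⟩ with hs
  have hany : ∀ e ∈ boxRange N, (s ∈ U ↔ e ∈ U) := fun e he => by
    obtain ⟨n, hn⟩ := Int.eq_ofNat_of_zero_le (by linarith [he.1] : 0 ≤ e.box + N)
    exact hchain n s e rfl (by omega) (by have := he.2; omega)
  exact (hany e he).symm.trans (hany e' he')

end IsBackwardInvariant

/-- For an irrational slope, no forward orbit of the step map stays in finitely many boxes:
otherwise the set of points that it does not meet or approach from above would be backward
invariant, but would contain some points of `boxRange N` and miss others. -/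
theorem exists_notMem_boxRange {α : ℝ} (hα : Irrational α) {N : ℕ} (hN : 1 ≤ N) (e : Edge) :
    ∃ i : ℕ, (step α ^ i) e ∉ boxRange N := by
  by_contra! hall
  set s : ℕ → Edge := fun i => (step α ^ i) e with hs
  have hsucc : ∀ i, step α (s i) = s (i + 1) := fun i => by
    rw [hs]; simp only [pow_succ', Equiv.Perm.mul_apply]
  have htr : ∀ i, truncStep α N (s i) = s (i + 1) := fun i => by
    rw [truncStep_of_ne, hsucc]
    rw [hsucc]
    exact (hall (i + 1)).2.ne
  set U : Set Edge := {v | ∃ ε > 0, ∀ δ, 0 ≤ δ → δ < ε → ∀ i, s i ≠ v.shift δ} with hU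
  have H : IsBackwardInvariant α N U := by
    refine ⟨hα, hN, ?_, ?_⟩
    · rintro v hv ⟨ε, hε, h1⟩
      obtain ⟨ε', hε', h2⟩ := exists_truncStep_shift α N v
      refine ⟨min ε ε', lt_min hε hε', fun δ h3 h4 i h5 => ?_⟩
      rw [lt_min_iff] at h4
      refine h1 δ h3 h4.1 (i + 1) ?_
      rw [← h2 δ (by rw [abs_of_nonneg h3]; exact h4.2) (Or.inl h3), ← h5, htr]
    · rintro v ⟨ε, hε, h1⟩
      filter_upwards [Ico_mem_nhdsGE hε] with δ hδ
      refine ⟨ε - δ, by linarith [hδ.2], fun δ' h3 h4 i => ?_⟩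
      rw [Edge.shift_shift]
      exact h1 _ (by linarith [hδ.1]) (by linarith) i
  have h0 := h_pos N
  -- The orbit never enters the aperture at `x = N`, so it does not approach the preimage `v` of its
  -- centre `c`.
  set c : Edge := ⟨N, 0, by linarith, h0⟩ with hc
  set v := (step α).symm c with hv
  have hvc : step α v = c := Equiv.apply_symm_apply _ _
  have hvU : v ∈ U := by
    obtain ⟨ε, hε, h1⟩ := exists_step_shift α v
    refine ⟨ε, hε, fun δ h2 h3 i h4 => ?_⟩
    have h5 := h1 δ (by rwa [abs_of_nonneg h2]) (Or.inl h2)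
    rw [← h4, hsucc, hvc] at h5
    have h6 := (hall (i + 1)).2
    change (s (i + 1)).box < N at h6
    rw [h5] at h6
    simp [hc] at h6
  have hvr : v ∈ boxRange N := by
    have h1 := step_symm_box_of_nonneg α (s := c) (by simp [hc])
    constructor <;> rw [h1] <;> simp only [hc] <;> omega
  obtain ⟨ε, hε, h1⟩ := (H.mem_iff hvr (hall 0)).1 hvU
  exact h1 0 le_rfl hε 0 (by simp [hs])

/-! ### The sets of points of `L` that reach an aperture -/

/-- A trajectory reaching `x = j` at the height `u`, taken modulo the height `4 * 2⁻ʲ` of the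
previous box, passes through the aperture there. -/
def PassesAperture (j : ℕ) (u : ℝ) : Prop :=
  ∃ k : ℤ, u + k * (4 * (2 : ℝ)⁻¹ ^ j) ∈ Ico (-(2 : ℝ)⁻¹ ^ j) ((2 : ℝ)⁻¹ ^ j)

/-- The `2`-periodic lift of `E α n` to the real line. The heights need not be reduced at each box,
because the period at the aperture number `j` divides those at the previous ones. -/
def reach (α : ℝ) (n : ℕ) : Set ℝ := {x | ∀ j, 1 ≤ j → j ≤ n → PassesAperture j (x + j * α)}

theorem half_pow_pos (n : ℕ) : (0 : ℝ) < 2⁻¹ ^ n := by positivity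

theorem half_pow_eq_two_mul_succ (n : ℕ) : (2 : ℝ)⁻¹ ^ n = 2 * 2⁻¹ ^ (n + 1) := by
  rw [pow_succ]; ring

theorem half_pow_le_half {n : ℕ} (hn : 1 ≤ n) : (2 : ℝ)⁻¹ ^ n ≤ 2⁻¹ := by
  simpa using pow_le_pow_of_le_one (by norm_num : (0 : ℝ) ≤ 2⁻¹) (by norm_num) hn

theorem exists_two_eq_mul {j : ℕ} (hj : 1 ≤ j) : ∃ m : ℤ, (2 : ℝ) = m * (4 * 2⁻¹ ^ j) := by
  obtain ⟨i, rfl⟩ := Nat.exists_eq_add_of_le hj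
  refine ⟨2 ^ i, ?_⟩
  have : (2 : ℝ) ^ i * 2⁻¹ ^ i = 1 := by rw [← mul_pow]; norm_num
  push_cast
  rw [pow_add]
  linear_combination (-2 : ℝ) * this

theorem PassesAperture.add_int_mul {j : ℕ} {u : ℝ} (hu : PassesAperture j u) (z : ℤ) :
    PassesAperture j (u + z * (4 * (2 : ℝ)⁻¹ ^ j)) := by
  obtain ⟨k, hk⟩ := hu
  refine ⟨k - z, ?_⟩
  convert hk using 1
  push_cast; ring

theorem passesAperture_or (j : ℕ) (u : ℝ) :
    PassesAperture j u ∨ PassesAperture j (u + 2 * (2 : ℝ)⁻¹ ^ j) := by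
  have hr := half_pow_pos j
  have h1 := Int.floor_le ((u + (2 : ℝ)⁻¹ ^ j) / (4 * (2 : ℝ)⁻¹ ^ j))
  have h2 := Int.lt_floor_add_one ((u + (2 : ℝ)⁻¹ ^ j) / (4 * (2 : ℝ)⁻¹ ^ j))
  set k := ⌊(u + (2 : ℝ)⁻¹ ^ j) / (4 * (2 : ℝ)⁻¹ ^ j)⌋
  rw [le_div_iff₀ (by linarith)] at h1
  rw [div_lt_iff₀ (by linarith)] at h2
  by_cases h3 : u + (-k : ℤ) * (4 * (2 : ℝ)⁻¹ ^ j) < (2 : ℝ)⁻¹ ^ j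
  · exact Or.inl ⟨-k, by push_cast; linarith, h3⟩
  · push_cast at h3
    exact Or.inr ⟨-k - 1, by push_cast; linarith, by push_cast; linarith⟩

theorem PassesAperture.even {j : ℕ} {u : ℝ} (hu : PassesAperture j u) {l : ℤ}
    (hl : PassesAperture j (u + l * (2 * (2 : ℝ)⁻¹ ^ j))) : Even l := by
  have hr := half_pow_pos j
  obtain ⟨k, hk1, hk2⟩ := hu
  obtain ⟨m, hm1, hm2⟩ := hl
  set r := (2 : ℝ)⁻¹ ^ j
  have h1 : ((l + 2 * m - 2 * k : ℤ) : ℝ) * (2 * r) < 1 * (2 * r) := by push_cast; linarith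
  have h2 : (-1) * (2 * r) < ((l + 2 * m - 2 * k : ℤ) : ℝ) * (2 * r) := by push_cast; linarith
  have h3 := lt_of_mul_lt_mul_right h1 (by linarith)
  have h4 := lt_of_mul_lt_mul_right h2 (by linarith)
  have h5 : l + 2 * m - 2 * k < 1 := by exact_mod_cast h3
  have h6 : -1 < l + 2 * m - 2 * k := by exact_mod_cast h4
  exact ⟨k - m, by omega⟩

/-- A trajectory that passes an aperture together with one slightly below it is not at the lower
end of the aperture. -/
theorem PassesAperture.exists_mem_Ioo {j : ℕ} {u δ : ℝ} (hu : PassesAperture j u)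
    (h0 : 0 < δ) (hδ : δ < (2 : ℝ)⁻¹ ^ j) (hu' : PassesAperture j (u - δ)) :
    ∃ k : ℤ, u + k * (4 * (2 : ℝ)⁻¹ ^ j) ∈ Ioo (-(2 : ℝ)⁻¹ ^ j) ((2 : ℝ)⁻¹ ^ j) := by
  have hr := half_pow_pos j
  obtain ⟨k, hk1, hk2⟩ := hu
  obtain ⟨m, hm1, hm2⟩ := hu'
  set r := (2 : ℝ)⁻¹ ^ j
  have h1 : ((m - k : ℤ) : ℝ) * (4 * r) < 1 * (4 * r) := by push_cast; linarith
  have h2 : (-1) * (4 * r) < ((m - k : ℤ) : ℝ) * (4 * r) := by push_cast; linarith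
  have h3 := lt_of_mul_lt_mul_right h1 (by linarith)
  have h4 := lt_of_mul_lt_mul_right h2 (by linarith)
  have h5 : m - k < 1 := by exact_mod_cast h3
  have h6 : -1 < m - k := by exact_mod_cast h4
  obtain rfl : m = k := by omega
  exact ⟨m, by linarith, hk2⟩

theorem PassesAperture.eventually_neg_sub {j : ℕ} {u : ℝ} (hu : PassesAperture j u) :
    ∀ᶠ δ in 𝓝[>] (0 : ℝ), PassesAperture j (-u - δ) := by
  obtain ⟨k, hk1, hk2⟩ := hu
  have h1 : 0 < (2 : ℝ)⁻¹ ^ j - (u + k * (4 * (2 : ℝ)⁻¹ ^ j)) := by linarith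
  filter_upwards [Ioo_mem_nhdsGT h1] with δ hδ
  exact ⟨-k, by push_cast; linarith [hδ.2], by push_cast; linarith [hδ.1]⟩

theorem PassesAperture.eventually_add {j : ℕ} {u : ℝ} (hu : PassesAperture j u) :
    ∀ᶠ δ in 𝓝[≥] (0 : ℝ), PassesAperture j (u + δ) := by
  obtain ⟨k, hk1, hk2⟩ := hu
  have h1 : 0 < (2 : ℝ)⁻¹ ^ j - (u + k * (4 * (2 : ℝ)⁻¹ ^ j)) := by linarith
  filter_upwards [Ico_mem_nhdsGE h1] with δ hδ
  exact ⟨k, by linarith [hδ.1], by linarith [hδ.2]⟩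

theorem reach_anti (α : ℝ) {m n : ℕ} (hmn : m ≤ n) : reach α n ⊆ reach α m :=
  fun _ hx j h1 h2 => hx j h1 (h2.trans hmn)

theorem add_two_mul_int_mem_reach {α : ℝ} {n : ℕ} {x : ℝ} (hx : x ∈ reach α n) (k : ℤ) :
    x + 2 * k ∈ reach α n := by
  intro j h1 h2
  obtain ⟨m, hm⟩ := exists_two_eq_mul h1
  have := (hx j h1 h2).add_int_mul (k * m)
  convert this using 1
  push_cast
  linear_combination (k : ℝ) * hm

theorem mem_reach_succ {α : ℝ} {n : ℕ} {x : ℝ} :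
    x ∈ reach α (n + 1) ↔ x ∈ reach α n ∧ PassesAperture (n + 1) (x + (n + 1 : ℕ) * α) := by
  refine ⟨fun hx => ⟨reach_anti α n.le_succ hx, hx _ (by omega) le_rfl⟩, fun hx j h1 h2 => ?_⟩
  rcases h2.lt_or_eq with h3 | rfl
  · exact hx.1 j h1 (by omega)
  · exact hx.2

theorem eventually_add_mem_reach {α : ℝ} {n : ℕ} {x : ℝ} (hx : x ∈ reach α n) :
    ∀ᶠ δ in 𝓝[≥] (0 : ℝ), x + δ ∈ reach α n := by
  induction n with
  | zero => exact Eventually.of_forall fun δ j h1 h2 => by omega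
  | succ n ih =>
    rw [mem_reach_succ] at hx
    filter_upwards [ih hx.1, hx.2.eventually_add] with δ h1 h2
    rw [mem_reach_succ, add_right_comm]
    exact ⟨h1, h2⟩

theorem eventually_neg_sub_mem_reach {α : ℝ} {n : ℕ} {x : ℝ} (hx : x ∈ reach (-α) n) :
    ∀ᶠ δ in 𝓝[>] (0 : ℝ), -x - δ ∈ reach α n := by
  induction n with
  | zero => exact Eventually.of_forall fun δ j h1 h2 => by omega
  | succ n ih =>
    rw [mem_reach_succ] at hx
    filter_upwards [ih hx.1, hx.2.eventually_neg_sub] with δ h1 h2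
    rw [mem_reach_succ]
    refine ⟨h1, ?_⟩
    convert h2 using 1
    ring

/-- Every class modulo `2 * 2⁻ⁿ` meets `reach α n`: by induction, each of the two classes modulo
`4 * 2⁻ⁿ` that make it up has a point reaching the previous aperture, and as their heights at the
aperture number `n` differ by half a period, one of them passes it. -/
theorem exists_add_mem_reach (α : ℝ) (n : ℕ) (θ : ℝ) :
    ∃ l : ℤ, θ + l * (2 * (2 : ℝ)⁻¹ ^ n) ∈ reach α n := by
  induction n generalizing θ with
  | zero => exact ⟨0, fun j h1 h2 => by omega⟩
  | succ n ih =>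
    have hr := half_pow_eq_two_mul_succ n
    obtain ⟨l, hl⟩ := ih θ
    rcases passesAperture_or (n + 1) (θ + l * (2 * (2 : ℝ)⁻¹ ^ n) + (n + 1 : ℕ) * α) with h1 | h1
    · refine ⟨2 * l, ?_⟩
      have h2 : θ + (2 * l : ℤ) * (2 * (2 : ℝ)⁻¹ ^ (n + 1)) = θ + l * (2 * (2 : ℝ)⁻¹ ^ n) := by
        rw [hr]; push_cast; ring
      rw [h2]
      exact mem_reach_succ.2 ⟨hl, h1⟩
    · obtain ⟨m, hm⟩ := ih (θ + (2 : ℝ)⁻¹ ^ n)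
      refine ⟨1 + 2 * m, ?_⟩
      have h2 : θ + (1 + 2 * m : ℤ) * (2 * (2 : ℝ)⁻¹ ^ (n + 1)) =
          θ + (2 : ℝ)⁻¹ ^ n + m * (2 * (2 : ℝ)⁻¹ ^ n) := by
        rw [hr]; push_cast; ring
      rw [h2]
      refine mem_reach_succ.2 ⟨hm, ?_⟩
      have := h1.add_int_mul (m - l)
      convert this using 1
      rw [hr]; push_cast; ring

/-- A class modulo `2 * 2⁻ⁿ` meets `reach α n` in only one point modulo `2`. -/
theorem exists_eq_two_mul_of_mem_reach {α : ℝ} {n : ℕ} {x : ℝ} (hx : x ∈ reach α n) {l : ℤ}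
    (hl : x + l * (2 * (2 : ℝ)⁻¹ ^ n) ∈ reach α n) :
    ∃ k : ℤ, l * (2 * (2 : ℝ)⁻¹ ^ n) = 2 * k := by
  induction n generalizing l with
  | zero => exact ⟨l, by simp; ring⟩
  | succ n ih =>
    have hr := half_pow_eq_two_mul_succ n
    rw [mem_reach_succ] at hx hl
    have h1 : Even l := hx.2.even (by rw [add_right_comm]; exact hl.2)
    obtain ⟨m, rfl⟩ := h1
    have h2 : ((m + m : ℤ) : ℝ) * (2 * (2 : ℝ)⁻¹ ^ (n + 1)) = m * (2 * (2 : ℝ)⁻¹ ^ n) := by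
      rw [hr]; push_cast; ring
    rw [h2] at hl ⊢
    exact ih hx.1 hl.1

/-- The lift of `E α n` consists of the translates by even integers of one right-open interval
starting at `a`; its length is then that of the aperture. -/
def IsSingleInterval (α : ℝ) (n : ℕ) (a : ℝ) : Prop :=
  ∀ x, x ∈ reach α n ↔ ∃ k : ℤ, x + 2 * k ∈ Ico a (a + 2 * (2 : ℝ)⁻¹ ^ n)

theorem IsSingleInterval.left_mem {α a : ℝ} {n : ℕ} (H : IsSingleInterval α n a) :
    a ∈ reach α n :=
  (H a).2 ⟨0, by simp⟩

theorem IsSingleInterval.add_two_mul_int {α a : ℝ} {n : ℕ} (H : IsSingleInterval α n a) (m : ℤ) :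
    IsSingleInterval α n (a + 2 * m) := by
  intro x
  rw [H x]
  constructor <;> rintro ⟨k, hk1, hk2⟩
  · exact ⟨k + m, by push_cast; linarith, by push_cast; linarith⟩
  · exact ⟨k - m, by push_cast; linarith, by push_cast; linarith⟩

theorem isSingleInterval_of_eq {α a b : ℝ} {n : ℕ} (hn : 1 ≤ n)
    (H : ∀ x, x ∈ reach α n ↔ ∃ k : ℤ, x + 2 * k ∈ Ico a b) : IsSingleInterval α n a := by
  have hr := half_pow_pos n
  have hr' := half_pow_le_half hn
  have h1 : b ≤ a + 2 * (2 : ℝ)⁻¹ ^ n := by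
    by_contra! h1
    have h2 : a ∈ reach α n := (H a).2 ⟨0, by simp; linarith⟩
    have h3 : a + (1 : ℤ) * (2 * (2 : ℝ)⁻¹ ^ n) ∈ reach α n :=
      (H _).2 ⟨0, by push_cast; linarith, by push_cast; linarith⟩
    obtain ⟨k, hk⟩ := exists_eq_two_mul_of_mem_reach h2 h3
    push_cast at hk
    have h4 : (0 : ℝ) < k := by linarith
    have h5 : (k : ℝ) < 1 := by linarith
    have h6 : 0 < k := by exact_mod_cast h4
    have h7 : k < 1 := by exact_mod_cast h5
    omega
  have h2 : a + 2 * (2 : ℝ)⁻¹ ^ n ≤ b := by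
    by_contra! h2
    obtain ⟨l, hl⟩ := exists_add_mem_reach α n b
    obtain ⟨k, hk1, hk2⟩ := (H _).1 hl
    obtain ⟨m, hm⟩ := exists_two_eq_mul hn
    have h3 : ((l + 2 * (m * k) : ℤ) : ℝ) * (2 * (2 : ℝ)⁻¹ ^ n) < 0 * (2 * (2 : ℝ)⁻¹ ^ n) := by
      push_cast
      linear_combination hk2 - (k : ℝ) * hm
    have h4 : (-1) * (2 * (2 : ℝ)⁻¹ ^ n) < ((l + 2 * (m * k) : ℤ) : ℝ) * (2 * (2 : ℝ)⁻¹ ^ n) := by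
      push_cast
      linear_combination hk1 + (k : ℝ) * hm + h2
    have h5 := lt_of_mul_lt_mul_right h3 (by linarith)
    have h6 := lt_of_mul_lt_mul_right h4 (by linarith)
    have h7 : l + 2 * (m * k) < 0 := by exact_mod_cast h5
    have h8 : -1 < l + 2 * (m * k) := by exact_mod_cast h6
    omega
  obtain rfl := le_antisymm h1 h2
  exact H

/-- The ends of an interval `E α n` are the points whose trajectories meet the ends of the aperture
number `n`. -/
theorem IsSingleInterval.exists_left_add_eq {α a : ℝ} {n : ℕ} (H : IsSingleInterval α n a)
    (hn : 1 ≤ n) : ∃ l : ℤ, a + n * α = (2 * l + 1) * (2 : ℝ)⁻¹ ^ n := by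
  have hr := half_pow_pos n
  set r := (2 : ℝ)⁻¹ ^ n with hrdef
  obtain ⟨z, hz⟩ : ∃ z : ℤ, r - n * α + z * (2 * r) ∈ Ico a (a + 2 * r) := by
    refine ⟨-toIcoDiv (by linarith : 0 < 2 * r) a (r - n * α), ?_⟩
    have := toIcoMod_mem_Ico (by linarith : 0 < 2 * r) a (r - n * α)
    rw [← self_sub_toIcoDiv_zsmul] at this
    simpa [sub_eq_add_neg] using this
  set v := r - n * α + z * (2 * r) with hv
  rcases hz.1.eq_or_lt with h1 | h1
  · exact ⟨z, by rw [h1, hv]; ring⟩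
  · exfalso
    set δ := min (r / 2) (v - a) with hδ
    have h2 : 0 < δ := lt_min (by linarith) (by linarith)
    have h3 : δ ≤ r / 2 := min_le_left _ _
    have h4 : δ ≤ v - a := min_le_right _ _
    have h5 : v ∈ reach α n := (H v).2 ⟨0, by
      rw [Int.cast_zero, mul_zero, add_zero]; exact hz⟩
    have h6 : v - δ ∈ reach α n := (H _).2 ⟨0, by
      rw [Int.cast_zero, mul_zero, add_zero, ← hrdef]; constructor <;> linarith [hz.2]⟩
    obtain ⟨k, hk1, hk2⟩ := (h5 n hn le_rfl).exists_mem_Ioo h2 (by linarith) (by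
      have := h6 n hn le_rfl
      rwa [sub_add_eq_add_sub] at this)
    rw [← hrdef] at hk1 hk2
    have h7 : ((2 * z + 1 + 4 * k : ℤ) : ℝ) * r < 1 * r := by
      push_cast; linarith
    have h8 : (-1) * r < ((2 * z + 1 + 4 * k : ℤ) : ℝ) * r := by
      push_cast; linarith
    have h9 := lt_of_mul_lt_mul_right h7 (by linarith)
    have h10 := lt_of_mul_lt_mul_right h8 (by linarith)
    have h11 : 2 * z + 1 + 4 * k < 1 := by exact_mod_cast h9
    have h12 : -1 < 2 * z + 1 + 4 * k := by exact_mod_cast h10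
    omega

theorem IsSingleInterval.sub_notMem_dyadic {α a a' : ℝ} {n n' : ℕ} (hα : Irrational α)
    (H : IsSingleInterval α n a) (H' : IsSingleInterval α n' a') (hn : 1 ≤ n) (hn' : n < n') :
    a' - a ∉ dyadic := by
  intro hd
  obtain ⟨l, hl⟩ := H.exists_left_add_eq hn
  obtain ⟨l', hl'⟩ := H'.exists_left_add_eq (by omega)
  have h1 : ((n' - n : ℤ) : ℝ) * α = (2 * l' + 1 : ℤ) * (2 : ℝ)⁻¹ ^ n'
      - (2 * l + 1 : ℤ) * (2 : ℝ)⁻¹ ^ n - (a' - a) := by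
    push_cast; linarith
  have := eq_zero_of_int_mul_mem_dyadic hα (k := (n' - n : ℤ)) (by
    rw [h1]
    exact dyadic.sub_mem (dyadic.sub_mem (int_mul_mem_dyadic _ (half_pow_mem_dyadic _))
      (int_mul_mem_dyadic _ (half_pow_mem_dyadic _))) hd)
  omega

/-- The intervals `E α n` are strictly nested, at both ends: a common end would make a nonzero
multiple of `α` dyadic. -/
theorem IsSingleInterval.strict_nested {α a a' : ℝ} {n n' : ℕ} (hα : Irrational α)
    (H : IsSingleInterval α n a) (H' : IsSingleInterval α n' a') (hn : 1 ≤ n) (hn' : n < n')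
    (haa : |a' - a| < 1) :
    a < a' ∧ a' + 2 * (2 : ℝ)⁻¹ ^ n' < a + 2 * (2 : ℝ)⁻¹ ^ n := by
  have hr := half_pow_pos n
  have hr1 := half_pow_le_half hn
  have hd := H.sub_notMem_dyadic hα H' hn hn'
  obtain ⟨haa1, haa2⟩ := abs_lt.1 haa
  have h1 : a ≤ a' ∧ a' < a + 2 * (2 : ℝ)⁻¹ ^ n := by
    obtain ⟨k, hk1, hk2⟩ := (H a').1 (reach_anti α hn'.le H'.left_mem)
    have h2 : (-1 : ℝ) < k := by linarith
    have h3 : (k : ℝ) < 1 := by linarith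
    have h4 : -1 < k := by exact_mod_cast h2
    have h5 : k < 1 := by exact_mod_cast h3
    obtain rfl : k = 0 := by omega
    simp only [Int.cast_zero, mul_zero, add_zero] at hk1 hk2
    exact ⟨hk1, hk2⟩
  have h2 : a' + 2 * (2 : ℝ)⁻¹ ^ n' ≤ a + 2 * (2 : ℝ)⁻¹ ^ n := by
    by_contra! h2
    have h3 : a + 2 * (2 : ℝ)⁻¹ ^ n ∈ reach α n := by
      refine reach_anti α hn'.le ((H' _).2 ⟨0, ?_⟩)
      simp only [Int.cast_zero, mul_zero, add_zero]
      exact ⟨h1.2.le, h2⟩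
    obtain ⟨k, hk1, hk2⟩ := (H _).1 h3
    have h4 : (k : ℝ) < 0 := by linarith
    have h5 : (-1 : ℝ) < k := by linarith
    have h6 : -1 < k := by exact_mod_cast h5
    have h7 : k < 0 := by exact_mod_cast h4
    omega
  refine ⟨lt_of_le_of_ne h1.1 ?_, lt_of_le_of_ne h2 ?_⟩
  · rintro rfl
    exact hd (by simp)
  · intro h3
    refine hd ?_
    have : a' - a = (2 : ℤ) * (2 : ℝ)⁻¹ ^ n - (2 : ℤ) * (2 : ℝ)⁻¹ ^ n' := by push_cast; linarith
    rw [this]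
    exact dyadic.sub_mem (int_mul_mem_dyadic _ (half_pow_mem_dyadic _))
      (int_mul_mem_dyadic _ (half_pow_mem_dyadic _))

/-- The sets `reach α n` shrink to `y`, up to even integers, and `y` is interior to all of
them. -/
structure IsEscapePoint (α y : ℝ) : Prop where
  shrink : ∀ ε > 0, ∃ n, ∀ x ∈ reach α n, ∃ k : ℤ, |x - y - 2 * k| < ε
  interior : ∀ n, ∃ ε > 0, ∀ x, |x - y| < ε → x ∈ reach α n

theorem IsEscapePoint.mem_reach {α y : ℝ} (H : IsEscapePoint α y) (n : ℕ) : y ∈ reach α n := by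
  obtain ⟨ε, hε, h1⟩ := H.interior n
  exact h1 y (by simp [hε])

theorem IsEscapePoint.exists_eq_add {α y : ℝ} (H : IsEscapePoint α y) {x : ℝ}
    (hx : ∀ n, x ∈ reach α n) : ∃ k : ℤ, x = y + 2 * k := by
  refine ⟨round ((x - y) / 2), ?_⟩
  by_contra hne
  have h0 : 0 < |(x - y) / 2 - round ((x - y) / 2)| := by
    rw [abs_pos]
    intro h1
    exact hne (by linarith)
  obtain ⟨n, hn⟩ := H.shrink _ h0
  obtain ⟨k, hk⟩ := hn x (hx n)
  have h1 := round_le ((x - y) / 2) k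
  have h2 : |x - y - 2 * k| = 2 * |(x - y) / 2 - k| := by
    rw [← abs_two (α := ℝ), ← abs_mul, abs_two]; congr 1; ring
  have := abs_nonneg ((x - y) / 2 - k)
  linarith

/-- Infinitely many intervals, strictly nested at both ends, have exactly one common point, which is
interior to all of them. -/
theorem exists_isEscapePoint {α : ℝ} (hα : Irrational α)
    (hfr : ∃ᶠ n : ℕ in atTop, ∃ a, IsSingleInterval α n a) : ∃ y, IsEscapePoint α y := by
  obtain ⟨n₀, hn₀, a₀, ha₀⟩ := frequently_atTop.1 hfr 1
  have hr₀ := half_pow_le_half hn₀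
  set A : ℕ → ℝ → Prop := fun n a =>
    n₀ ≤ n ∧ IsSingleInterval α n a ∧ a ∈ Ico a₀ (a₀ + 2 * (2 : ℝ)⁻¹ ^ n₀) with hA
  have hex : ∀ m, ∃ n > m, ∃ a, A n a := by
    intro m
    obtain ⟨n, hn, a, ha⟩ := frequently_atTop.1 hfr (max (m + 1) n₀)
    have hn := max_le_iff.1 hn
    obtain ⟨k, hk⟩ := (ha₀ a).1 (reach_anti α hn.2 ha.left_mem)
    exact ⟨n, by omega, a + 2 * k, hn.2, ha.add_two_mul_int k, hk⟩
  have hnest : ∀ n n' a a', A n a → A n' a' → n < n' →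
      a < a' ∧ a' + 2 * (2 : ℝ)⁻¹ ^ n' < a + 2 * (2 : ℝ)⁻¹ ^ n := by
    rintro n n' a a' ⟨h1, h2, h3⟩ ⟨_, h4, h5⟩ hnn
    exact h2.strict_nested hα h4 (by omega) hnn
      (abs_lt.2 ⟨by linarith [h3.2, h5.1], by linarith [h3.1, h5.2]⟩)
  have huniq : ∀ n a a', A n a → A n a' → a = a' := by
    rintro n a a' h1 h2
    obtain ⟨n', hn', c, hc⟩ := hex n
    obtain ⟨k, hk⟩ := (h1.2.1 a').1 h2.2.1.left_mem
    obtain ⟨k', hk'⟩ := (h2.2.1 a).1 h1.2.1.left_mem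
    have h3 := h1.2.2
    have h4 := h2.2.2
    have h5 := half_pow_le_half (show 1 ≤ n by have := h1.1; omega)
    have h6 : (k : ℝ) < 1 := by linarith [hk.2, h3.2, h4.1]
    have h7 : (-1 : ℝ) < k := by linarith [hk.1, h3.1, h4.2]
    have h8 : (k' : ℝ) < 1 := by linarith [hk'.2, h3.1, h4.2, h3.2, h4.1]
    have h9 : (-1 : ℝ) < k' := by linarith [hk'.1, h3.1, h4.2, h3.2, h4.1]
    have h10 : -1 < k := by exact_mod_cast h7
    have h11 : k < 1 := by exact_mod_cast h6
    have h12 : -1 < k' := by exact_mod_cast h9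
    have h13 : k' < 1 := by exact_mod_cast h8
    obtain rfl : k = 0 := by omega
    obtain rfl : k' = 0 := by omega
    simp only [Int.cast_zero, mul_zero, add_zero] at hk hk'
    exact le_antisymm hk.1 hk'.1
  set S : Set ℝ := {a | ∃ n, A n a} with hS
  have hbound : ∀ n a, A n a → a + 2 * (2 : ℝ)⁻¹ ^ n ∈ upperBounds S := by
    rintro n a ha a' ⟨n', ha'⟩
    have h1 := half_pow_pos n
    have h2 := half_pow_pos n'
    rcases lt_trichotomy n n' with hnn | rfl | hnn
    · linarith [(hnest _ _ _ _ ha ha' hnn).2]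
    · rw [huniq _ _ _ ha ha']; linarith
    · linarith [(hnest _ _ _ _ ha' ha hnn).1]
  have hmem : ∀ n a, A n a → a < sSup S ∧ sSup S < a + 2 * (2 : ℝ)⁻¹ ^ n := by
    intro n a ha
    obtain ⟨n', hn', a', ha'⟩ := hex n
    have h1 := hnest _ _ _ _ ha ha' hn'
    have h2 : a' ≤ sSup S := le_csSup ⟨_, hbound _ _ ha⟩ ⟨n', ha'⟩
    have h3 : sSup S ≤ a' + 2 * (2 : ℝ)⁻¹ ^ n' := csSup_le ⟨a, n, ha⟩ (hbound _ _ ha')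
    constructor <;> linarith
  refine ⟨sSup S, fun ε hε => ?_, fun n => ?_⟩
  · obtain ⟨m, hm⟩ := exists_pow_lt_of_lt_one (half_pos hε) (by norm_num : (2 : ℝ)⁻¹ < 1)
    obtain ⟨n, hn, a, ha⟩ := hex m
    have h1 := hmem n a ha
    have h2 : (2 : ℝ)⁻¹ ^ n ≤ 2⁻¹ ^ m := pow_le_pow_of_le_one (by norm_num) (by norm_num) hn.le
    refine ⟨n, fun x hx => ?_⟩
    obtain ⟨k, hk⟩ := (ha.2.1 x).1 hx
    refine ⟨-k, abs_lt.2 ⟨?_, ?_⟩⟩ <;> push_cast <;> linarith [hk.1, hk.2]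
  · obtain ⟨n', hn', a, ha⟩ := hex n
    have h1 := hmem n' a ha
    refine ⟨min (sSup S - a) (a + 2 * (2 : ℝ)⁻¹ ^ n' - sSup S),
      lt_min (by linarith) (by linarith), fun x hx => ?_⟩
    rw [lt_min_iff, abs_lt, abs_lt] at hx
    refine reach_anti α hn'.le ((ha.2.1 x).2 ⟨0, ?_⟩)
    simp only [Int.cast_zero, mul_zero, add_zero]
    constructor <;> linarith

/-- Escape points of the slopes `α` and `-α` correspond to each other by reflection. -/
theorem IsEscapePoint.neg {α y : ℝ} (H : IsEscapePoint α y) : IsEscapePoint (-α) (-y) := by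
  refine ⟨fun ε hε => ?_, fun n => ?_⟩
  · obtain ⟨n, hn⟩ := H.shrink (ε / 2) (half_pos hε)
    refine ⟨n, fun x hx => ?_⟩
    obtain ⟨δ, h1, h2⟩ := ((eventually_neg_sub_mem_reach hx).and
      (Ioo_mem_nhdsGT (half_pos hε))).exists
    obtain ⟨k, hk⟩ := hn _ h1
    rw [abs_lt] at hk
    refine ⟨-k, abs_lt.2 ⟨?_, ?_⟩⟩ <;> push_cast <;> linarith [h2.1, h2.2]
  · obtain ⟨ε, hε, h1⟩ := H.interior n
    refine ⟨ε, hε, fun x hx j hj1 hj2 => ?_⟩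
    have h2 : |-x - y| < ε := by
      rw [← abs_neg]; convert hx using 2; ring
    have hr := half_pow_pos j
    set δ := min ((2 : ℝ)⁻¹ ^ j / 2) ((ε - |-x - y|) / 2) with hδ
    have h3 : 0 < δ := lt_min (by linarith) (by linarith)
    have h4 : δ ≤ (2 : ℝ)⁻¹ ^ j / 2 := min_le_left _ _
    have h5 : δ ≤ (ε - |-x - y|) / 2 := min_le_right _ _
    have h6 : |-x - δ - y| < ε := by
      rw [abs_lt] at h2 ⊢
      have := neg_abs_le (-x - y)
      have := le_abs_self (-x - y)
      constructor <;> linarith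
    have h7 := h1 _ h6 j hj1 hj2
    rw [sub_add_eq_add_sub] at h7
    obtain ⟨k, hk1, hk2⟩ := (h1 _ h2 j hj1 hj2).exists_mem_Ioo h3 (by linarith) h7
    exact ⟨-k, by push_cast; linarith, by push_cast; linarith⟩

/-! ### Trajectories starting on `L` -/

/-- The point of `L` of height `x` modulo `2`, as a left edge point of box `0`. -/
noncomputable def edgeL (x : ℝ) : Edge := ⟨0, wrap 0 x, wrap_mem _ _⟩

theorem edgeL_add_two_mul (x : ℝ) (k : ℤ) : edgeL (x + 2 * k) = edgeL x := by
  ext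
  · rfl
  · have := wrap_add_int_mul 0 x k
    rw [h_zero, mul_one, mul_comm] at this
    exact this

theorem edgeL_shift (x δ : ℝ) : (edgeL x).shift δ = edgeL (x + δ) := by
  ext
  · rfl
  · exact wrap_wrap_add _ _ _

theorem eq_edgeL {e : Edge} (he : e.box = 0) : e = edgeL e.y := by
  obtain ⟨b, y, hy⟩ := e
  obtain rfl : b = 0 := he
  ext
  · rfl
  · exact (wrap_eq_self hy).symm

theorem wrap_natCast_mem_iff (n : ℕ) (u : ℝ) :
    wrap n u ∈ Ico (-h (n + 1)) (h (n + 1)) ↔ PassesAperture (n + 1) u := by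
  have h1 : h ((n : ℤ) + 1) = (2 : ℝ)⁻¹ ^ (n + 1) := by
    have := h_natCast (n + 1); push_cast at this; exact this
  have h2 : 2 * h n = 4 * (2 : ℝ)⁻¹ ^ (n + 1) := by
    rw [h_natCast, pow_succ]; ring
  have hr := half_pow_pos (n + 1)
  rw [h1]
  constructor
  · intro hu
    obtain ⟨z, hz⟩ := exists_eq_wrap_add n u
    rw [h2] at hz
    refine ⟨-z, ?_⟩
    convert hu using 1
    push_cast; linarith
  · rintro ⟨k, hk⟩
    have h3 : wrap n u = u + k * (4 * (2 : ℝ)⁻¹ ^ (n + 1)) := by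
      rw [wrap_eq_iff]
      exact ⟨⟨by linarith [hk.1], by linarith [hk.2]⟩, -k, by rw [h2]; push_cast; ring⟩
    rwa [h3]

theorem wrap_succ_eq_of_mem {n : ℕ} {u : ℝ}
    (hu : wrap n u ∈ Ico (-h (n + 1)) (h (n + 1))) : wrap (n + 1) u = wrap n u := by
  obtain ⟨z, hz⟩ := exists_eq_wrap_add n u
  rw [wrap_eq_iff]
  refine ⟨hu, 2 * z, ?_⟩
  have := h_eq_two_mul_succ (k := n) (by positivity)
  rw [this] at hz
  push_cast; linarith

theorem box_iff_and_y (α x : ℝ) (n : ℕ) :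
    ((∀ i ≤ n, ((step α ^ i) (edgeL x)).box = i) ↔ x ∈ reach α n) ∧
      (x ∈ reach α n → ((step α ^ n) (edgeL x)).y = wrap n (x + n * α)) := by
  induction n with
  | zero =>
    refine ⟨⟨fun _ j h1 h2 => by omega, fun _ i hi => ?_⟩, fun _ => ?_⟩
    · obtain rfl : i = 0 := by omega
      simp [edgeL]
    · simp [edgeL]
  | succ n ih =>
    have hy : x ∈ reach α n → wrap n (((step α ^ n) (edgeL x)).y + α) =
        wrap n (x + (n + 1 : ℕ) * α) := fun hx => by
      rw [ih.2 hx, wrap_wrap_add]; congr 1; push_cast; ring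
    have hiff := wrap_natCast_mem_iff n (x + (n + 1 : ℕ) * α)
    refine ⟨⟨fun hb => ?_, fun hx i hi => ?_⟩, fun hx => ?_⟩
    · have hx : x ∈ reach α n := ih.1.1 fun i hi => hb i (by omega)
      refine mem_reach_succ.2 ⟨hx, ?_⟩
      rw [← hiff, ← hy hx]
      by_contra hout
      have h1 := hb n (by omega)
      have h2 := hb (n + 1) le_rfl
      rw [pow_succ', Equiv.Perm.mul_apply, step_box_of_notMem (by rw [h1]; exact hout), h1] at h2
      omega
    · rcases hi.lt_or_eq with h1 | rfl
      · exact ih.1.2 (mem_reach_succ.1 hx).1 i (by omega)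
      · rw [mem_reach_succ] at hx
        have h1 := ih.1.2 hx.1 n le_rfl
        rw [pow_succ', Equiv.Perm.mul_apply, step_box_of_mem, h1]
        · push_cast; ring
        · rw [h1, hy hx.1, hiff]
          exact hx.2
    · rw [mem_reach_succ] at hx
      have h1 := ih.1.2 hx.1 n le_rfl
      rw [pow_succ', Equiv.Perm.mul_apply, step_y, h1, hy hx.1]
      have := wrap_succ_eq_of_mem (hiff.2 hx.2)
      rw [← this]
      push_cast
      rfl

/-- The trajectory of `(0, x)` reaches the aperture number `n` without hitting a wall if and only
if `x ∈ reach α n`. -/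
theorem forall_box_eq_iff_mem_reach (α x : ℝ) (n : ℕ) :
    (∀ i ≤ n, ((step α ^ i) (edgeL x)).box = i) ↔ x ∈ reach α n :=
  (box_iff_and_y α x n).1

theorem step_pow_y_edgeL {α x : ℝ} {n : ℕ} (hx : x ∈ reach α n) :
    ((step α ^ n) (edgeL x)).y = wrap n (x + n * α) :=
  (box_iff_and_y α x n).2 hx

/-! ### Visits to the escape point -/

theorem step_zpow_add_one (α : ℝ) (e : Edge) (i : ℤ) :
    (step α ^ (i + 1)) e = step α ((step α ^ i) e) := by
  rw [add_comm, zpow_one_add, Equiv.Perm.mul_apply]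

theorem step_zpow_sub_one (α : ℝ) (e : Edge) (i : ℤ) :
    (step α ^ (i - 1)) e = (step α).symm ((step α ^ i) e) := by
  rw [Equiv.eq_symm_apply, ← step_zpow_add_one, sub_add_cancel]

theorem step_zpow_add (α : ℝ) (e : Edge) (i j : ℤ) :
    (step α ^ (i + j)) e = (step α ^ i) ((step α ^ j) e) := by
  rw [zpow_add, Equiv.Perm.mul_apply]

theorem step_zpow_natCast (α : ℝ) (e : Edge) (n : ℕ) :
    (step α ^ (n : ℤ)) e = (step α ^ n) e := by
  rw [zpow_natCast]

/-- A box with nonnegative number is reached from box `0` without hitting a wall. -/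
theorem box_zpow_sub {α : ℝ} {e : Edge} {i : ℤ} {n : ℕ} (hi : ((step α ^ i) e).box = n) :
    ∀ m : ℕ, m ≤ n → ((step α ^ (i - m)) e).box = n - m := by
  intro m
  induction m with
  | zero => simpa using hi
  | succ m ih =>
    intro hm
    have h1 := ih (by omega)
    have h2 : i - ((m + 1 : ℕ) : ℤ) = i - m - 1 := by push_cast; ring
    rw [h2, step_zpow_sub_one, step_symm_box_of_nonneg α (by omega), h1]
    push_cast; ring

theorem exists_edgeL_of_box_eq {α : ℝ} {e : Edge} {i : ℤ} {n : ℕ}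
    (hi : ((step α ^ i) e).box = n) :
    ∃ x ∈ reach α n, (step α ^ (i - n)) e = edgeL x := by
  have h0 : ((step α ^ (i - n)) e).box = 0 := by rw [box_zpow_sub hi n le_rfl, sub_self]
  refine ⟨_, ?_, eq_edgeL h0⟩
  rw [← forall_box_eq_iff_mem_reach]
  intro m hm
  rw [← eq_edgeL h0, ← step_zpow_natCast, ← step_zpow_add]
  have := box_zpow_sub hi (n - m) (by omega)
  rw [show (m : ℤ) + (i - n) = i - ((n - m : ℕ) : ℤ) by omega, this]
  omega

theorem box_zpow_add_of_box_eq_neg {α : ℝ} {e : Edge} (m : ℕ) {i : ℤ}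
    (hi : ((step α ^ i) e).box = -m) : ((step α ^ (i + m)) e).box = 0 := by
  induction m generalizing i with
  | zero => simpa using hi
  | succ m ih =>
    have := ih (i := i + 1) (by
      rw [step_zpow_add_one, step_box_of_neg α (by rw [hi]; omega), hi]; push_cast; ring)
    rw [← this]; congr 3; push_cast; ring

theorem IsEscapePoint.box_zpow {α y : ℝ} (H : IsEscapePoint α y) (m : ℕ) :
    ((step α ^ m) (edgeL y)).box = m :=
  (forall_box_eq_iff_mem_reach α y m).2 (H.mem_reach m) m le_rfl

/-- An orbit of the step map never hits a wall from some time on if and only if it passes through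
the escape point. -/
theorem IsEscapePoint.eventually_box_iff {α y : ℝ} (H : IsEscapePoint α y) (e : Edge) :
    (∃ i₀ : ℤ, ∀ i ≥ i₀, ((step α ^ i) e).box = ((step α ^ i₀) e).box + (i - i₀)) ↔
      ∃ i : ℤ, (step α ^ i) e = edgeL y := by
  constructor
  · rintro ⟨i₀, hi₀⟩
    set b := ((step α ^ i₀) e).box with hb
    set j := i₀ - b with hj
    have hbox : ∀ m : ℕ, i₀ ≤ j + m → ((step α ^ (j + m)) e).box = m := fun m hm => by
      rw [hi₀ _ hm]; omega
    have hreach : ∀ n : ℕ, ∃ x ∈ reach α n, (step α ^ j) e = edgeL x := by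
      intro n
      obtain ⟨x, hx, hxe⟩ := exists_edgeL_of_box_eq (hbox (max n b.toNat) (by omega))
      rw [add_sub_cancel_right] at hxe
      exact ⟨x, reach_anti α (le_max_left _ _) hx, hxe⟩
    obtain ⟨x, -, hx⟩ := hreach 0
    have hall : ∀ n, x ∈ reach α n := by
      intro n
      obtain ⟨x', h1, h2⟩ := hreach n
      rw [← forall_box_eq_iff_mem_reach] at h1 ⊢
      rwa [← hx, h2]
    obtain ⟨k, rfl⟩ := H.exists_eq_add hall
    exact ⟨j, by rw [hx, edgeL_add_two_mul]⟩
  · rintro ⟨i₀, hi₀⟩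
    refine ⟨i₀, fun i hi => ?_⟩
    obtain ⟨m, hm⟩ := Int.eq_ofNat_of_zero_le (sub_nonneg.2 hi)
    obtain rfl : i = m + i₀ := by omega
    rw [step_zpow_add, hi₀, step_zpow_natCast, H.box_zpow]
    simp [edgeL]

/-- A forward orbit that does not pass through the escape point reaches every aperture infinitely
often. -/
theorem IsEscapePoint.exists_ge_edgeL {α y : ℝ} (H : IsEscapePoint α y) (hα : Irrational α)
    {e : Edge} (he : ∀ i : ℤ, (step α ^ i) e ≠ edgeL y) (n : ℕ) (i₀ : ℤ) :
    ∃ i ≥ i₀, ∃ x ∈ reach α n, (step α ^ i) e = edgeL x := by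
  obtain ⟨i₁, hi₁, hb₁⟩ : ∃ i₁ ≥ i₀, ((step α ^ i₁) e).box = 0 := by
    have h1 : ∃ i ≥ i₀, ((step α ^ (i + 1)) e).box ≠ ((step α ^ i) e).box + 1 := by
      by_contra! h1
      obtain ⟨i, hi⟩ := (H.eventually_box_iff e).1 ⟨i₀, fun i hi => by
        obtain ⟨m, hm⟩ := Int.eq_ofNat_of_zero_le (sub_nonneg.2 hi)
        obtain rfl : i = i₀ + m := by omega
        clear hi hm
        induction m with
        | zero => simp
        | succ m ih =>
          have := h1 (i₀ + m) (by omega)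
          rw [show i₀ + ((m + 1 : ℕ) : ℤ) = i₀ + m + 1 by push_cast; ring, this, ih]
          ring⟩
      exact he i hi
    obtain ⟨i, hi, hne⟩ := h1
    rw [step_zpow_add_one] at hne
    have h2 := (step_box_eq_or α ((step α ^ i) e)).resolve_left hne
    have h3 : 0 ≤ ((step α ^ i) e).box := by
      by_contra h3
      exact hne (step_box_of_neg α (not_le.1 h3))
    obtain ⟨m, hm⟩ := Int.eq_ofNat_of_zero_le h3
    rw [← step_zpow_add_one, hm] at h2
    exact ⟨i + 1 + (m + 1 : ℕ), by omega, box_zpow_add_of_box_eq_neg (m + 1) (by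
      rw [h2]; push_cast; ring)⟩
  have hex := exists_notMem_boxRange hα (N := n + 1) (by omega) ((step α ^ i₁) e)
  classical
  -- The first exit from the boxes `-(n+1), …, n` is through the aperture number `n + 1`.
  set t := Nat.find hex with ht
  have ht1 := Nat.find_spec hex
  rw [← ht] at ht1
  have h0 : t ≠ 0 := by
    intro h0
    rw [h0] at ht1
    refine ht1 ⟨?_, ?_⟩ <;> simp only [pow_zero, Equiv.Perm.one_apply, hb₁] <;> push_cast <;> omega
  obtain ⟨s, hs⟩ := Nat.exists_eq_succ_of_ne_zero h0
  have hs1 : (step α ^ s) ((step α ^ i₁) e) ∈ boxRange (n + 1) := by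
    have := Nat.find_min hex (m := s) (by omega)
    exact not_not.1 this
  have hN : ((step α ^ t) ((step α ^ i₁) e)).box = (n + 1 : ℕ) := by
    rw [hs, Nat.succ_eq_add_one, pow_succ', Equiv.Perm.mul_apply] at ht1 ⊢
    obtain ⟨h3, h4⟩ := hs1
    simp only [boxRange, mem_ofPred_eq, not_and, not_lt] at ht1
    rcases step_box_eq_or α ((step α ^ s) ((step α ^ i₁) e)) with h5 | h5 <;> omega
  rw [← step_zpow_natCast, ← step_zpow_add] at hN
  obtain ⟨x, hx, hxe⟩ := exists_edgeL_of_box_eq hN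
  refine ⟨_, ?_, x, reach_anti α n.le_succ hx, hxe⟩
  by_contra hlt
  have h6 := box_zpow_sub hN t (by omega)
  rw [add_sub_cancel_left, hb₁] at h6
  omega

/-! ### Time reversal -/

/-- Reflection in the vertical axis, exchanging the left edge of each box with the right edge of
its mirror image. -/
def Edge.flip (e : Edge) : Edge :=
  ⟨-(e.box + 1), e.y, by rw [h_neg]; exact e.mem⟩

@[simp] theorem Edge.flip_box (e : Edge) : e.flip.box = -(e.box + 1) := rfl

@[simp] theorem Edge.flip_y (e : Edge) : e.flip.y = e.y := rfl

theorem Edge.flip_flip (e : Edge) : e.flip.flip = e := by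
  ext
  · simp
  · rfl

theorem transfer_symm_flip (e : Edge) : transfer.symm e.flip = (transfer e).flip := by
  have h1 : h (e.flip.box - 1) = h (e.box + 1) := by
    rw [Edge.flip_box, ← h_neg (e.box + 1)]; congr 1; ring
  ext
  · by_cases hs : e.y ∈ Ico (-h (e.box + 1)) (h (e.box + 1))
    · rw [transfer_symm_box_of_mem (by rwa [h1]), Edge.flip_box, Edge.flip_box,
        transfer_box_of_mem hs]; ring
    · rw [transfer_symm_box_of_notMem (by rwa [h1]), Edge.flip_box, Edge.flip_box,
        transfer_box_of_notMem hs]; ring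
  · simp

theorem cross_flip (α : ℝ) (e : Edge) : cross α e.flip = (cross α e).flip := by
  ext
  · rfl
  · exact wrap_congr (h_neg _) _

theorem cross_symm (α : ℝ) : (cross α).symm = cross (-α) := Equiv.ext fun _ => rfl

/-- Reflection in the vertical axis, as a map of left edge points. -/
noncomputable def mirror (e : Edge) : Edge := transfer e.flip

theorem mirror_transfer (e : Edge) : mirror (transfer e) = e.flip := by
  rw [mirror, ← transfer_symm_flip, Equiv.apply_symm_apply]

theorem mirror_mirror (e : Edge) : mirror (mirror e) = e := by
  rw [mirror.eq_1 e, mirror_transfer, Edge.flip_flip]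

theorem mirror_step_neg (α : ℝ) (e : Edge) :
    mirror (step (-α) (mirror e)) = (step α).symm e := by
  have h1 : transfer.symm e = (mirror e).flip := by
    rw [mirror, ← transfer_symm_flip, Edge.flip_flip]
  rw [step_symm_apply, h1, cross_symm, cross_flip, step_apply, mirror_transfer]

/-- The reflection conjugates the step map to the inverse of the step map of slope `-α`. -/
theorem step_neg_zpow_mirror (α : ℝ) (e : Edge) (i : ℤ) :
    (step (-α) ^ i) (mirror e) = mirror ((step α ^ (-i)) e) := by
  set M : Equiv.Perm Edge := Function.Involutive.toPerm mirror mirror_mirror with hM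
  have h1 : step (-α) = M * (step α)⁻¹ * M⁻¹ := by
    ext1 v
    change _ = mirror ((step α).symm (mirror v))
    rw [← mirror_step_neg, mirror_mirror, mirror_mirror]
  rw [h1, conj_zpow, inv_zpow']
  change mirror ((step α ^ (-i)) (mirror (mirror e))) = _
  rw [mirror_mirror]

theorem mirror_edgeL (x : ℝ) : mirror (edgeL x) = edgeL x := by
  ext
  · have : (edgeL x).flip.box < 0 := by simp [edgeL]
    rw [mirror, transfer_box_of_neg this]
    simp [edgeL]
  · simp [mirror]

/-- A backward orbit that does not pass through the reflected escape point comes from every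
aperture infinitely often. -/
theorem IsEscapePoint.exists_le_edgeL {α y : ℝ} (H : IsEscapePoint α y) (hα : Irrational α)
    {e : Edge} (he : ∀ i : ℤ, (step α ^ i) e ≠ edgeL (-y)) (n : ℕ) (i₀ : ℤ) :
    ∃ i ≤ i₀, ∃ x ∈ reach (-α) n, (step α ^ i) e = edgeL x := by
  obtain ⟨i, hi, x, hx, hxe⟩ := H.neg.exists_ge_edgeL hα.neg (e := mirror e) (fun i hi => by
    rw [step_neg_zpow_mirror] at hi
    refine he (-i) ?_
    rw [← mirror_mirror ((step α ^ (-i)) e), hi, mirror_edgeL]) n (-i₀)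
  rw [step_neg_zpow_mirror] at hxe
  refine ⟨-i, by omega, x, hx, ?_⟩
  rw [← mirror_mirror ((step α ^ (-i)) e), hxe, mirror_edgeL]

/-- An orbit of the step map hits no wall up to some time if and only if it passes through the
reflected escape point. -/
theorem IsEscapePoint.eventually_box_iff_neg {α y : ℝ} (H : IsEscapePoint α y) (e : Edge) :
    (∃ i₀ : ℤ, ∀ i ≤ i₀, ((step α ^ i) e).box = ((step α ^ i₀) e).box + (i - i₀)) ↔
      ∃ i : ℤ, (step α ^ i) e = edgeL (-y) := by
  have hmir : (∃ i : ℤ, (step (-α) ^ i) (mirror e) = edgeL (-y)) ↔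
      ∃ i : ℤ, (step α ^ i) e = edgeL (-y) := by
    constructor <;> rintro ⟨i, hi⟩ <;> refine ⟨-i, ?_⟩
    · rw [step_neg_zpow_mirror] at hi
      rw [← mirror_mirror ((step α ^ (-i)) e), hi, mirror_edgeL]
    · rw [step_neg_zpow_mirror, neg_neg, hi, mirror_edgeL]
  rw [← hmir]
  constructor
  · rintro ⟨i₀, hi₀⟩
    rw [← H.neg.eventually_box_iff]
    set b := ((step α ^ i₀) e).box with hb
    have hbox : ∀ i ≤ i₀, ((step (-α) ^ (-i)) (mirror e)).box = -(b + (i - i₀)) := by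
      intro i hi
      rw [step_neg_zpow_mirror, neg_neg]
      have h1 := hi₀ i hi
      have h2 := hi₀ (i - 1) (by omega)
      -- The predecessor lies in the next box to the left, which bounds the height.
      have h3 : ((step α ^ i) e).y ∈ Ico (-h (((step α ^ i) e).box - 1))
          (h (((step α ^ i) e).box - 1)) := by
        have h4 : ((step α ^ i) e).y = (cross α ((step α ^ (i - 1)) e)).y := by
          rw [← transfer_y (cross α _), ← step_apply, ← step_zpow_add_one, sub_add_cancel]
        have h5 := (cross α ((step α ^ (i - 1)) e)).mem
        rw [← h4, cross_box, h2] at h5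
        rw [h1]
        rwa [show b + (i - i₀) - 1 = b + (i - 1 - i₀) by ring]
      rw [mirror, transfer_box_of_mem, Edge.flip_box, h1]
      · ring
      · rw [Edge.flip_box, Edge.flip_y, neg_add_rev, neg_add_cancel_comm, h_neg_eq_h_sub_one]
        exact h3
    refine ⟨-i₀, fun i hi => ?_⟩
    have h1 := hbox (-i) (by omega)
    rw [neg_neg] at h1
    rw [h1, hbox i₀ le_rfl]
    ring
  · rintro ⟨i₀, hi₀⟩
    have h0 : (step α ^ (-i₀)) e = edgeL (-y) := by
      rw [step_neg_zpow_mirror] at hi₀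
      rw [← mirror_mirror ((step α ^ (-i₀)) e), hi₀, mirror_edgeL]
    refine ⟨-i₀, fun i hi => ?_⟩
    obtain ⟨m, hm⟩ := Int.eq_ofNat_of_zero_le (by omega : 0 ≤ -i₀ - i)
    have h1 : (step α ^ i) e = mirror ((step (-α) ^ m) (edgeL (-y))) := by
      rw [← hi₀, ← step_zpow_natCast, ← step_zpow_add, step_neg_zpow_mirror, mirror_mirror]
      congr 2; omega
    have h2 := H.neg.box_zpow m
    rw [h0, h1, mirror, transfer_box_of_neg]
    · rw [Edge.flip_box, h2]; simp [edgeL]; omega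
    · rw [Edge.flip_box, h2]; omega

/-! ### The rotation by `π` -/

/-- The left edge points over the corners of the billiard table. -/
def Edge.IsVertex (e : Edge) : Prop :=
  |e.y| = h |e.box| ∨ |e.y| = h (|e.box| - 1) ∨ (e.box = 0 ∧ e.y = 0)

theorem Edge.IsSingular.isVertex {e : Edge} (he : e.IsSingular) : e.IsVertex := Or.inl he.2

/-- The rotation by `π` about the origin, from left edges to right edges. -/
noncomputable def Edge.turn (e : Edge) : Edge :=
  ⟨-(e.box + 1), wrap (-(e.box + 1)) (-e.y), wrap_mem _ _⟩

@[simp] theorem Edge.turn_box (e : Edge) : e.turn.box = -(e.box + 1) := rfl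

@[simp] theorem Edge.turn_y (e : Edge) : e.turn.y = wrap (-(e.box + 1)) (-e.y) := rfl

theorem wrap_neg_wrap_add (k : ℤ) (y a : ℝ) : wrap k (-wrap k y + a) = wrap k (-y + a) := by
  obtain ⟨z, hz⟩ := exists_eq_wrap_add k y
  have : -y + a = -wrap k y + a + (-z : ℤ) * (2 * h k) := by push_cast; linarith
  rw [this, wrap_add_int_mul]

theorem cross_turn_cross (α : ℝ) (e : Edge) : cross α (cross α e).turn = e.turn := by
  ext
  · rfl
  · simp only [cross_y, Edge.turn_y, Edge.turn_box, cross_box, wrap_wrap_add]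
    rw [wrap_congr (h_neg e.box), wrap_neg_wrap_add, wrap_congr (h_neg e.box)]
    congr 1; ring

theorem abs_wrap_neg {k : ℤ} {y : ℝ} (hy : y ∈ Ico (-h k) (h k)) : |wrap k (-y)| = |y| := by
  rcases hy.1.eq_or_lt with h1 | h1
  · have h2 : wrap k (-y) = y := by
      rw [wrap_eq_iff]
      exact ⟨hy, 1, by push_cast; linarith⟩
    rw [h2]
  · rw [wrap_eq_self ⟨by linarith [hy.2], by linarith⟩, abs_neg]

theorem abs_transfer_box (e : Edge) : |(transfer e).box| = |e.box + 1| := by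
  by_cases hs : e.y ∈ Ico (-h (e.box + 1)) (h (e.box + 1))
  · rw [transfer_box_of_mem hs]
  · rw [transfer_box_of_notMem hs, abs_neg]

theorem isVertex_transfer_of_abs {e : Edge}
    (he : |e.y| = h e.box ∨ |e.y| = h (e.box + 1)) : (transfer e).IsVertex := by
  rw [Edge.IsVertex, abs_transfer_box, transfer_y]
  rcases le_or_gt 0 e.box with hb | hb
  · rw [abs_of_pos (by omega : 0 < e.box + 1), add_sub_cancel_right]
    tauto
  · rw [abs_of_nonpos (by omega : e.box + 1 ≤ 0), h_neg,
      show -(e.box + 1) - 1 = -(e.box + 1 + 1) by ring, h_neg]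
    tauto

/-- The rotation by `π` reverses the passage from right edges to left edges, except at vertices. -/
theorem turn_transfer {e : Edge} (he : ¬ (transfer e).IsVertex) :
    (transfer e).turn = transfer.symm e.turn := by
  have h1 : |e.y| ≠ h e.box := fun h2 => he (isVertex_transfer_of_abs (Or.inl h2))
  have h2 : |e.y| ≠ h (e.box + 1) := fun h2 => he (isVertex_transfer_of_abs (Or.inr h2))
  have hp := h_pos e.box
  have hp' := h_pos (e.box + 1)
  have h3 : -h e.box < e.y := lt_of_le_of_ne e.mem.1 fun h4 => h1 (by
    rw [← h4, abs_neg, abs_of_pos hp])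
  have h4 : wrap e.box (-e.y) = -e.y := wrap_eq_self ⟨by linarith [e.mem.2], by linarith⟩
  have h5 : h (e.turn.box - 1) = h (e.box + 1) := by
    rw [Edge.turn_box, ← h_neg (e.box + 1)]; congr 1; ring
  have h6 : e.turn.y = -e.y := by rw [Edge.turn_y, wrap_congr (h_neg e.box), h4]
  by_cases hs : e.y ∈ Ico (-h (e.box + 1)) (h (e.box + 1))
  · have h7 : -h (e.box + 1) < e.y := lt_of_le_of_ne hs.1 fun h4 => h2 (by
      rw [← h4, abs_neg, abs_of_pos hp'])
    have h8 : -e.y ∈ Ico (-h (e.box + 1)) (h (e.box + 1)) :=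
      ⟨by linarith [hs.2], by linarith⟩
    have hb := transfer_box_of_mem hs
    ext
    · rw [transfer_symm_box_of_mem (by rw [h5, h6]; exact h8), Edge.turn_box, Edge.turn_box, hb]
      ring
    · rw [transfer_symm_y, h6, Edge.turn_y, transfer_y, hb, wrap_congr (h_neg (e.box + 1)),
        wrap_eq_self h8]
  · have h8 : -e.y ∉ Ico (-h (e.box + 1)) (h (e.box + 1)) := by
      rintro ⟨h9, h10⟩
      refine hs ⟨by linarith, lt_of_le_of_ne (by linarith) fun h11 => h2 ?_⟩
      rw [h11, abs_of_pos hp']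
    have hb := transfer_box_of_notMem hs
    ext
    · rw [transfer_symm_box_of_notMem (by rw [h5, h6]; exact h8), Edge.turn_box, Edge.turn_box,
        hb]
      ring
    · rw [transfer_symm_y, h6, Edge.turn_y, transfer_y, hb]
      have h9 : -(-(e.box + 1) + 1) = e.box := by ring
      rw [h9, h4]

/-- The rotation by `π` about the origin, as a map of left edge points. -/
noncomputable def rotate (e : Edge) : Edge := transfer e.turn

theorem step_rotate_step {α : ℝ} {e : Edge} (he : ¬ (step α e).IsVertex) :
    step α (rotate (step α e)) = rotate e := by
  rw [rotate, step_apply α e, turn_transfer he, Equiv.apply_symm_apply, step_apply,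
    cross_turn_cross, rotate]

theorem isVertex_rotate {e : Edge} : (rotate e).IsVertex ↔ e.IsVertex := by
  have h1 : |(rotate e).box| = |e.box| := by
    rw [rotate, abs_transfer_box, Edge.turn_box, ← abs_neg]; congr 1; ring
  have h2 : |(rotate e).y| = |e.y| := by
    rw [rotate, transfer_y, Edge.turn_y, wrap_congr (h_neg e.box), abs_wrap_neg e.mem]
  rw [Edge.IsVertex, Edge.IsVertex, h1, h2, ← abs_eq_zero, h1, abs_eq_zero,
    ← abs_eq_zero (a := (rotate e).y), h2, abs_eq_zero]

theorem rotate_edgeL (x : ℝ) : rotate (edgeL x) = edgeL (-x) := by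
  ext
  · rw [rotate, transfer_box_of_neg (by simp [edgeL])]
    simp [edgeL]
  · simp only [rotate, transfer_y, Edge.turn_y]
    rw [wrap_congr (h_neg _)]
    have := wrap_neg_wrap_add 0 x 0
    rw [add_zero, add_zero] at this
    exact this

/-- The points fixed by the rotation by `π` are vertices. -/
theorem isVertex_of_rotate_eq {e : Edge} (he : rotate e = e) : e.IsVertex := by
  have hy : wrap e.box (-e.y) = e.y := by
    have := congrArg Edge.y he
    rwa [rotate, transfer_y, Edge.turn_y, wrap_congr (h_neg e.box)] at this
  have hp := h_pos e.box
  rcases e.mem.1.eq_or_lt with h1 | h1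
  · have h2 : |e.y| = h e.box := by rw [← h1, abs_neg, abs_of_pos hp]
    rcases le_or_gt 0 e.box with hb | hb
    · exact Or.inl (by rw [abs_of_nonneg hb, h2])
    · refine Or.inr (Or.inl ?_)
      rw [abs_of_neg hb, h2, ← h_neg]; congr 1; ring
  · rw [wrap_eq_self ⟨by linarith [e.mem.2], by linarith⟩] at hy
    have h0 : e.y = 0 := by linarith
    refine Or.inr (Or.inr ⟨?_, h0⟩)
    have hb := congrArg Edge.box he
    rw [rotate, transfer_box_of_mem, Edge.turn_box] at hb
    · omega
    · have hp' := h_pos (e.turn.box + 1)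
      rw [Edge.turn_y, h0, neg_zero, wrap_eq_self]
      · exact ⟨by linarith, hp'⟩
      · have := h_pos (-(e.box + 1))
        exact ⟨by linarith, this⟩

/-- The forward orbit of the reflected escape point is the image by rotation of the backward orbit
of the escape point. -/
theorem step_pow_edgeL_neg {α y : ℝ}
    (hv : ∀ i : ℤ, i ≤ 0 → ¬ ((step α ^ i) (edgeL y)).IsVertex) (m : ℕ) :
    (step α ^ m) (edgeL (-y)) = rotate ((step α ^ (-m : ℤ)) (edgeL y)) := by
  induction m with
  | zero => simp [rotate_edgeL]
  | succ m ih =>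
    rw [pow_succ', Equiv.Perm.mul_apply, ih]
    have h1 : (step α ^ (-m : ℤ)) (edgeL y) = step α ((step α ^ (-(m + 1 : ℕ) : ℤ)) (edgeL y)) := by
      rw [← step_zpow_add_one]; congr 2; push_cast; ring
    rw [h1]
    refine step_rotate_step ?_
    rw [← h1]
    exact hv _ (by omega)

/-- The orbit of the reflected escape point does not pass through the escape point: the middle of
the connecting trajectory would be fixed by the rotation, hence a vertex. -/
theorem IsEscapePoint.zpow_edgeL_neg_ne {α y : ℝ} (H : IsEscapePoint α y)
    (hv : ∀ i : ℤ, i ≤ 0 → ¬ ((step α ^ i) (edgeL y)).IsVertex) (i : ℤ) :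
    (step α ^ i) (edgeL (-y)) ≠ edgeL y := by
  intro hi
  rcases lt_or_ge i 0 with hneg | hpos
  · -- The escape orbit does not return to box `0`.
    obtain ⟨m, hm⟩ := Int.eq_ofNat_of_zero_le (by omega : 0 ≤ -i)
    have h1 : (step α ^ m) (edgeL y) = edgeL (-y) := by
      rw [← hi, ← step_zpow_natCast, ← step_zpow_add, show (m : ℤ) + i = 0 by omega]
      simp
    have h2 := H.box_zpow m
    rw [h1] at h2
    simp only [edgeL] at h2
    omega
  · obtain ⟨k, rfl⟩ := Int.eq_ofNat_of_zero_le hpos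
    have hpq : ∀ m n : ℕ, m + n = k → (step α ^ m) (edgeL (-y)) =
        (step α ^ (-n : ℤ)) (edgeL y) := by
      intro m n hmn
      rw [← hi, ← step_zpow_add, ← step_zpow_natCast]
      congr 2; omega
    obtain ⟨l, hl | hl⟩ := Nat.even_or_odd' k
    · have h1 := hpq l l (by omega)
      rw [step_pow_edgeL_neg hv] at h1
      exact hv _ (by omega) (isVertex_of_rotate_eq h1)
    · -- The middle is halfway across a box, which would have to be its own image; no box is.
      have h1 := hpq (l + 1) l (by omega)
      rw [step_pow_edgeL_neg hv] at h1
      have h2 : (step α ^ (-l : ℤ)) (edgeL y) =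
          step α ((step α ^ (-(l + 1 : ℕ) : ℤ)) (edgeL y)) := by
        rw [← step_zpow_add_one]; congr 2; push_cast; ring
      rw [h2, rotate, step_apply, EmbeddingLike.apply_eq_iff_eq] at h1
      have h3 := congrArg Edge.box h1
      rw [Edge.turn_box, cross_box] at h3
      omega

/-- The forward orbit of the escape point meets no singular vertex. -/
theorem IsEscapePoint.not_isSingular {α y : ℝ} (H : IsEscapePoint α y) {m : ℕ} (hm : 1 ≤ m) :
    ¬ ((step α ^ m) (edgeL y)).IsSingular := by
  rintro ⟨-, h1⟩
  have hbox := H.box_zpow m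
  obtain ⟨n, rfl⟩ := Nat.exists_eq_add_of_le' hm
  obtain ⟨ε, hε, hint⟩ := H.interior (n + 1)
  have hr := half_pow_pos (n + 1)
  set δ := min (ε / 2) ((2 : ℝ)⁻¹ ^ (n + 1) / 2) with hδ
  have hδ0 : 0 < δ := lt_min (by linarith) (by linarith)
  have hδ1 : δ ≤ ε / 2 := min_le_left _ _
  have hδ2 : δ ≤ (2 : ℝ)⁻¹ ^ (n + 1) / 2 := min_le_right _ _
  have h2 := hint (y - δ) (by rw [sub_sub_cancel_left, abs_neg, abs_of_pos hδ0]; linarith)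
    (n + 1) (by omega) le_rfl
  rw [sub_add_eq_add_sub] at h2
  obtain ⟨k, hk1, hk2⟩ := (H.mem_reach (n + 1) (n + 1) (by omega) le_rfl).exists_mem_Ioo
    hδ0 (by linarith) h2
  have h3 : ((step α ^ (n + 1)) (edgeL y)).y = y + (n + 1 : ℕ) * α +
      k * (4 * (2 : ℝ)⁻¹ ^ (n + 1)) := by
    rw [step_pow_y_edgeL (H.mem_reach (n + 1)), wrap_eq_iff, h_natCast]
    exact ⟨⟨hk1.le, hk2⟩, -2 * k, by push_cast; ring⟩
  rw [hbox, Nat.abs_cast, h_natCast, h3] at h1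
  have := abs_lt.2 ⟨hk1, hk2⟩
  linarith

/-! ### The flow in terms of the step map -/

theorem speed_pos (α : ℝ) : 0 < speed α := by unfold speed; positivity

/-- The point at horizontal distance `u`, measured along the trajectory, from a left edge point. -/
noncomputable def Edge.travel (α : ℝ) (e : Edge) (u : ℝ) : Phase :=
  ((step α ^ ⌊u⌋) e).advance α u

theorem floor_advance_x (α : ℝ) (e : Edge) (u : ℝ) : ⌊(e.advance α u).x⌋ = e.box := by
  simp [Edge.advance]

theorem fract_advance_x (α : ℝ) (e : Edge) (u : ℝ) :
    Int.fract (e.advance α u).x = Int.fract u := by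
  simp [Edge.advance]

theorem advance_base (α : ℝ) (e : Edge) (u : ℝ) : (e.advance α u).base α = e := by
  have h1 := floor_advance_x α e u
  have h2 := fract_advance_x α e u
  refine Edge.ext h1 ?_
  change wrap ⌊(e.advance α u).x⌋ ((e.advance α u).y - α * Int.fract (e.advance α u).x) = e.y
  rw [h1, h2]
  change wrap e.box (wrap e.box (e.y + α * Int.fract u) - α * Int.fract u) = e.y
  rw [sub_eq_add_neg, wrap_wrap_add, add_neg_cancel_right, wrap_eq_self e.mem]

theorem advance_congr (α : ℝ) (e : Edge) {u v : ℝ} (huv : Int.fract u = Int.fract v) :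
    e.advance α u = e.advance α v := by
  ext <;> simp [Edge.advance, huv]

theorem flow_travel (α t : ℝ) (e : Edge) (u : ℝ) :
    flow α t (e.travel α u) = e.travel α (u + t * speed α) := by
  have h1 : Int.fract u + t * speed α = u + t * speed α - ⌊u⌋ := by rw [← Int.self_sub_floor]; ring
  unfold flow Edge.travel
  rw [advance_base, fract_advance_x, h1, ← step_zpow_add, Int.floor_sub_intCast, sub_add_cancel]
  exact advance_congr α _ (Int.fract_sub_intCast _ _)

theorem travel_base (α : ℝ) (z : Phase) : (z.base α).travel α (Int.fract z.x) = z := by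
  unfold Edge.travel
  rw [Int.floor_fract, zpow_zero, Equiv.Perm.one_apply]
  ext
  · simp [Edge.advance, Phase.base, Int.floor_add_fract]
  · simp only [Edge.advance, Phase.base, Int.fract_fract]
    rw [wrap_wrap_add, sub_add_cancel, wrap_eq_self z.mem]

theorem travel_zpow (α : ℝ) (e : Edge) (i : ℤ) (u : ℝ) :
    ((step α ^ i) e).travel α u = e.travel α (u + i) := by
  unfold Edge.travel
  rw [← step_zpow_add, Int.floor_add_intCast]
  exact advance_congr α _ (Int.fract_add_intCast _ _).symm

theorem travel_x (α : ℝ) (e : Edge) (u : ℝ) :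
    (e.travel α u).x = ((step α ^ ⌊u⌋) e).box + Int.fract u := rfl

theorem travel_intCast_x (α : ℝ) (e : Edge) (i : ℤ) :
    (e.travel α i).x = ((step α ^ i) e).box := by
  rw [travel_x, Int.fract_intCast, add_zero, Int.floor_intCast]

theorem travel_intCast_y (α : ℝ) (e : Edge) (i : ℤ) :
    (e.travel α i).y = ((step α ^ i) e).y := by
  simp only [Edge.travel, Edge.advance, Int.fract_intCast, Int.floor_intCast, mul_zero, add_zero]
  exact wrap_eq_self (Edge.mem _)

theorem orbit_travel (α : ℝ) (e : Edge) (u : ℝ) :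
    orbit α (e.travel α u) = range (e.travel α) := by
  ext z
  constructor
  · rintro ⟨t, rfl⟩
    exact ⟨_, (flow_travel α t e u).symm⟩
  · rintro ⟨v, rfl⟩
    refine ⟨(v - u) / speed α, ?_⟩
    change flow α _ _ = _
    rw [flow_travel, div_mul_cancel₀ _ (speed_pos α).ne', add_sub_cancel]

theorem orbit_eq_range (α : ℝ) (z : Phase) : orbit α z = range ((z.base α).travel α) := by
  conv_lhs => rw [← travel_base α z]
  exact orbit_travel α _ _

theorem range_travel_eq_iff (α : ℝ) (e e' : Edge) :
    range (e.travel α) = range (e'.travel α) ↔ ∃ i : ℤ, (step α ^ i) e = e' := by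
  constructor
  · intro hr
    obtain ⟨u, hu⟩ : e'.travel α 0 ∈ range (e.travel α) := hr ▸ mem_range_self 0
    refine ⟨⌊u⌋, ?_⟩
    have := congrArg (Phase.base α) hu
    simp only [Edge.travel, advance_base] at this
    simpa using this
  · rintro ⟨i, rfl⟩
    rw [← orbit_travel α e i, ← orbit_travel α _ 0, travel_zpow, zero_add]

theorem flow_eq_travel (α t : ℝ) (z : Phase) :
    flow α t z = (z.base α).travel α (Int.fract z.x + t * speed α) := by
  conv_lhs => rw [← travel_base α z]
  rw [flow_travel]

theorem flow_div_speed (α : ℝ) (z : Phase) (u : ℝ) :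
    flow α ((u - Int.fract z.x) / speed α) z = (z.base α).travel α u := by
  rw [flow_eq_travel, div_mul_cancel₀ _ (speed_pos α).ne', add_sub_cancel]

theorem onL_eq_travel (α : ℝ) {y : ℝ} (hy : y ∈ Ico (-1 : ℝ) 1) :
    onL y hy = (edgeL y).travel α 0 := by
  have h1 : wrap 0 y = y := wrap_eq_self (by simpa using hy)
  have h2 := travel_intCast_x α (edgeL y) 0
  have h3 := travel_intCast_y α (edgeL y) 0
  rw [Int.cast_zero, zpow_zero, Equiv.Perm.one_apply] at h2 h3
  ext
  · rw [h2]; simp [onL, edgeL]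
  · rw [h3]; simp [onL, edgeL, h1]

theorem flow_onL (α : ℝ) {y : ℝ} (hy : y ∈ Ico (-1 : ℝ) 1) (u : ℝ) :
    flow α (u / speed α) (onL y hy) = (edgeL y).travel α u := by
  rw [onL_eq_travel α hy, flow_travel, div_mul_cancel₀ _ (speed_pos α).ne', zero_add]

theorem mem_E_iff {α y : ℝ} {n : ℕ} : y ∈ E α n ↔ y ∈ Ico (-1 : ℝ) 1 ∧ y ∈ reach α n := by
  rw [← forall_box_eq_iff_mem_reach]
  have key : ∀ (hy : y ∈ Ico (-1 : ℝ) 1) (i : ℕ), (flow α (i / speed α) (onL y hy)).x = i ↔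
      ((step α ^ i) (edgeL y)).box = i := fun hy i => by
    have h1 := travel_intCast_x α (edgeL y) i
    rw [Int.cast_natCast, step_zpow_natCast] at h1
    rw [flow_onL, h1]
    norm_cast
  constructor
  · rintro ⟨hy, h1⟩
    exact ⟨hy, fun i hi => (key hy i).1 (h1 i hi)⟩
  · rintro ⟨hy, h1⟩
    exact ⟨hy, fun i hi => (key hy i).2 (h1 i hi)⟩

theorem escapes_iff (α : ℝ) (z : Phase) : Escapes α z ↔ ∃ i₀ : ℤ, ∀ i ≥ i₀,
    ((step α ^ i) (z.base α)).box = ((step α ^ i₀) (z.base α)).box + (i - i₀) := by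
  have hs := speed_pos α
  constructor
  · rintro ⟨t₀, ht₀⟩
    set i₀ := ⌈Int.fract z.x + t₀ * speed α⌉ with hi₀
    have key : ∀ i ≥ i₀, (((step α ^ i) (z.base α)).box : ℝ) =
        (flow α t₀ z).x + (i - Int.fract z.x - t₀ * speed α) := by
      intro i hi
      have h1 : t₀ ≤ (i - Int.fract z.x) / speed α := by
        rw [le_div_iff₀ hs]
        have := Int.ceil_le.1 hi
        linarith
      have h2 := ht₀ _ h1
      rw [flow_div_speed, travel_intCast_x, sub_mul, div_mul_cancel₀ _ hs.ne'] at h2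
      exact h2
    refine ⟨i₀, fun i hi => ?_⟩
    have h1 := key i hi
    have h2 := key i₀ le_rfl
    have h3 : (((step α ^ i) (z.base α)).box : ℝ) =
        ((step α ^ i₀) (z.base α)).box + (i - i₀) := by linarith
    exact_mod_cast h3
  · rintro ⟨i₀, hi₀⟩
    refine ⟨(i₀ - Int.fract z.x) / speed α, fun t ht => ?_⟩
    rw [ge_iff_le, div_le_iff₀ hs] at ht
    rw [flow_div_speed, travel_intCast_x, flow_eq_travel, travel_x,
      hi₀ _ (Int.le_floor.2 (by linarith)), sub_mul, div_mul_cancel₀ _ hs.ne',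
      ← Int.self_sub_floor (Int.fract z.x + t * speed α)]
    push_cast; ring

theorem escapesInPast_iff (α : ℝ) (z : Phase) : EscapesInPast α z ↔ ∃ i₀ : ℤ, ∀ i ≤ i₀,
    ((step α ^ i) (z.base α)).box = ((step α ^ i₀) (z.base α)).box + (i - i₀) := by
  have hs := speed_pos α
  constructor
  · rintro ⟨t₀, ht₀⟩
    set i₀ := ⌊Int.fract z.x + t₀ * speed α⌋ with hi₀
    have key : ∀ i ≤ i₀, (((step α ^ i) (z.base α)).box : ℝ) =
        (flow α t₀ z).x + (i - Int.fract z.x - t₀ * speed α) := by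
      intro i hi
      have h1 : (i - Int.fract z.x) / speed α ≤ t₀ := by
        rw [div_le_iff₀ hs]
        have := Int.le_floor.1 hi
        linarith
      have h2 := ht₀ _ h1
      rw [flow_div_speed, travel_intCast_x, sub_mul, div_mul_cancel₀ _ hs.ne'] at h2
      exact h2
    refine ⟨i₀, fun i hi => ?_⟩
    have h1 := key i hi
    have h2 := key i₀ le_rfl
    have h3 : (((step α ^ i) (z.base α)).box : ℝ) =
        ((step α ^ i₀) (z.base α)).box + (i - i₀) := by linarith
    exact_mod_cast h3
  · rintro ⟨i₀, hi₀⟩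
    refine ⟨(i₀ - Int.fract z.x) / speed α, fun t ht => ?_⟩
    rw [le_div_iff₀ hs] at ht
    have h1 : ⌊Int.fract z.x + t * speed α⌋ ≤ i₀ := by
      have := Int.floor_le (Int.fract z.x + t * speed α)
      have h2 : ((⌊Int.fract z.x + t * speed α⌋ : ℤ) : ℝ) ≤ i₀ := by linarith
      exact_mod_cast h2
    rw [flow_div_speed, travel_intCast_x, flow_eq_travel, travel_x, hi₀ _ h1, sub_mul,
      div_mul_cancel₀ _ hs.ne', ← Int.self_sub_floor (Int.fract z.x + t * speed α)]
    push_cast; ring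

theorem isVertex_travel_intCast {α : ℝ} {e : Edge} {i : ℤ} (hv : ((step α ^ i) e).IsVertex) :
    IsVertex (e.travel α i) := by
  unfold IsVertex
  rw [travel_intCast_x, travel_intCast_y]
  set s := (step α ^ i) e
  rcases eq_or_ne s.box 0 with h0 | h0
  · left
    refine ⟨by simp [h0], ?_⟩
    rcases hv with h1 | h1 | h1
    · right; simpa [h0] using h1
    · right; simpa [h0] using h1
    · exact Or.inl h1.2
  · right
    obtain ⟨m, hm⟩ := Nat.exists_eq_succ_of_ne_zero (Int.natAbs_ne_zero.2 h0)
    have hb : |s.box| = (m + 1 : ℕ) := by rw [Int.abs_eq_natAbs, hm]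
    refine ⟨m + 1, by omega, by exact_mod_cast hb, ?_⟩
    rcases hv with h1 | h1 | h1
    · left; rw [h1, hb, h_natCast]
    · right
      rw [h1, hb, ← h_natCast]; congr 1; push_cast; simp
    · exact absurd h1.1 h0

/-- A vertex on a trajectory has integral abscissa and dyadic height. -/
theorem exists_of_isVertex_travel {α u : ℝ} {e : Edge} (hv : IsVertex (e.travel α u)) :
    ∃ i : ℤ, u = i ∧ ((step α ^ i) e).y ∈ dyadic := by
  have hint : ∃ m : ℤ, (e.travel α u).x = m := by
    rcases hv with h1 | ⟨n, -, h1, -⟩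
    · exact ⟨0, by simpa using h1.1⟩
    · rcases eq_or_eq_neg_of_abs_eq h1 with h2 | h2
      · exact ⟨n, by simpa using h2⟩
      · exact ⟨-n, by simpa using h2⟩
  obtain ⟨m, hm⟩ := hint
  have hu : u = ⌊u⌋ := by
    have h1 := fract_advance_x α ((step α ^ ⌊u⌋) e) u
    change Int.fract (e.travel α u).x = _ at h1
    rw [hm, Int.fract_intCast] at h1
    have := Int.self_sub_floor u
    linarith
  refine ⟨⌊u⌋, hu, ?_⟩
  rw [← travel_intCast_y, ← hu]
  have habs : ∀ {a b : ℝ}, |a| = b → b ∈ dyadic → a ∈ dyadic := by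
    intro a b h1 h2
    rcases eq_or_eq_neg_of_abs_eq h1 with h3 | h3 <;> rw [h3]
    · exact h2
    · exact dyadic.neg_mem h2
  rcases hv with ⟨-, h1 | h1⟩ | ⟨n, -, -, h1 | h1⟩
  · rw [h1]; exact dyadic.zero_mem
  · exact habs h1 (by simpa using int_mem_dyadic 1)
  · exact habs h1 (half_pow_mem_dyadic _)
  · exact habs h1 (half_pow_mem_dyadic _)

/-! ### Continuity on the surface -/

/-- Vertical displacements are continuous on the surface, where the top of each box is glued to
its bottom. -/
theorem tendsto_advance_shift (α : ℝ) (e : Edge) (u : ℝ) :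
    Tendsto (fun δ => (e.shift δ).advance α u) (𝓝 0) (𝓝 (e.advance α u)) := by
  have hp := h_pos e.box
  set f := Int.fract u with hf
  have hf0 : 0 ≤ f := Int.fract_nonneg u
  have hf1 : f < 1 := Int.fract_lt_one u
  set g : ℝ → Surface := fun y => Quot.mk Glue ⟨((e.box : ℝ) + f,
    (projIcc (-h e.box) (h e.box) (by linarith) y : ℝ)), e.box, by simp [hf0],
    by simp [hf1.le], abs_le.2 (projIcc (-h e.box) (h e.box) (by linarith) y).2⟩ with hg
  have hgc : Continuous g := by
    refine continuous_quot_mk.comp (Continuous.subtype_mk ?_ _)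
    exact continuous_const.prodMk (continuous_subtype_val.comp continuous_projIcc)
  have hper : g (-h e.box) = g (-h e.box + 2 * h e.box) := by
    rw [show -h e.box + 2 * h e.box = h e.box by ring]
    symm
    apply Quot.sound
    left
    refine ⟨e.box, ?_, ?_, ?_, ?_, ?_⟩
    · simp [hf0]
    · simp [hf1.le]
    · rfl
    · simp
    · simp
  have : Fact (0 < 2 * h e.box) := ⟨two_h_pos _⟩
  have hlift := AddCircle.liftIco_continuous (p := 2 * h e.box) hper hgc.continuousOn
  have hwrap : ∀ y : ℝ, AddCircle.liftIco (2 * h e.box) (-h e.box) g (y : AddCircle (2 * h e.box))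
      = g (wrap e.box y) := by
    intro y
    obtain ⟨z, hz⟩ := exists_eq_wrap_add e.box y
    have h1 : (y : AddCircle (2 * h e.box)) = (wrap e.box y : ℝ) := by
      conv_lhs => rw [hz]
      rw [← zsmul_eq_mul, AddCircle.coe_add, AddCircle.coe_zsmul, AddCircle.coe_period, smul_zero,
        add_zero]
    rw [h1, AddCircle.liftIco_coe_apply]
    have := wrap_mem e.box y
    rwa [show -h e.box + 2 * h e.box = h e.box by ring]
  have hcont : Continuous fun y : ℝ => g (wrap e.box y) := by
    simp_rw [← hwrap]
    exact hlift.comp (AddCircle.continuous_mk' _)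
  have hsurf : ∀ δ, ((e.shift δ).advance α u).toSurface = g (wrap e.box (e.y + δ + α * f)) := by
    intro δ
    have h1 := wrap_mem e.box (e.y + δ + α * f)
    have h2 : ((e.shift δ).advance α u).y = wrap e.box (e.y + δ + α * f) := by
      simp [Edge.advance, wrap_wrap_add, hf]
    simp only [Phase.toSurface, hg]
    congr 1
    ext
    · rfl
    · change ((e.shift δ).advance α u).y = _
      rw [h2, projIcc_of_mem _ ⟨h1.1, h1.2.le⟩]
  rw [nhds_induced, tendsto_comap_iff]
  have h0 : (e.advance α u).toSurface = g (wrap e.box (e.y + 0 + α * f)) := by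
    rw [← hsurf, Edge.shift_zero]
  rw [h0]
  have : (Phase.toSurface ∘ fun δ => (e.shift δ).advance α u) =
      fun δ => g (wrap e.box (e.y + δ + α * f)) := funext hsurf
  rw [this]
  exact (hcont.comp (by fun_prop : Continuous fun δ : ℝ => e.y + δ + α * f)).tendsto 0

/-- Left edge points close to `e` follow the trajectory of `e` for the horizontal distance `v`. -/
theorem tendsto_travel_shift {α v : ℝ} {e : Edge}
    (hc : ∃ ε > 0, ∀ δ, |δ| < ε → (step α ^ ⌊v⌋) (e.shift δ) = ((step α ^ ⌊v⌋) e).shift δ) :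
    Tendsto (fun δ => (e.shift δ).travel α v) (𝓝 0) (𝓝 (e.travel α v)) := by
  obtain ⟨ε, hε, hc⟩ := hc
  refine (tendsto_advance_shift α ((step α ^ ⌊v⌋) e) v).congr' ?_
  filter_upwards [Metric.ball_mem_nhds (0 : ℝ) hε] with δ hδ
  rw [Metric.mem_ball, dist_zero_right, Real.norm_eq_abs] at hδ
  rw [Edge.travel, hc δ hδ]

theorem travel_mem_omegaLimit_atTop {α v : ℝ} {e : Edge} {z : Phase}
    (hc : ∃ ε > 0, ∀ δ, |δ| < ε → (step α ^ ⌊v⌋) (e.shift δ) = ((step α ^ ⌊v⌋) e).shift δ)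
    (hz : ∀ ε > 0, ∀ i₀ : ℤ, ∃ i ≥ i₀, ∃ δ, |δ| < ε ∧ (step α ^ i) (z.base α) = e.shift δ) :
    e.travel α v ∈ omegaLimit atTop (flow α) {z} := by
  rw [mem_omegaLimit_iff_frequently]
  intro W hW
  obtain ⟨ε, hε, hball⟩ := Metric.mem_nhds_iff.1 (tendsto_travel_shift hc hW)
  rw [frequently_atTop]
  intro T
  obtain ⟨i, hi, δ, hδ, hi'⟩ := hz ε hε ⌈T * speed α + Int.fract z.x - v⌉
  refine ⟨(v + i - Int.fract z.x) / speed α, ?_, z, mem_singleton z, ?_⟩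
  · rw [le_div_iff₀ (speed_pos α)]
    have := Int.ceil_le.1 hi
    linarith
  · rw [mem_preimage, flow_div_speed, ← travel_zpow, hi']
    exact hball (by simpa using hδ)

theorem travel_mem_omegaLimit_atBot {α v : ℝ} {e : Edge} {z : Phase}
    (hc : ∃ ε > 0, ∀ δ, |δ| < ε → (step α ^ ⌊v⌋) (e.shift δ) = ((step α ^ ⌊v⌋) e).shift δ)
    (hz : ∀ ε > 0, ∀ i₀ : ℤ, ∃ i ≤ i₀, ∃ δ, |δ| < ε ∧ (step α ^ i) (z.base α) = e.shift δ) :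
    e.travel α v ∈ omegaLimit atBot (flow α) {z} := by
  rw [mem_omegaLimit_iff_frequently]
  intro W hW
  obtain ⟨ε, hε, hball⟩ := Metric.mem_nhds_iff.1 (tendsto_travel_shift hc hW)
  rw [frequently_atBot]
  intro T
  obtain ⟨i, hi, δ, hδ, hi'⟩ := hz ε hε ⌊T * speed α + Int.fract z.x - v⌋
  refine ⟨(v + i - Int.fract z.x) / speed α, ?_, z, mem_singleton z, ?_⟩
  · rw [div_le_iff₀ (speed_pos α)]
    have := Int.le_floor.1 hi
    linarith
  · rw [mem_preimage, flow_div_speed, ← travel_zpow, hi']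
    exact hball (by simpa using hδ)

theorem omegaLimit_subset_closure_orbit {α : ℝ} {z : Phase} {F : Filter ℝ} :
    omegaLimit F (flow α) {z} ⊆ closure (orbit α z) := by
  refine (iInter₂_subset univ univ_mem).trans (closure_mono ?_)
  rintro _ ⟨t, -, w, hw, rfl⟩
  rw [mem_singleton_iff.1 hw]
  exact ⟨t, rfl⟩

/-! ### Limit sets -/

/-- A slope with an escape point whose trajectory meets no vertex before its last crossing of
`L`. -/
structure IsTypical (α y : ℝ) : Prop where
  irrational : Irrational α
  escape : IsEscapePoint α y
  not_isVertex : ∀ i : ℤ, i ≤ 0 → ¬ ((step α ^ i) (edgeL y)).IsVertex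

namespace IsTypical

variable {α y : ℝ}

/-- Points close to the escape point follow its trajectory for any finite time, in the past as well
as in the future. -/
theorem exists_step_zpow_shift (H : IsTypical α y) (k : ℤ) : ∃ ε > 0, ∀ δ, |δ| < ε →
    (step α ^ k) ((edgeL y).shift δ) = ((step α ^ k) (edgeL y)).shift δ := by
  rcases le_or_gt 0 k with hk | hk
  · obtain ⟨n, rfl⟩ := Int.eq_ofNat_of_zero_le hk
    obtain ⟨ε, hε, h1⟩ := exists_step_pow_shift α (edgeL y) n
      fun i hi _ => H.escape.not_isSingular hi
    exact ⟨ε, hε, fun δ hδ => by simpa only [step_zpow_natCast] using h1 δ hδ n le_rfl⟩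
  · obtain ⟨n, hn⟩ := Int.eq_ofNat_of_zero_le (by omega : 0 ≤ -k)
    set v := (step α ^ k) (edgeL y) with hv
    have hvi : ∀ i : ℕ, (step α ^ i) v = (step α ^ (i + k)) (edgeL y) := fun i => by
      rw [hv, ← step_zpow_natCast, ← step_zpow_add]
    obtain ⟨ε, hε, h1⟩ := exists_step_pow_shift α v n fun i hi hi' hsing => by
      rw [hvi] at hsing
      exact H.not_isVertex _ (by omega) hsing.isVertex
    refine ⟨ε, hε, fun δ hδ => ?_⟩
    have h2 := h1 δ hδ n le_rfl
    rw [hvi, show (n : ℤ) + k = 0 by omega, zpow_zero, Equiv.Perm.one_apply] at h2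
    rw [← h2, ← step_zpow_natCast, ← step_zpow_add, show k + (n : ℤ) = 0 by omega, zpow_zero,
      Equiv.Perm.one_apply]

theorem exists_step_pow_shift_neg (H : IsTypical α y) (n : ℕ) : ∃ ε > 0, ∀ δ, |δ| < ε →
    (step α ^ n) ((edgeL (-y)).shift δ) = ((step α ^ n) (edgeL (-y))).shift δ := by
  obtain ⟨ε, hε, h1⟩ := exists_step_pow_shift α (edgeL (-y)) n fun i _ _ hsing => by
    have h2 := hsing.isVertex
    rw [step_pow_edgeL_neg H.not_isVertex, isVertex_rotate] at h2
    exact H.not_isVertex _ (by omega) h2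
  exact ⟨ε, hε, fun δ hδ => h1 δ hδ n le_rfl⟩

theorem isEscapeOrbit_iff (H : IsTypical α y) (O : Set Phase) :
    IsEscapeOrbit α O ↔ O = range ((edgeL y).travel α) := by
  have key : ∀ z, Escapes α z ↔ orbit α z = range ((edgeL y).travel α) := fun z => by
    rw [escapes_iff, H.escape.eventually_box_iff, orbit_eq_range, range_travel_eq_iff]
  constructor
  · rintro ⟨z, hz, rfl⟩
    exact (key z).1 hz
  · rintro rfl
    have h1 := orbit_travel α (edgeL y) 0
    exact ⟨_, (key _).2 h1, h1.symm⟩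

theorem isPastEscapeOrbit_iff (H : IsTypical α y) (O : Set Phase) :
    IsPastEscapeOrbit α O ↔ O = range ((edgeL (-y)).travel α) := by
  have key : ∀ z, EscapesInPast α z ↔ orbit α z = range ((edgeL (-y)).travel α) := fun z => by
    rw [escapesInPast_iff, H.escape.eventually_box_iff_neg, orbit_eq_range, range_travel_eq_iff]
  constructor
  · rintro ⟨z, hz, rfl⟩
    exact (key z).1 hz
  · rintro rfl
    have h1 := orbit_travel α (edgeL (-y)) 0
    exact ⟨_, (key _).2 h1, h1.symm⟩

theorem range_travel_ne (H : IsTypical α y) :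
    range ((edgeL (-y)).travel α) ≠ range ((edgeL y).travel α) := by
  rw [Ne, range_travel_eq_iff, not_exists]
  exact H.escape.zpow_edgeL_neg_ne H.not_isVertex

theorem subset_omegaLimit_atTop (H : IsTypical α y) {z : Phase}
    (hz : orbit α z ≠ range ((edgeL y).travel α)) :
    range ((edgeL y).travel α) ⊆ omegaLimit atTop (flow α) {z} := by
  rintro _ ⟨v, rfl⟩
  rw [orbit_eq_range, Ne, range_travel_eq_iff, not_exists] at hz
  refine travel_mem_omegaLimit_atTop (H.exists_step_zpow_shift _) fun ε hε i₀ => ?_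
  obtain ⟨n, hn⟩ := H.escape.shrink ε hε
  obtain ⟨i, hi, x, hx, hxe⟩ := H.escape.exists_ge_edgeL H.irrational hz n i₀
  obtain ⟨k, hk⟩ := hn x hx
  refine ⟨i, hi, _, hk, ?_⟩
  rw [hxe, edgeL_shift, ← edgeL_add_two_mul x (-k)]
  congr 1; push_cast; ring

/-- Backward orbits accumulate on the orbit that escapes in the past, and this orbit accumulates
on the escape orbit. -/
theorem subset_omegaLimit_atBot (H : IsTypical α y) {z : Phase}
    (hz : orbit α z ≠ range ((edgeL (-y)).travel α)) :
    range ((edgeL y).travel α) ⊆ omegaLimit atBot (flow α) {z} := by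
  have hfwd : ∀ v ≥ 0, (edgeL (-y)).travel α v ∈ omegaLimit atBot (flow α) {z} := by
    intro v hv
    rw [orbit_eq_range, Ne, range_travel_eq_iff, not_exists] at hz
    refine travel_mem_omegaLimit_atBot ?_ fun ε hε i₀ => ?_
    · obtain ⟨n, hn⟩ := Int.eq_ofNat_of_zero_le (Int.floor_nonneg.2 hv)
      rw [hn]
      simpa only [Int.ofNat_eq_natCast, step_zpow_natCast] using H.exists_step_pow_shift_neg n
    · obtain ⟨n, hn⟩ := H.escape.neg.shrink ε hε
      obtain ⟨i, hi, x, hx, hxe⟩ := H.escape.exists_le_edgeL H.irrational hz n i₀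
      obtain ⟨k, hk⟩ := hn x hx
      refine ⟨i, hi, _, hk, ?_⟩
      rw [hxe, edgeL_shift, ← edgeL_add_two_mul x (-k)]
      congr 1; push_cast; ring
  refine (H.subset_omegaLimit_atTop (z := (edgeL (-y)).travel α 0) ?_).trans ?_
  · rw [orbit_travel]
    exact H.range_travel_ne
  · refine (iInter₂_subset (Ici 0) (Ici_mem_atTop 0)).trans ?_
    refine closure_minimal ?_ (isClosed_omegaLimit _ _ _)
    rintro _ ⟨t, ht, w, hw, rfl⟩
    rw [mem_singleton_iff.1 hw]
    rw [flow_travel, zero_add]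
    exact hfwd _ (mul_nonneg ht (speed_pos α).le)

end IsTypical

/-! ### Typical directions -/

theorem exists_add_two_mul_mem (x : ℝ) : ∃ k : ℤ, x + 2 * k ∈ Ico (-1 : ℝ) 1 := by
  obtain ⟨z, hz⟩ := exists_eq_wrap_add 0 x
  have h1 := wrap_mem 0 x
  rw [h_zero] at hz h1
  refine ⟨-z, ?_⟩
  convert h1 using 1
  push_cast; linarith

theorem E_nonempty (α : ℝ) (n : ℕ) : (E α n).Nonempty := by
  obtain ⟨l, hl⟩ := exists_add_mem_reach α n 0
  obtain ⟨k, hk⟩ := exists_add_two_mul_mem (0 + l * (2 * (2 : ℝ)⁻¹ ^ n))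
  exact ⟨_, mem_E_iff.2 ⟨hk, add_two_mul_int_mem_reach hl k⟩⟩

theorem exists_isSingleInterval {α : ℝ} {n : ℕ} (hn : 1 ≤ n) (h1 : numIntervals (E α n) = 1) :
    ∃ a, IsSingleInterval α n a := by
  have hne : {N : ℕ | ∃ a b : Fin N → ℝ, E α n = ⋃ i, arc (a i) (b i)}.Nonempty := by
    by_contra h2
    rw [numIntervals, not_nonempty_iff_eq_empty.1 h2, Nat.sInf_empty] at h1
    omega
  have h2 := Nat.sInf_mem hne
  change numIntervals (E α n) ∈ _ at h2
  rw [h1] at h2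
  obtain ⟨a, b, hab⟩ := h2
  have hU : ⋃ i, arc (a i) (b i) = arc (a 0) (b 0) := Set.ext fun x => by simp
  rw [hU] at hab
  refine ⟨a 0, isSingleInterval_of_eq (b := b 0) hn fun x => ?_⟩
  obtain ⟨k, hk⟩ := exists_add_two_mul_mem x
  have h3 : x ∈ reach α n ↔ x + 2 * k ∈ reach α n := by
    refine ⟨fun hx => add_two_mul_int_mem_reach hx k, fun hx => ?_⟩
    have := add_two_mul_int_mem_reach hx (-k)
    push_cast at this
    rwa [mul_neg, add_neg_cancel_right] at this
  have h4 : x + 2 * k ∈ E α n ↔ x + 2 * k ∈ reach α n := by simp only [mem_E_iff, hk, true_and]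
  rw [h3, ← h4, hab]
  constructor
  · rintro ⟨-, m, hm⟩
    refine ⟨k + m, ?_⟩
    convert hm using 1
    push_cast; ring
  · rintro ⟨m, hm⟩
    refine ⟨hk, m - k, ?_⟩
    convert hm using 1
    push_cast; ring

theorem IsSingleInterval.numIntervals_eq {α a : ℝ} {n : ℕ} (H : IsSingleInterval α n a) :
    numIntervals (E α n) = 1 := by
  have h1 : 1 ∈ {N : ℕ | ∃ a b : Fin N → ℝ, E α n = ⋃ i, arc (a i) (b i)} := by
    refine ⟨fun _ => a, fun _ => a + 2 * (2 : ℝ)⁻¹ ^ n, ?_⟩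
    ext x
    rw [mem_E_iff, H x]
    simp [arc]
  have h2 := Nat.sInf_le h1
  have h3 := Nat.sInf_mem ⟨1, h1⟩
  change numIntervals (E α n) ≤ 1 at h2
  change numIntervals (E α n) ∈ _ at h3
  rcases Nat.eq_zero_or_pos (numIntervals (E α n)) with h4 | h4
  · rw [h4] at h3
    obtain ⟨a, b, hab⟩ := h3
    have := E_nonempty α n
    rw [hab, iUnion_of_empty] at this
    exact absurd this not_nonempty_empty
  · omega

theorem exists_isTypical {α : ℝ} (hα : α ∈ typicalDirections) : ∃ y, IsTypical α y := by
  obtain ⟨-, hirr, hfr, hv⟩ := hα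
  obtain ⟨y, hy⟩ := exists_isEscapePoint hirr ((hfr.and_eventually (eventually_ge_atTop 1)).mono
    fun n hn => exists_isSingleInterval hn.2 hn.1)
  obtain ⟨k, hk⟩ := exists_add_two_mul_mem y
  refine ⟨y, hirr, hy, fun i hi hvi => ?_⟩
  refine hv _ hk (fun n => mem_E_iff.2 ⟨hk, add_two_mul_int_mem_reach (hy.mem_reach n) k⟩)
    (i / speed α) (div_nonpos_of_nonpos_of_nonneg (by exact_mod_cast hi) (speed_pos α).le) ?_
  rw [flow_onL, edgeL_add_two_mul]
  exact isVertex_travel_intCast hvi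

/-! ### Runs of zeros in binary expansions -/

/-- The length of the block of binary digits that follows `q` digits, slightly larger than
`log₂ q`. -/
def blockLength (q : ℕ) : ℕ := Nat.clog 2 (8 * q)

theorem le_two_pow_blockLength (q : ℕ) : (8 * q : ℝ) ≤ 2 ^ blockLength q := by
  exact_mod_cast Nat.le_pow_clog one_lt_two (8 * q)

theorem two_pow_blockLength_lt {q : ℕ} (hq : 1 ≤ q) : (2 : ℝ) ^ blockLength q < 16 * q := by
  have h1 := Nat.pow_pred_clog_lt_self one_lt_two (show 1 < 8 * q by omega)
  have h2 : 0 < Nat.clog 2 (8 * q) := Nat.clog_pos one_lt_two (by omega)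
  have h3 : 2 ^ blockLength q = 2 * 2 ^ (Nat.clog 2 (8 * q)).pred := by
    rw [← pow_succ', Nat.pred_eq_sub_one, Nat.sub_add_cancel h2, blockLength]
  have h4 : 2 ^ blockLength q < 16 * q := by omega
  exact_mod_cast h4

/-- The numbers whose binary expansion has no zero block among the first `M` of the consecutive
blocks of lengths `blockLength q`, `blockLength (q + blockLength q)`, … -/
def noZeroBlock : ℕ → ℕ → Set ℝ
  | 0, _ => univ
  | M + 1, q => {x | ((2 : ℝ) ^ blockLength q)⁻¹ ≤ Int.fract x ∧
      2 ^ blockLength q * x ∈ noZeroBlock M (q + blockLength q)}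

theorem add_int_mem_noZeroBlock {M q : ℕ} {x : ℝ} (k : ℤ) (hx : x ∈ noZeroBlock M q) :
    x + k ∈ noZeroBlock M q := by
  induction M generalizing q x k with
  | zero => trivial
  | succ M ih =>
    refine ⟨by rw [Int.fract_add_intCast]; exact hx.1, ?_⟩
    have := ih (2 ^ blockLength q * k) hx.2
    convert this using 1
    push_cast; ring

theorem volume_inter_Ico_add {B : Set ℝ} (hB : ∀ x ∈ B, ∀ k : ℤ, x + k ∈ B) (k : ℤ) :
    volume (B ∩ Ico (k : ℝ) (k + 1)) = volume (B ∩ Ico 0 1) := by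
  rw [← measure_preimage_add_right volume (k : ℝ)]
  congr 1
  ext x
  constructor
  · rintro ⟨h1, h2, h3⟩
    have := hB _ h1 (-k)
    push_cast at this
    rw [add_neg_cancel_right] at this
    exact ⟨this, by linarith, by linarith⟩
  · rintro ⟨h1, h2, h3⟩
    exact ⟨hB _ h1 k, by linarith, by linarith⟩

theorem volume_inter_Ico_one_le {B : Set ℝ} (hB : ∀ x ∈ B, ∀ k : ℤ, x + k ∈ B) (n : ℕ) :
    volume (B ∩ Ico 1 (1 + n : ℝ)) ≤ n * volume (B ∩ Ico 0 1) := by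
  induction n with
  | zero => simp
  | succ n ih =>
    have h1 : B ∩ Ico 1 (1 + (n + 1 : ℕ) : ℝ) ⊆
        (B ∩ Ico 1 (1 + n : ℝ)) ∪ (B ∩ Ico ((1 + n : ℤ) : ℝ) ((1 + n : ℤ) + 1)) := by
      rintro x ⟨h2, h3, h4⟩
      push_cast at h4 ⊢
      rcases lt_or_ge x (1 + n) with h5 | h5
      · exact Or.inl ⟨h2, h3, h5⟩
      · exact Or.inr ⟨h2, h5, by linarith⟩
    calc _ ≤ _ := measure_mono h1
      _ ≤ _ := measure_union_le _ _
      _ ≤ n * volume (B ∩ Ico 0 1) + volume (B ∩ Ico 0 1) :=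
        add_le_add ih (volume_inter_Ico_add hB _).le
      _ = _ := by push_cast; rw [add_mul, one_mul]

theorem volume_noZeroBlock_succ_le (M q : ℕ) :
    volume (noZeroBlock (M + 1) q ∩ Ico 0 1) ≤
      ENNReal.ofReal (1 - ((2 : ℝ) ^ blockLength q)⁻¹) *
        volume (noZeroBlock M (q + blockLength q) ∩ Ico 0 1) := by
  set l := blockLength q with hl
  have hp : (0 : ℝ) < 2 ^ l := by positivity
  have h1 : noZeroBlock (M + 1) q ∩ Ico 0 1 ⊆
      (fun x : ℝ => 2 ^ l * x) ⁻¹' (noZeroBlock M (q + l) ∩ Ico 1 (1 + (2 ^ l - 1 : ℕ) : ℝ)) := by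
    rintro x ⟨⟨h2, h3⟩, h4⟩
    rw [Int.fract_eq_self.2 h4, inv_le_iff_one_le_mul₀' hp] at h2
    refine ⟨h3, h2, ?_⟩
    rw [Nat.cast_sub Nat.one_le_two_pow]
    push_cast
    nlinarith [h4.2]
  refine (measure_mono h1).trans ?_
  rw [Real.volume_preimage_mul_left hp.ne', abs_of_pos (inv_pos.2 hp)]
  refine (mul_le_mul_right (volume_inter_Ico_one_le
    (fun x hx k => add_int_mem_noZeroBlock k hx) _) _).trans ?_
  rw [← mul_assoc]
  refine mul_le_mul_left (le_of_eq ?_) _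
  rw [← ENNReal.ofReal_natCast, ← ENNReal.ofReal_mul (by positivity),
    Nat.cast_sub Nat.one_le_two_pow]
  congr 1
  push_cast
  rw [mul_sub, inv_mul_cancel₀ hp.ne', mul_one]

/-- The loss of measure at one block dominates an increment of `log log`: the former is at least
`1 / (16 * q)`, and the latter at most `4 / q`, as the block has length at most `4 * log q`. -/
theorem one_sub_le_exp {q : ℕ} (hq : 16 ≤ q) :
    1 - ((2 : ℝ) ^ blockLength q)⁻¹ ≤
      Real.exp (-(Real.log (Real.log (q + blockLength q : ℕ)) - Real.log (Real.log q)) / 64) := by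
  have hq' : (16 : ℝ) ≤ q := by exact_mod_cast hq
  have hq0 : (0 : ℝ) < q := by linarith
  set l := blockLength q with hl
  have h1 : (2 : ℝ) ^ l < 16 * q := two_pow_blockLength_lt (by omega)
  have hlog2 : (1 / 2 : ℝ) ≤ Real.log 2 := by linarith [Real.log_two_gt_d9]
  have hlogq : 0 < Real.log q := Real.log_pos (by linarith)
  have hl4 : (l : ℝ) ≤ 4 * Real.log q := by
    have h2 := Real.log_le_log (by positivity) h1.le
    rw [Real.log_pow, Real.log_mul (by norm_num) hq0.ne'] at h2
    have h3 : Real.log 16 ≤ Real.log q := Real.log_le_log (by norm_num) hq'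
    have h4 : (l : ℝ) * (1 / 2) ≤ l * Real.log 2 :=
      mul_le_mul_of_nonneg_left hlog2 (Nat.cast_nonneg l)
    linarith
  have h5 : Real.log (q + l : ℕ) ≤ Real.log q + l / q := by
    have h6 : ((q + l : ℕ) : ℝ) = q * (1 + l / q) := by
      push_cast; field_simp
    rw [h6, Real.log_mul hq0.ne' (by positivity)]
    have := Real.log_le_sub_one_of_pos (show (0 : ℝ) < 1 + l / q by positivity)
    linarith
  have h7 : Real.log (Real.log (q + l : ℕ)) ≤ Real.log (Real.log q) + 4 / q := by
    have h8 : Real.log q + l / q ≤ Real.log q * (1 + 4 / q) := by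
      have : (l : ℝ) / q ≤ 4 * Real.log q / q := by gcongr
      calc _ ≤ Real.log q + 4 * Real.log q / q := by linarith
        _ = _ := by ring
    have hl0 : (0 : ℝ) ≤ l := Nat.cast_nonneg l
    have h9 : 0 < Real.log (q + l : ℕ) := Real.log_pos (by push_cast; linarith)
    have h10 := Real.log_le_log h9 (h5.trans h8)
    rw [Real.log_mul hlogq.ne' (by positivity)] at h10
    have := Real.log_le_sub_one_of_pos (show (0 : ℝ) < 1 + 4 / q by positivity)
    linarith
  have h11 : 1 / (16 * q : ℝ) ≤ ((2 : ℝ) ^ l)⁻¹ := by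
    rw [one_div]; exact inv_anti₀ (by positivity) h1.le
  have h12 := Real.one_sub_le_exp_neg (((2 : ℝ) ^ l)⁻¹)
  refine h12.trans (Real.exp_le_exp.2 ?_)
  have h13 : 4 / (q : ℝ) / 64 = 1 / (16 * q) := by field_simp; norm_num
  linarith

theorem volume_noZeroBlock_le (M : ℕ) {q : ℕ} (hq : 16 ≤ q) :
    volume (noZeroBlock M q ∩ Ico 0 1) ≤ ENNReal.ofReal (Real.exp
      (-(Real.log (Real.log ((fun q => q + blockLength q)^[M] q : ℕ)) - Real.log (Real.log q)) /
        64)) := by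
  induction M generalizing q with
  | zero => simp [noZeroBlock]
  | succ M ih =>
    refine (volume_noZeroBlock_succ_le M q).trans ?_
    refine (mul_le_mul' (ENNReal.ofReal_le_ofReal (one_sub_le_exp hq))
      (ih (q := q + blockLength q) (by omega))).trans (le_of_eq ?_)
    rw [← ENNReal.ofReal_mul (Real.exp_pos _).le, ← Real.exp_add, Function.iterate_succ_apply]
    congr 2
    ring

theorem le_iterate_add_blockLength (M : ℕ) {q : ℕ} (hq : 16 ≤ q) :
    q + M ≤ (fun q => q + blockLength q)^[M] q := by
  induction M with
  | zero => simp
  | succ M ih =>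
    rw [Function.iterate_succ_apply']
    have h1 : 0 < blockLength ((fun q => q + blockLength q)^[M] q) :=
      Nat.clog_pos one_lt_two (by omega)
    omega

theorem volume_iInter_noZeroBlock {q : ℕ} (hq : 16 ≤ q) :
    volume (⋂ M, noZeroBlock M q) = 0 := by
  set Z := ⋂ M, noZeroBlock M q with hZ
  have hper : ∀ x ∈ Z, ∀ k : ℤ, x + k ∈ Z := fun x hx k =>
    mem_iInter.2 fun M => add_int_mem_noZeroBlock k (mem_iInter.1 hx M)
  have h0 : volume (Z ∩ Ico 0 1) = 0 := by
    have hlim : Tendsto (fun M : ℕ => ENNReal.ofReal (Real.exp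
        (-(Real.log (Real.log ((fun q => q + blockLength q)^[M] q : ℕ)) - Real.log (Real.log q)) /
          64))) atTop (𝓝 0) := by
      rw [← ENNReal.ofReal_zero]
      refine ENNReal.tendsto_ofReal (Real.tendsto_exp_atBot.comp ?_)
      have h1 : Tendsto (fun M : ℕ => (((fun q => q + blockLength q)^[M] q : ℕ) : ℝ)) atTop
          atTop := by
        refine tendsto_natCast_atTop_atTop.comp (tendsto_atTop_mono (fun M => ?_) tendsto_id)
        have := le_iterate_add_blockLength M hq
        simp only [id]
        omega
      have h2 := Real.tendsto_log_atTop.comp (Real.tendsto_log_atTop.comp h1)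
      have h3 := tendsto_atTop_add_const_right _ (-Real.log (Real.log q)) h2
      have h4 := tendsto_neg_atTop_atBot.comp h3
      have h5 := h4.atBot_div_const (show (0 : ℝ) < 64 by norm_num)
      exact h5
    refine le_antisymm (ge_of_tendsto' hlim fun M => ?_) (zero_le)
    exact (measure_mono (inter_subset_inter_left _ (iInter_subset _ M))).trans
      (volume_noZeroBlock_le M hq)
  have hU : Z ⊆ ⋃ k : ℤ, Z ∩ Ico (k : ℝ) (k + 1) := fun x hx =>
    mem_iUnion.2 ⟨⌊x⌋, hx, Int.floor_le x, Int.lt_floor_add_one x⟩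
  refine measure_mono_null hU (measure_iUnion_null fun k => ?_)
  rw [volume_inter_Ico_add hper, h0]

theorem mem_noZeroBlock_of_forall {x : ℝ} {N : ℕ}
    (hx : ∀ n ≥ N, 1 ≤ 8 * (n + 1 : ℝ) * Int.fract (2 ^ n * x)) (M : ℕ) {p q : ℕ} (hp : N ≤ p)
    (hq : p + 1 ≤ q) : 2 ^ p * x ∈ noZeroBlock M q := by
  induction M generalizing p q with
  | zero => trivial
  | succ M ih =>
    refine ⟨?_, ?_⟩
    · have h1 := hx p hp
      have h2 : ((p : ℝ) + 1) ≤ q := by exact_mod_cast hq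
      have h3 := le_two_pow_blockLength q
      have h4 := Int.fract_nonneg (2 ^ p * x)
      rw [inv_le_iff_one_le_mul₀' (by positivity)]
      nlinarith
    · rw [← mul_assoc, ← pow_add, add_comm (blockLength q)]
      exact ih (by omega) (by omega)

/-- Almost every number has, infinitely often, a run of zeros starting at the binary digit number
`n` and of length at least `log₂ n` up to a constant. -/
theorem ae_frequently_fract_lt :
    ∀ᵐ x : ℝ, ∃ᶠ n : ℕ in atTop, 8 * (n + 1 : ℝ) * Int.fract (2 ^ n * x) < 1 := by
  rw [ae_iff]
  have hsub : {x : ℝ | ¬ ∃ᶠ n : ℕ in atTop, 8 * (n + 1 : ℝ) * Int.fract (2 ^ n * x) < 1} ⊆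
      ⋃ N : ℕ, (fun x : ℝ => 2 ^ N * x) ⁻¹' ⋂ M, noZeroBlock M (N + 16) := by
    intro x hx
    rw [mem_ofPred_eq, not_frequently] at hx
    obtain ⟨N, hN⟩ := eventually_atTop.1 hx
    exact mem_iUnion.2 ⟨N, mem_iInter.2 fun M =>
      mem_noZeroBlock_of_forall (fun n hn => not_lt.1 (hN n hn)) M le_rfl (by omega)⟩
  refine measure_mono_null hsub (measure_iUnion_null fun N => ?_)
  rw [Real.volume_preimage_mul_left (by positivity), volume_iInter_noZeroBlock (by omega),
    mul_zero]

/-! ### Almost every direction is typical -/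

/-- The sequence `2 ^ t * (m + t) * β` grows at each step by a factor at most `3`, so it cannot
jump over the interval `[1/4, 3/4)`. -/
theorem exists_mem_Ico_quarter {β : ℝ} (hβ : 0 < β) {m : ℕ} (hm : 2 ≤ m) (h0 : m * β < 1 / 4)
    {T : ℕ} (hT : 1 / 4 ≤ 2 ^ T * (m + T) * β) :
    ∃ t ≤ T, 2 ^ t * (m + t) * β ∈ Ico (1 / 4 : ℝ) (3 / 4) := by
  classical
  have hex : ∃ t : ℕ, 1 / 4 ≤ 2 ^ t * (m + t) * β := ⟨T, hT⟩
  refine ⟨Nat.find hex, Nat.find_min' hex hT, Nat.find_spec hex, ?_⟩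
  have hne : Nat.find hex ≠ 0 := by
    intro h1
    have h2 := Nat.find_spec hex
    rw [h1] at h2
    simp only [pow_zero, one_mul, Nat.cast_zero, add_zero] at h2
    linarith
  obtain ⟨s, hs⟩ := Nat.exists_eq_succ_of_ne_zero hne
  have h1 := Nat.find_min hex (m := s) (by omega)
  rw [hs]
  push_cast
  rw [pow_succ]
  have hm' : (2 : ℝ) ≤ m := by exact_mod_cast hm
  have h2 : (2 : ℝ) ^ s * β * (2 * (m + (s + 1))) ≤ 2 ^ s * β * (3 * (m + s)) := by
    have : (0 : ℝ) ≤ s := Nat.cast_nonneg s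
    exact mul_le_mul_of_nonneg_left (by linarith) (by positivity)
  have h3 : (2 : ℝ) ^ s * (m + s) * β < 1 / 4 := not_le.1 h1
  linarith

/-- The condition of passing the aperture number `n + 2`, with heights in units of its period. -/
theorem passesAperture_iff {n : ℕ} {u : ℝ} :
    PassesAperture (n + 2) u ↔ ∃ k : ℤ, 2 ^ n * u + k ∈ Ico (-1 / 4 : ℝ) (1 / 4) := by
  have h1 : (2 : ℝ)⁻¹ ^ (n + 2) = (2 ^ n)⁻¹ / 4 := by rw [pow_add, inv_pow]; norm_num; ring
  have hp : (0 : ℝ) < 2 ^ n := by positivity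
  refine exists_congr fun k => ?_
  have h2 : u + k * (4 * (2 : ℝ)⁻¹ ^ (n + 2)) = (2 ^ n * u + k) * (2 ^ n)⁻¹ := by
    rw [h1]; field_simp
  rw [h2, h1, mem_Ico, mem_Ico, ← div_eq_mul_inv, le_div_iff₀ hp, div_lt_iff₀ hp]
  have h3 : -((2 ^ n : ℝ)⁻¹ / 4) * 2 ^ n = -1 / 4 := by field_simp
  have h4 : ((2 ^ n : ℝ)⁻¹ / 4) * 2 ^ n = 1 / 4 := by field_simp
  rw [h3, h4]

/-- If the trajectories slightly below a given one pass an aperture, then it meets the aperture or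
its upper end. -/
theorem exists_mem_Ioc_of_eventually {j : ℕ} {u : ℝ}
    (hu : ∀ᶠ δ in 𝓝[>] (0 : ℝ), PassesAperture j (u - δ)) :
    ∃ k : ℤ, u + k * (4 * (2 : ℝ)⁻¹ ^ j) ∈ Ioc (-(2 : ℝ)⁻¹ ^ j) ((2 : ℝ)⁻¹ ^ j) := by
  have hr := half_pow_pos j
  obtain ⟨δ, ⟨k, hk⟩, hδ0, hδ1⟩ := (hu.and (Ioo_mem_nhdsGT hr)).exists
  rcases le_or_gt (u + k * (4 * (2 : ℝ)⁻¹ ^ j)) ((2 : ℝ)⁻¹ ^ j) with h1 | h1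
  · exact ⟨k, by linarith [hk.1], h1⟩
  · exfalso
    obtain ⟨δ', ⟨k', hk'⟩, hδ0', hδ1'⟩ := (hu.and (Ioo_mem_nhdsGT
      (lt_min hr (sub_pos.2 h1)))).exists
    rw [lt_min_iff] at hδ1'
    have h2 : ((k' - k : ℤ) : ℝ) * (4 * (2 : ℝ)⁻¹ ^ j) < 0 * (4 * (2 : ℝ)⁻¹ ^ j) := by
      push_cast; linarith [hk'.2]
    have h3 : (-1) * (4 * (2 : ℝ)⁻¹ ^ j) < ((k' - k : ℤ) : ℝ) * (4 * (2 : ℝ)⁻¹ ^ j) := by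
      push_cast; linarith [hk'.1, hk.2]
    have h4 := lt_of_mul_lt_mul_right h2 (by linarith)
    have h5 := lt_of_mul_lt_mul_right h3 (by linarith)
    have h6 : k' - k < 0 := by exact_mod_cast h4
    have h7 : -1 < k' - k := by exact_mod_cast h5
    omega

/-- If the trajectories slightly below a given one pass the aperture number `n + 2`, then it meets
this aperture or its upper end; heights are in units of the period. -/
theorem exists_mem_Ioc_quarter {n : ℕ} {u : ℝ}
    (hu : ∀ᶠ δ in 𝓝[>] (0 : ℝ), PassesAperture (n + 2) (u - δ)) :
    ∃ k : ℤ, 2 ^ n * u + k ∈ Ioc (-1 / 4 : ℝ) (1 / 4) := by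
  obtain ⟨k, hk1, hk2⟩ := exists_mem_Ioc_of_eventually hu
  have h1 : (2 : ℝ)⁻¹ ^ (n + 2) = (2 ^ n)⁻¹ / 4 := by rw [pow_add, inv_pow]; norm_num; ring
  have hp : (0 : ℝ) < 2 ^ n := by positivity
  have h2 : u + k * (4 * (2 : ℝ)⁻¹ ^ (n + 2)) = (2 ^ n * u + k) * (2 ^ n)⁻¹ := by
    rw [h1]; field_simp
  have h3 : -((2 ^ n : ℝ)⁻¹ / 4) * 2 ^ n = -1 / 4 := by field_simp
  have h4 : ((2 ^ n : ℝ)⁻¹ / 4) * 2 ^ n = 1 / 4 := by field_simp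
  rw [h2, h1, ← div_eq_mul_inv] at hk1 hk2
  rw [lt_div_iff₀ hp, h3] at hk1
  rw [div_le_iff₀ hp, h4] at hk2
  exact ⟨k, hk1, hk2⟩

/-- If the interval starting at a point of `reach α n` that meets the end of the aperture number
`n` is not contained in `reach α n`, then it is interrupted at a point `t` whose trajectory meets
the upper end of an earlier aperture, and the trajectories slightly below reach the aperture
number `n`. -/
theorem isSingleInterval_or_exists {α : ℝ} {n : ℕ} (hn : 1 ≤ n) :
    (∃ a, IsSingleInterval α n a) ∨ ∃ t : ℝ, ∃ j : ℕ, ∃ z : ℤ, 1 ≤ j ∧ j < n ∧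
      t + j * α = (2 : ℝ)⁻¹ ^ j + z * (4 * (2 : ℝ)⁻¹ ^ j) ∧
      ∀ i, 1 ≤ i → i ≤ n → ∀ᶠ δ in 𝓝[>] (0 : ℝ), PassesAperture i (t + i * α - δ) := by
  have hr := half_pow_pos n
  obtain ⟨l, hl⟩ := exists_add_mem_reach α n ((2 : ℝ)⁻¹ ^ n - n * α)
  set c := (2 : ℝ)⁻¹ ^ n - n * α + l * (2 * (2 : ℝ)⁻¹ ^ n) with hc
  by_cases hall : ∀ x ∈ Ico c (c + 2 * (2 : ℝ)⁻¹ ^ n), x ∈ reach α n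
  · refine Or.inl ⟨c, fun x => ⟨fun hx => ?_, ?_⟩⟩
    · have h2r : 0 < 2 * (2 : ℝ)⁻¹ ^ n := by linarith
      have h1 := toIcoMod_mem_Ico h2r c x
      have h2 : toIcoMod h2r c x = x + (-toIcoDiv h2r c x : ℤ) * (2 * (2 : ℝ)⁻¹ ^ n) := by
        rw [← self_sub_toIcoDiv_zsmul]; push_cast; rw [zsmul_eq_mul]; ring
      rw [h2] at h1
      obtain ⟨k, hk⟩ := exists_eq_two_mul_of_mem_reach hx (hall _ h1)
      exact ⟨k, by rwa [hk] at h1⟩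
    · rintro ⟨k, hk⟩
      have := add_two_mul_int_mem_reach (hall _ hk) (-k)
      push_cast at this
      rwa [mul_neg, add_neg_cancel_right] at this
  · right
    push Not at hall
    obtain ⟨x₀, hx₀, hx₀r⟩ := hall
    set S : Set ℝ := {x | c ≤ x ∧ x ∉ reach α n} with hS
    have hSne : S.Nonempty := ⟨x₀, hx₀.1, hx₀r⟩
    have hSbdd : BddBelow S := ⟨c, fun x hx => hx.1⟩
    set t := sInf S with ht
    have hct : c ≤ t := le_csInf hSne fun x hx => hx.1
    have hbelow : ∀ x, c ≤ x → x < t → x ∈ reach α n := fun x h1 h2 => by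
      by_contra h3
      exact absurd (csInf_le hSbdd ⟨h1, h3⟩) (not_le.2 h2)
    have htr : t ∉ reach α n := by
      intro h1
      obtain ⟨ε, hε, hε'⟩ := mem_nhdsGE_iff_exists_Ico_subset.1 (eventually_add_mem_reach h1)
      have hε : 0 < ε := hε
      obtain ⟨x, hxS, hx⟩ := exists_lt_of_csInf_lt hSne (show sInf S < t + ε by linarith)
      have h2 : t ≤ x := csInf_le hSbdd hxS
      refine hxS.2 ?_
      have := hε' (show x - t ∈ Ico 0 ε from ⟨by linarith, by linarith⟩)
      simpa using this
    have hct' : c < t := lt_of_le_of_ne hct fun h1 => htr (h1 ▸ hl)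
    have htc : t < c + 2 * (2 : ℝ)⁻¹ ^ n :=
      (csInf_le hSbdd ⟨hx₀.1, hx₀r⟩ : t ≤ x₀).trans_lt hx₀.2
    have hleft : ∀ i, 1 ≤ i → i ≤ n →
        ∀ᶠ δ in 𝓝[>] (0 : ℝ), PassesAperture i (t + i * α - δ) := by
      intro i h1 h2
      filter_upwards [Ioo_mem_nhdsGT (sub_pos.2 hct')] with δ hδ
      have := hbelow (t - δ) (by linarith [hδ.2]) (by linarith [hδ.1]) i h1 h2
      rwa [sub_add_eq_add_sub] at this
    have hex : ∃ j, 1 ≤ j ∧ j ≤ n ∧ ¬ PassesAperture j (t + j * α) := by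
      by_contra! h1
      exact htr h1
    obtain ⟨j, hj1, hjn, hj⟩ := hex
    obtain ⟨k, hk1, hk2⟩ := exists_mem_Ioc_of_eventually (hleft j hj1 hjn)
    have heq : t + j * α = (2 : ℝ)⁻¹ ^ j + (-k : ℤ) * (4 * (2 : ℝ)⁻¹ ^ j) := by
      rcases hk2.eq_or_lt with h1 | h1
      · push_cast; linarith
      · exact absurd ⟨k, hk1.le, h1⟩ hj
    refine ⟨t, j, -k, hj1, lt_of_le_of_ne hjn ?_, heq, hleft⟩
    rintro rfl
    -- The interval contains no other point whose trajectory meets the end of the last aperture.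
    have h1 : ((-(2 * k) - l : ℤ) : ℝ) * (2 * (2 : ℝ)⁻¹ ^ j) = t - c := by
      rw [hc]; push_cast at heq ⊢; linarith
    have h2 : 0 < ((-(2 * k) - l : ℤ) : ℝ) * (2 * (2 : ℝ)⁻¹ ^ j) := by linarith
    have h3 : ((-(2 * k) - l : ℤ) : ℝ) * (2 * (2 : ℝ)⁻¹ ^ j) < 1 * (2 * (2 : ℝ)⁻¹ ^ j) := by
      linarith
    have h4 := pos_of_mul_pos_left h2 (by linarith)
    have h5 := lt_of_mul_lt_mul_right h3 (by linarith)
    have h6 : 0 < -(2 * k) - l := by exact_mod_cast h4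
    have h7 : -(2 * k) - l < 1 := by exact_mod_cast h5
    omega

theorem irrational_fract_two_pow_mul {α : ℝ} (hα : Irrational α) (N : ℕ) :
    Irrational (Int.fract (2 ^ N * α)) := by
  have h1 : Irrational ((2 ^ N : ℕ) * α) := hα.natCast_mul (pow_ne_zero N two_ne_zero)
  push_cast at h1
  rw [← Int.self_sub_floor]
  exact h1.sub_intCast _

theorem pow_mul_eq_fract_add (α : ℝ) (N t : ℕ) :
    (2 : ℝ) ^ (N + t) * α = 2 ^ t * Int.fract (2 ^ N * α) + ((2 ^ t * ⌊2 ^ N * α⌋ : ℤ) : ℝ) := by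
  push_cast
  rw [← Int.self_sub_floor, pow_add]
  ring

/-- A run of zeros in the binary expansion of `α` destroys all the earlier interruptions of the
interval before new ones can appear. -/
theorem exists_isSingleInterval_of_fract_lt {α : ℝ} (hα : Irrational α) {N : ℕ}
    (hN : 8 * (N + 1 : ℝ) * Int.fract (2 ^ N * α) < 1) :
    ∃ n ≥ N, ∃ a, IsSingleInterval α n a := by
  have hirr := irrational_fract_two_pow_mul hα N
  have hpow := pow_mul_eq_fract_add α N
  set β := Int.fract (2 ^ N * α) with hβdef
  set q := ⌊2 ^ N * α⌋ with hq
  have hβ : 0 < β := lt_of_le_of_ne (Int.fract_nonneg _) fun h1 => hirr ⟨0, by simp [← h1]⟩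
  have hN0 : (0 : ℝ) ≤ N := Nat.cast_nonneg N
  have hβ4 : β < 1 / 4 := by nlinarith
  -- `S` is the length of the run of zeros, and the interval is whole at `n = N + S + 2`.
  obtain ⟨S, hS1, hS2⟩ : ∃ S : ℕ, 2 ^ S * β < 1 / 4 ∧ 1 / 4 ≤ 2 ^ (S + 1) * β := by
    classical
    have hex : ∃ s : ℕ, 1 / 4 ≤ 2 ^ s * β := by
      obtain ⟨s, hs⟩ := pow_unbounded_of_one_lt (1 / 4 / β) one_lt_two
      exact ⟨s, by rw [div_lt_iff₀ hβ] at hs; exact hs.le⟩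
    have hne : Nat.find hex ≠ 0 := by
      intro h1
      have h2 := Nat.find_spec hex
      rw [h1] at h2
      simp only [pow_zero, one_mul] at h2
      linarith
    obtain ⟨s, hs⟩ := Nat.exists_eq_succ_of_ne_zero hne
    have h2 := Nat.find_spec hex
    rw [hs] at h2
    exact ⟨s, not_le.1 (Nat.find_min hex (m := s) (by omega)), h2⟩
  refine ⟨N + S + 2, by omega, (isSingleInterval_or_exists (by omega)).resolve_right ?_⟩
  rintro ⟨t, j, z, hj1, hjn, htj, hleft⟩
  rcases le_or_gt j N with hjN | hjN
  -- If `j ≤ N`, the height at `x = N + s + 2` is `2 ^ s * (m + s) * β` modulo `1`, which leaves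
  -- `(-1/4, 1/4]` for some `s ≤ S`; the factor `8` makes the initial value less than `1/4`.
  · obtain ⟨m, hm⟩ : ∃ m : ℕ, m + j = N + 2 := ⟨N + 2 - j, by omega⟩
    have hm2 : 2 ≤ m := by omega
    have hm2' : (2 : ℝ) ≤ m := by exact_mod_cast hm2
    have hmN : (m : ℝ) ≤ N + 1 := by
      have : m ≤ N + 1 := by omega
      exact_mod_cast this
    obtain ⟨s, hsS, hs1, hs2⟩ := exists_mem_Ico_quarter hβ hm2 (by nlinarith) (T := S) (by
      rw [pow_succ] at hS2
      have : (0 : ℝ) ≤ S := Nat.cast_nonneg S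
      have h2 : (2 : ℝ) ^ S * β * 2 ≤ 2 ^ S * β * (m + S) := by
        gcongr
        linarith
      linarith)
    obtain ⟨k, hk1, hk2⟩ := exists_mem_Ioc_quarter (n := N + s) (by
      exact hleft (N + s + 2) (by omega) (by omega))
    have hval : 2 ^ (N + s) * (t + (N + s + 2 : ℕ) * α) =
        2 ^ s * (m + s) * β +
          ((2 ^ (N + s - j) * (1 + 4 * z) + (m + s) * (2 ^ s * q) : ℤ) : ℝ) := by
      have h1 : (2 : ℝ) ^ (N + s) = 2 ^ (N + s - j) * 2 ^ j := by
        rw [← pow_add, Nat.sub_add_cancel (by omega)]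
      have h2 : (2 : ℝ) ^ j * 2⁻¹ ^ j = 1 := by rw [← mul_pow]; norm_num
      have h3 : t + (N + s + 2 : ℕ) * α = (2 : ℝ)⁻¹ ^ j * (1 + 4 * z) + (m + s) * α := by
        have h4 : ((N + s + 2 : ℕ) : ℝ) = j + (m + s) := by
          rw [show N + s + 2 = j + (m + s) by omega]; push_cast; ring
        rw [h4]
        linear_combination htj
      rw [h3, mul_add, mul_left_comm ((2 : ℝ) ^ (N + s)) ((m : ℝ) + s) α, hpow s, h1]
      push_cast
      linear_combination (2 : ℝ) ^ (N + s - j) * (1 + 4 * z) * h2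
    rw [hval, add_assoc, ← Int.cast_add] at hk1 hk2
    set K := 2 ^ (N + s - j) * (1 + 4 * z) + (m + s) * (2 ^ s * q) + k with hK
    have h1 : (-1 : ℝ) < K := by linarith
    have h2 : (K : ℝ) < 1 := by linarith
    have h3 : -1 < K := by exact_mod_cast h1
    have h4 : K < 1 := by exact_mod_cast h2
    have h5 : K = 0 := by omega
    rw [h5, Int.cast_zero, add_zero] at hk2
    have h6 : Irrational ((2 ^ s * (m + s) : ℕ) * β) :=
      hirr.natCast_mul (by positivity)
    refine h6 ⟨1 / 4, ?_⟩
    push_cast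
    linarith
  -- If `j = N + s + 1`, the height at the next aperture is `1/2 + 2 ^ s * β` modulo `1`, with
  -- `2 ^ s * β < 1/4`.
  · obtain ⟨s, rfl⟩ : ∃ s : ℕ, j = N + s + 1 := ⟨j - N - 1, by omega⟩
    have hsS : s ≤ S := by omega
    have hs1 : (2 : ℝ) ^ s * β < 1 / 4 := by
      have : (2 : ℝ) ^ s * β ≤ 2 ^ S * β := by
        gcongr
        norm_num
      linarith
    have hs0 : 0 < (2 : ℝ) ^ s * β := by positivity
    obtain ⟨k, hk1, hk2⟩ := exists_mem_Ioc_quarter (n := N + s) (by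
      exact hleft (N + s + 2) (by omega) (by omega))
    have hval : 2 ^ (N + s) * (t + (N + s + 2 : ℕ) * α) =
        1 / 2 + 2 ^ s * β + ((2 * z + 2 ^ s * q : ℤ) : ℝ) := by
      have h2 : (2 : ℝ) ^ (N + s) * 2⁻¹ ^ (N + s) = 1 := by rw [← mul_pow]; norm_num
      rw [pow_succ] at htj
      have h3 : t + (N + s + 2 : ℕ) * α =
          (2 : ℝ)⁻¹ ^ (N + s) * (1 / 2 + 2 * z) + α := by
        push_cast at htj ⊢
        linear_combination htj
      rw [h3, mul_add, hpow s]
      push_cast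
      linear_combination (1 / 2 + 2 * (z : ℝ)) * h2
    rw [hval, add_assoc, ← Int.cast_add] at hk1 hk2
    set K := 2 * z + 2 ^ s * q + k with hK
    have h1 : (-1 : ℝ) < K := by linarith
    have h2 : (K : ℝ) < 0 := by linarith
    have h3 : -1 < K := by exact_mod_cast h1
    have h4 : K < 0 := by exact_mod_cast h2
    omega

/-- The height at which an escape orbit crosses `L` for the last time is not the sum of a dyadic
rational and a nonnegative multiple of `α`. -/
theorem sub_mul_notMem_dyadic {α : ℝ} (hα : Irrational α)
    (hfr : ∃ᶠ N : ℕ in atTop, 8 * (N + 1 : ℝ) * Int.fract (2 ^ N * α) < 1) {y : ℝ}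
    (hy : ∀ n, y ∈ reach α n) (k : ℕ) : y - k * α ∉ dyadic := by
  rintro ⟨s, a, ha⟩
  obtain ⟨N, hNge, hN⟩ := frequently_atTop.1 hfr (max k s)
  have hNge := max_le_iff.1 hNge
  have hirr := irrational_fract_two_pow_mul hα N
  have hpow := pow_mul_eq_fract_add α N
  set β := Int.fract (2 ^ N * α) with hβdef
  set q := ⌊2 ^ N * α⌋ with hq
  have hβ : 0 < β := lt_of_le_of_ne (Int.fract_nonneg _) fun h1 => hirr ⟨0, by simp [← h1]⟩
  have hkN : (k : ℝ) ≤ N := by exact_mod_cast hNge.1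
  obtain ⟨T, hT⟩ := exists_nat_gt (1 / 4 / β)
  rw [div_lt_iff₀ hβ] at hT
  obtain ⟨t, -, ht1, ht2⟩ := exists_mem_Ico_quarter hβ (m := N + 2 + k) (by omega)
    (by push_cast; nlinarith) (T := T) (by
      have h1 : (1 : ℝ) ≤ 2 ^ T := one_le_pow₀ one_le_two
      have h2 : (T : ℝ) ≤ ((N + 2 + k : ℕ) : ℝ) + T := by
        have : (0 : ℝ) ≤ ((N + 2 + k : ℕ) : ℝ) := Nat.cast_nonneg _
        linarith
      have h3 : (1 : ℝ) * T ≤ 2 ^ T * (((N + 2 + k : ℕ) : ℝ) + T) := by gcongr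
      have h4 := mul_le_mul_of_nonneg_right h3 hβ.le
      linarith)
  obtain ⟨K, hK1, hK2⟩ := passesAperture_iff.1 (hy (N + t + 2) (N + t + 2) (by omega) le_rfl)
  have hval : 2 ^ (N + t) * (y + (N + t + 2 : ℕ) * α) =
      2 ^ t * ((N + 2 + k : ℕ) + t) * β +
        ((2 ^ (N + t - s) * a + (N + 2 + k + t) * (2 ^ t * q) : ℤ) : ℝ) := by
    have h1 : (2 : ℝ) ^ (N + t) = 2 ^ (N + t - s) * 2 ^ s := by
      rw [← pow_add, Nat.sub_add_cancel (by omega)]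
    have h2 : 2 ^ (N + t) * (y + (N + t + 2 : ℕ) * α) =
        2 ^ (N + t) * (y - k * α) + (N + 2 + k + t) * (2 ^ (N + t) * α) := by
      push_cast; ring
    rw [h2, hpow t, h1]
    push_cast
    linear_combination (2 : ℝ) ^ (N + t - s) * ha
  rw [hval, add_assoc, ← Int.cast_add] at hK1 hK2
  set K' := 2 ^ (N + t - s) * a + (N + 2 + k + t) * (2 ^ t * q) + K with hK'
  have h1 : (-1 : ℝ) < K' := by linarith
  have h2 : (K' : ℝ) < 0 := by linarith
  have h3 : -1 < K' := by exact_mod_cast h1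
  have h4 : K' < 0 := by exact_mod_cast h2
  omega

theorem mem_typicalDirections_of_frequently {α : ℝ} (h0 : 0 < α) (hα : Irrational α)
    (hfr : ∃ᶠ N : ℕ in atTop, 8 * (N + 1 : ℝ) * Int.fract (2 ^ N * α) < 1) :
    α ∈ typicalDirections := by
  refine ⟨h0, hα, ?_, fun y hy hE t ht hv => ?_⟩
  · refine frequently_atTop.2 fun N₀ => ?_
    obtain ⟨N, hN₀, hN⟩ := frequently_atTop.1 hfr N₀
    obtain ⟨n, hn, a, ha⟩ := exists_isSingleInterval_of_fract_lt hα hN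
    exact ⟨n, le_trans hN₀ hn, ha.numIntervals_eq⟩
  · have hs := speed_pos α
    rw [← mul_div_cancel_right₀ t hs.ne', flow_onL] at hv
    obtain ⟨i, hi, hd⟩ := exists_of_isVertex_travel hv
    have hi0 : i ≤ 0 := by
      have : (i : ℝ) ≤ 0 := by
        rw [← hi]; exact mul_nonpos_of_nonpos_of_nonneg ht hs.le
      exact_mod_cast this
    obtain ⟨k, hk⟩ := Int.eq_ofNat_of_zero_le (by omega : 0 ≤ -i)
    refine sub_mul_notMem_dyadic hα hfr (fun n => (mem_E_iff.1 (hE n)).2) k ?_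
    have h1 := step_pow_y_sub_mem_dyadic α ((step α ^ i) (edgeL y)) k
    rw [← step_zpow_natCast, ← step_zpow_add, show (k : ℤ) + i = 0 by omega, zpow_zero,
      Equiv.Perm.one_apply] at h1
    have h2 : (edgeL y).y = y := wrap_eq_self (by simpa using hy)
    rw [h2] at h1
    have h3 := dyadic.add_mem h1 hd
    convert h3 using 1
    ring

theorem ae_irrational : ∀ᵐ x : ℝ, Irrational x := by
  have h1 : (range ((↑) : ℚ → ℝ)).Countable := countable_range _
  exact h1.ae_notMem volume

end StepBilliard

open StepBilliard in
theorem mainTheorem6 :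
    (∀ᵐ α ∂(volume.restrict (Ioi (0 : ℝ))), α ∈ StepBilliard.typicalDirections) ∧
    ∀ α ∈ StepBilliard.typicalDirections, ∃ η η' : Set StepBilliard.Phase,
      (∀ O, StepBilliard.IsEscapeOrbit α O ↔ O = η) ∧
      (∀ O, StepBilliard.IsPastEscapeOrbit α O ↔ O = η') ∧
      η' ≠ η ∧
      (∀ z, StepBilliard.orbit α z ≠ η → η ⊆ omegaLimit atTop (StepBilliard.flow α) {z}) ∧
      (∀ z, StepBilliard.orbit α z ≠ η → StepBilliard.orbit α z ≠ η' →
        η ⊆ omegaLimit atBot (StepBilliard.flow α) {z}) ∧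
      (∀ z ∈ η, η ⊆ omegaLimit atBot (StepBilliard.flow α) {z}) ∧
      (∀ f : StepBilliard.Phase → ℝ, Continuous f →
        (∀ t z, f (StepBilliard.flow α t z) = f z) → ∃ c, ∀ z, f z = c) ∧
      (StepBilliard.IsMinimalFlow α ↔ Dense η) := by
  refine ⟨?_, fun α hα => ?_⟩
  · filter_upwards [ae_restrict_mem measurableSet_Ioi, ae_restrict_of_ae ae_irrational,
      ae_restrict_of_ae ae_frequently_fract_lt] with α h0 h1 h2
    exact mem_typicalDirections_of_frequently h0 h1 h2
  obtain ⟨y, H⟩ := exists_isTypical hα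
  have horb : ∀ z ∈ range ((edgeL y).travel α), orbit α z = range ((edgeL y).travel α) := by
    rintro _ ⟨u, rfl⟩
    exact orbit_travel α _ _
  have hcl : ∀ z, range ((edgeL y).travel α) ⊆ closure (orbit α z) := by
    intro z
    by_cases hz : orbit α z = range ((edgeL y).travel α)
    · rw [hz]; exact subset_closure
    · exact (H.subset_omegaLimit_atTop hz).trans omegaLimit_subset_closure_orbit
  refine ⟨range ((edgeL y).travel α), range ((edgeL (-y)).travel α), H.isEscapeOrbit_iff,
    H.isPastEscapeOrbit_iff, H.range_travel_ne, fun z hz => H.subset_omegaLimit_atTop hz,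
    fun z _ hz => H.subset_omegaLimit_atBot hz, fun z hz => ?_, fun f hf hinv => ?_, ?_, ?_⟩
  · refine H.subset_omegaLimit_atBot ?_
    rw [horb z hz]
    exact H.range_travel_ne.symm
  · refine ⟨f ((edgeL y).travel α 0), fun z => ?_⟩
    have h1 : closure (orbit α z) ⊆ {w | f w = f z} := by
      refine closure_minimal ?_ (isClosed_eq hf continuous_const)
      rintro _ ⟨t, rfl⟩
      exact hinv t z
    exact (h1 (hcl z (mem_range_self 0))).symm
  · intro hmin
    have := hmin ((edgeL y).travel α 0)
    rwa [orbit_travel] at this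
  · intro hd z
    exact dense_closure.1 (hd.mono (hcl z))
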